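/- **Setting.** LF has kinds $K ::= \mathrm{Type} \mid \Pi x{:}A.K$, types $A ::= u \mid \Pi x{:}A.B \mid \lambda x{:}A.B \mid A\,M$ and objects $M ::= x \mid \lambda x{:}A.M \mid M\,N$, taken up to renaming of bound variables, with $\beta$-reduction; $P^\beta$ is the $\beta$-normal form of $P$. The judgments $\Gamma\ \mathrm{ctx}$, $\Gamma\vdash K\ \mathrm{kind}$, $\Gamma\vdash A:K$, $\Gamma\vdash M:A$ are derived by the usual LF rules, in the formulation in which types and kinds on the right of the colon are kept in $\beta$-normal form (the application rules give $\Gamma\vdash M\,N:(B[N/x])^\beta$ and $\Gamma\vdash A\,M:(K[M/x])^\beta$, the variable rules give $x:A^\beta$ and $u:K^\beta$, and $\lambda x{:}A.P$ is classified by $\Pi x{:}A^\beta.Q$). An expression is *canonical* with respect to $\Gamma$ if it is $\beta$-normal and every variable occurrence in it is fully applied, i.e. has exactly as many arguments as the normal form of the variable's type or kind has leading $\Pi$s. A context is canonical if all types and kinds it assigns are. A *base type* is a well-formed, fully applied type $u\,M_1\cdots M_m$. *Encoding.* $hohh$ terms are simply typed $\lambda$-terms, with equality generated by $\beta$ and $\eta$.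 Put $\phi(A)=\mathit{lf\text{-}obj}$ for base types $A$, $\phi(\Pi x{:}A.P)=\phi(A)\to\phi(P)$, $\phi(\mathrm{Type})=\mathit{lf\text{-}type}$, and for canonical objects $\langle x\,M_1\cdots M_m\rangle = x\,\langle M_1\rangle\cdots\langle M_m\rangle$, $\langle\lambda x{:}A.M\rangle=\lambda^{\phi(A)}x.\langle M\rangle$. The signature of a context $\Gamma$ contains each variable declared in $\Gamma$, with the simple type $\phi$ of its type or kind. For $hohh$ terms $\vec t=t_1,\dots,t_n$ and variables $\vec x=x_1,\dots,x_n$, write $M\sim N$ for objects if $\langle M\rangle=\langle N\rangle[t_1/x_1,\dots,t_n/x_n]$; types, kinds and contexts are related by $\sim$ if they are equal up to $\sim$ on the objects within. *Rigid occurrences.* For a set $G$ of variables and a set $\delta$ of variables, $G;\delta;x\vdash_o M$ is generated by: (INIT) $G;\delta;x\vdash_o x\,y_1\cdots y_m$ if $y_1,\dots,y_m\in\delta$ are distinct variables; (APP) $G;\delta;x\vdash_o y\,M_1\cdots M_m$ if $y\notin G$ and $G;\delta;x\vdash_o M_k$ for some $k$; (ABS) $G;\delta;x\vdash_o\lambda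 y{:}A.M$ if $G;\delta,y;x\vdash_o M$. For types, $G;x\vdash_t A$ is generated by: $G;x\vdash_t u\,A_1\cdots A_m$ if $G;\cdot;x\vdash_o A_k$ for some $k$; and $G;x\vdash_t\Pi y{:}A.B$ if $G,y;x\vdash_t B$. **Lemma (rigid variables).** Let $\Gamma$ be a canonical context, $\Gamma_0 = x_1:B_1,\dots,x_n:B_n$ with each $B_j$ canonical with respect to $\Gamma,x_1:B_1,\dots,x_{j-1}:B_{j-1}$, and let $t_1,\dots,t_n$ be $hohh$ terms over the signature of $\Gamma$, with $t_j$ of type $\phi(B_j)$. Let $1\le i\le n$, and for $j<i$ let $t'_j$ be an LF object, canonical with respect to $\Gamma$, with $t_j=\langle t'_j\rangle$. Assume that $C=(B_i[t'_1/x_1,\dots,t'_{i-1}/x_{i-1}])^\beta$ exists and $\Gamma\vdash C:\mathrm{Type}$. 1. Let $\Delta,\Delta'$ be contexts, $M,M'$ objects and $A,A'$ types such that the context $\Gamma,\Gamma_0,\Delta$ and, with respect to it, $M$ and $A$ are canonical, and the context $\Gamma,\Delta'$ and, with respect to it, $M'$ and $A'$ are canonical. Suppose that $\vec x;\mathrm{dom}(\Delta);x_i\vdash_o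 M$, that $\Gamma,\Gamma_0,\Delta\vdash M:A$ and $\Gamma,\Delta'\vdash M':A'$, and that $A'\sim A$, $M'\sim M$ and $\Delta'\sim\Delta$. Then there is an LF object $t'_i$, canonical with respect to $\Gamma$, with $t_i=\langle t'_i\rangle$ and $\Gamma\vdash t'_i:C$. 2. Let $A$ be a base type such that $\Pi x_1{:}B_1.\dots\Pi x_n{:}B_n.A$ is canonical with respect to $\Gamma$. Suppose that $\Gamma\vdash\Pi x_1{:}B_1.\dots\Pi x_n{:}B_n.A:\mathrm{Type}$ and $\vec x;x_i\vdash_t A$, and that $\Gamma\vdash A':\mathrm{Type}$ for some type $A'$, canonical with respect to $\Gamma$, with $A'\sim A$. Then there is an LF object $t'_i$, canonical with respect to $\Gamma$, with $t_i=\langle t'_i\rangle$ and $\Gamma\vdash t'_i:C$. -/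

import Mathlib

namespace RigidLF

/-! ### LF expressions

Object variables are de Bruijn indices, so expressions that differ in the names of bound variables
are identified.  Binders bind object variables only; type variables are names. -/

/-- The three syntactic categories: kinds, types (type families) and objects. -/
inductive Cat where
  | kind | fam | obj

/-- LF expressions.
`K := Type | Πx:A.K`, `A := u | Πx:A.B | λx:A.B | A M`, `M := x | λx:A.M | M N`. -/
inductive Exp : Cat → Type where
  | typ : Exp Cat.kind
  | piK (A : Exp Cat.fam) (K : Exp Cat.kind) : Exp Cat.kind
  | tvar (u : ℕ) : Exp Cat.fam
  | pi (A : Exp Cat.fam) (B : Exp Cat.fam) : Exp Cat.fam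
  | lamF (A : Exp Cat.fam) (B : Exp Cat.fam) : Exp Cat.fam
  | appF (A : Exp Cat.fam) (M : Exp Cat.obj) : Exp Cat.fam
  | var (x : ℕ) : Exp Cat.obj
  | lam (A : Exp Cat.fam) (M : Exp Cat.obj) : Exp Cat.obj
  | app (M : Exp Cat.obj) (N : Exp Cat.obj) : Exp Cat.obj

abbrev Kind := Exp Cat.kind
abbrev Fam := Exp Cat.fam
abbrev Obj := Exp Cat.obj

/-- Lifting of a renaming of indices under a binder. -/
def upRen (r : ℕ → ℕ) : ℕ → ℕ
  | 0 => 0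
  | n + 1 => r n + 1

/-- Simultaneous renaming of the object variables. -/
def Exp.rename : {c : Cat} → (ℕ → ℕ) → Exp c → Exp c
  | _, _, .typ => .typ
  | _, r, .piK A K => .piK (A.rename r) (K.rename (upRen r))
  | _, _, .tvar u => .tvar u
  | _, r, .pi A B => .pi (A.rename r) (B.rename (upRen r))
  | _, r, .lamF A B => .lamF (A.rename r) (B.rename (upRen r))
  | _, r, .appF A M => .appF (A.rename r) (M.rename r)
  | _, r, .var x => .var (r x)
  | _, r, .lam A M => .lam (A.rename r) (M.rename (upRen r))
  | _, r, .app M N => .app (M.rename r) (N.rename r)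

/-- Weakening by one object variable. -/
def Exp.shift {c : Cat} (P : Exp c) : Exp c := P.rename Nat.succ

/-- Lifting of a substitution under a binder. -/
def upSubst (s : ℕ → Obj) : ℕ → Obj
  | 0 => .var 0
  | n + 1 => (s n).shift

/-- Simultaneous capture-avoiding substitution for the object variables. -/
def Exp.subst : {c : Cat} → (ℕ → Obj) → Exp c → Exp c
  | _, _, .typ => .typ
  | _, s, .piK A K => .piK (A.subst s) (K.subst (upSubst s))
  | _, _, .tvar u => .tvar u
  | _, s, .pi A B => .pi (A.subst s) (B.subst (upSubst s))
  | _, s, .lamF A B => .lamF (A.subst s) (B.subst (upSubst s))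
  | _, s, .appF A M => .appF (A.subst s) (M.subst s)
  | _, s, .var x => s x
  | _, s, .lam A M => .lam (A.subst s) (M.subst (upSubst s))
  | _, s, .app M N => .app (M.subst s) (N.subst s)

/-- The substitution `[a₁/x₁, …, aₘ/xₘ]` for the `m` most recent variables `x₁, …, xₘ` of a context
`Γ, x₁, …, xₘ`, the terms `aⱼ` living in `Γ`; the most recent variable `xₘ` has index `0`. -/
def instObj {m : ℕ} (a : Fin m → Obj) (k : ℕ) : Obj :=
  if h : k < m then a (Fin.rev ⟨k, h⟩) else .var (k - m)

/-- `P[N/x]` for the most recent variable `x`. -/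
def Exp.inst {c : Cat} (P : Exp c) (N : Obj) : Exp c := P.subst (instObj fun _ : Fin 1 => N)

/-- One-step `β`-reduction, anywhere in an expression. -/
inductive Step : {c : Cat} → Exp c → Exp c → Prop where
  | betaF (A B M) : Step (.appF (.lamF A B) M) (B.inst M)
  | beta (A M N) : Step (.app (.lam A M) N) (M.inst N)
  | piK₁ {A A'} (K) : Step A A' → Step (.piK A K) (.piK A' K)
  | piK₂ (A) {K K'} : Step K K' → Step (.piK A K) (.piK A K')
  | pi₁ {A A'} (B) : Step A A' → Step (.pi A B) (.pi A' B)
  | pi₂ (A) {B B'} : Step B B' → Step (.pi A B) (.pi A B')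
  | lamF₁ {A A'} (B) : Step A A' → Step (.lamF A B) (.lamF A' B)
  | lamF₂ (A) {B B'} : Step B B' → Step (.lamF A B) (.lamF A B')
  | appF₁ {A A'} (M) : Step A A' → Step (.appF A M) (.appF A' M)
  | appF₂ (A) {M M'} : Step M M' → Step (.appF A M) (.appF A M')
  | lam₁ {A A'} (M) : Step A A' → Step (.lam A M) (.lam A' M)
  | lam₂ (A) {M M'} : Step M M' → Step (.lam A M) (.lam A M')
  | app₁ {M M'} (N) : Step M M' → Step (.app M N) (.app M' N)
  | app₂ (M) {N N'} : Step N N' → Step (.app M N) (.app M N')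

/-- `P` is in `β`-normal form. -/
def Normal {c : Cat} (P : Exp c) : Prop := ∀ Q, ¬ Step P Q

/-- `Q` is the `β`-normal form of `P`, i.e. `Q = P^β`. -/
def NormalFormOf {c : Cat} (P Q : Exp c) : Prop := Relation.ReflTransGen Step P Q ∧ Normal Q

/-! ### LF contexts and assertions -/

/-- An assignment `u : K` or `x : A`. -/
inductive Entry where
  | fam (u : ℕ) (K : Kind)
  | obj (A : Fam)

/-- Contexts, the most recent assignment first: `Γ, Δ` is `Δ ++ Γ`. -/
abbrev Ctx := List Entry

/-- `FamIn Γ u K`: the assignment `u : K` is in `Γ` (with `K` weakened to `Γ`). -/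
inductive FamIn : Ctx → ℕ → Kind → Prop where
  | here (Γ u K) : FamIn (.fam u K :: Γ) u K
  | skipFam {Γ u K} (v L) : FamIn Γ u K → FamIn (.fam v L :: Γ) u K
  | skipObj {Γ u K} (B) : FamIn Γ u K → FamIn (.obj B :: Γ) u K.shift

/-- `ObjIn Γ x A`: the assignment `x : A` is in `Γ` (with `A` weakened to `Γ`).
Indices count the object variables only. -/
inductive ObjIn : Ctx → ℕ → Fam → Prop where
  | here (Γ A) : ObjIn (.obj A :: Γ) 0 A.shift
  | skipFam {Γ x A} (v L) : ObjIn Γ x A → ObjIn (.fam v L :: Γ) x A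
  | skipObj {Γ x A} (B) : ObjIn Γ x A → ObjIn (.obj B :: Γ) (x + 1) A.shift

/-- The four forms of assertions: `Γ ctx`, `K kind`, `A : K`, `M : A`. -/
inductive Assertion where
  | ctx
  | kind (K : Kind)
  | fam (A : Fam) (K : Kind)
  | obj (M : Obj) (A : Fam)

/-- Derivability of LF assertions. -/
inductive Derives : Ctx → Assertion → Prop where
  | nullCtx : Derives [] .ctx
  | kindCtx {Γ u K} : Derives Γ (.kind K) → Derives Γ .ctx → (∀ L, ¬ FamIn Γ u L) →
      Derives (.fam u K :: Γ) .ctx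
  | typeCtx {Γ A} : Derives Γ (.fam A .typ) → Derives Γ .ctx → Derives (.obj A :: Γ) .ctx
  | typeKind {Γ} : Derives Γ .ctx → Derives Γ (.kind .typ)
  | piKind {Γ A K} : Derives Γ (.fam A .typ) → Derives (.obj A :: Γ) (.kind K) →
      Derives Γ (.kind (.piK A K))
  | varFam {Γ u K K'} : Derives Γ .ctx → FamIn Γ u K → NormalFormOf K K' →
      Derives Γ (.fam (.tvar u) K')
  | varObj {Γ x A A'} : Derives Γ .ctx → ObjIn Γ x A → NormalFormOf A A' →
      Derives Γ (.obj (.var x) A')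
  | piFam {Γ A B} : Derives Γ (.fam A .typ) → Derives (.obj A :: Γ) (.fam B .typ) →
      Derives Γ (.fam (.pi A B) .typ)
  | absFam {Γ A A' B K} : Derives Γ (.fam A .typ) → Derives (.obj A :: Γ) (.fam B K) →
      NormalFormOf A A' → Derives Γ (.fam (.lamF A B) (.piK A' K))
  | appFam {Γ A B K K' M} : Derives Γ (.fam A (.piK B K)) → Derives Γ (.obj M B) →
      NormalFormOf (K.inst M) K' → Derives Γ (.fam (.appF A M) K')
  | absObj {Γ A A' M B} : Derives Γ (.fam A .typ) → Derives (.obj A :: Γ) (.obj M B) →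
      NormalFormOf A A' → Derives Γ (.obj (.lam A M) (.pi A' B))
  | appObj {Γ M N A B B'} : Derives Γ (.obj M (.pi A B)) → Derives Γ (.obj N A) →
      NormalFormOf (B.inst N) B' → Derives Γ (.obj (.app M N) B')

/-! ### Canonical expressions -/

/-- The length of the prefix of `Π`s of a type or kind. -/
def Exp.piCount : {c : Cat} → Exp c → ℕ
  | _, .piK _ K => K.piCount + 1
  | _, .pi _ B => B.piCount + 1
  | _, _ => 0

/-- `FullyApplied Γ P k`: when `P` stands at a position where it is applied to exactly `k` arguments,
every variable occurrence in `P` is fully applied, i.e. has as many arguments as there are `Π`s in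
the prefix of the normal form of the type or kind of the variable. -/
def FullyApplied : {c : Cat} → Ctx → Exp c → ℕ → Prop
  | _, _, .typ, _ => True
  | _, Γ, .piK A K, _ => FullyApplied Γ A 0 ∧ FullyApplied (.obj A :: Γ) K 0
  | _, Γ, .tvar u, k => ∃ K K', FamIn Γ u K ∧ NormalFormOf K K' ∧ K'.piCount = k
  | _, Γ, .pi A B, _ => FullyApplied Γ A 0 ∧ FullyApplied (.obj A :: Γ) B 0
  | _, Γ, .lamF A B, _ => FullyApplied Γ A 0 ∧ FullyApplied (.obj A :: Γ) B 0
  | _, Γ, .appF A M, k => FullyApplied Γ A (k + 1) ∧ FullyApplied Γ M 0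
  | _, Γ, .var x, k => ∃ A A', ObjIn Γ x A ∧ NormalFormOf A A' ∧ A'.piCount = k
  | _, Γ, .lam A M, _ => FullyApplied Γ A 0 ∧ FullyApplied (.obj A :: Γ) M 0
  | _, Γ, .app M N, k => FullyApplied Γ M (k + 1) ∧ FullyApplied Γ N 0

/-- `P` is canonical with respect to `Γ`. -/
def Canonical {c : Cat} (Γ : Ctx) (P : Exp c) : Prop := Normal P ∧ FullyApplied Γ P 0

/-- Every type or kind that the context assigns is canonical. -/
def CanonicalCtx : Ctx → Prop
  | [] => True
  | .fam _ K :: Γ => Canonical Γ K ∧ CanonicalCtx Γ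
  | .obj A :: Γ => Canonical Γ A ∧ CanonicalCtx Γ

/-- The shape `u M₁ … Mₙ` of a base type. -/
inductive IsAtomic : Fam → Prop where
  | tvar (u) : IsAtomic (.tvar u)
  | appF {A} (M) : IsAtomic A → IsAtomic (.appF A M)

/-- The context `x₁ : B₁, …, xₙ : Bₙ`, where `Bⱼ` may mention `x₁, …, xⱼ₋₁`. -/
def teleCtx {n : ℕ} (B : Fin n → Fam) : Ctx := (List.ofFn fun j => Entry.obj (B j)).reverse

/-- `Πx₁:B₁. … Πxₙ:Bₙ. A`. -/
def pis {n : ℕ} (B : Fin n → Fam) (A : Fam) : Fam := (List.ofFn B).foldr Exp.pi A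

/-! ### Simply typed terms of the `hohh` logic -/

/-- Simple types; the atomic types are `o`, `lf-obj` and `lf-type`. -/
inductive HTy where
  | o | lfObj | lfType
  | arr (a b : HTy)

/-- The logical constants `⊤`, `⊃` and, for each type `a`, the quantifier over `a`. -/
inductive LogConst where
  | top | imp
  | all (a : HTy)

/-- The type of a logical constant. -/
def LogConst.ty : LogConst → HTy
  | .top => .o
  | .imp => .arr .o (.arr .o .o)
  | .all a => .arr (.arr a .o) .o

/-- Terms.  Type-level LF symbols are reused as constants `con u`, object-level LF symbols and
bound variables are indices. -/
inductive Tm where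
  | var (x : ℕ)
  | con (u : ℕ)
  | log (c : LogConst)
  | lam (a : HTy) (s : Tm)
  | app (s t : Tm)

/-- Simultaneous renaming of the variables. -/
def Tm.rename : (ℕ → ℕ) → Tm → Tm
  | r, .var x => .var (r x)
  | _, .con u => .con u
  | _, .log c => .log c
  | r, .lam a s => .lam a (s.rename (upRen r))
  | r, .app s t => .app (s.rename r) (t.rename r)

/-- Weakening by one variable. -/
def Tm.shift (s : Tm) : Tm := s.rename Nat.succ

/-- Lifting of a substitution under a binder. -/
def upTm (s : ℕ → Tm) : ℕ → Tm
  | 0 => .var 0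
  | n + 1 => (s n).shift

/-- Simultaneous capture-avoiding substitution. -/
def Tm.subst : (ℕ → Tm) → Tm → Tm
  | s, .var x => s x
  | _, .con u => .con u
  | _, .log c => .log c
  | s, .lam a r => .lam a (r.subst (upTm s))
  | s, .app r t => .app (r.subst s) (t.subst s)

/-- The substitution `[t₁/x₁, …, tₘ/xₘ]` for the `m` most recent variables. -/
def instTm {m : ℕ} (t : Fin m → Tm) (k : ℕ) : Tm :=
  if h : k < m then t (Fin.rev ⟨k, h⟩) else .var (k - m)

/-- `s[t/x]` for the most recent variable `x`. -/
def Tm.inst (s t : Tm) : Tm := s.subst (instTm fun _ : Fin 1 => t)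

/-- `HasTy S Θ s a`: the term `s` has type `a`, where `S` declares the constants and `Θ` lists the
types of the variables, the most recent first. -/
inductive HasTy (S : List (ℕ × HTy)) : List HTy → Tm → HTy → Prop where
  | var {Θ x a} : Θ[x]? = some a → HasTy S Θ (.var x) a
  | con {Θ u a} : (u, a) ∈ S → HasTy S Θ (.con u) a
  | log {Θ} (c) : HasTy S Θ (.log c) c.ty
  | lam {Θ a b s} : HasTy S (a :: Θ) s b → HasTy S Θ (.lam a s) (.arr a b)
  | app {Θ a b s t} : HasTy S Θ s (.arr a b) → HasTy S Θ t a → HasTy S Θ (.app s t) b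

/-- Equality of terms of a given type, generated by `β` and `η`. -/
inductive TmEq (S : List (ℕ × HTy)) : List HTy → Tm → Tm → HTy → Prop where
  | refl {Θ s a} : HasTy S Θ s a → TmEq S Θ s s a
  | symm {Θ s t a} : TmEq S Θ s t a → TmEq S Θ t s a
  | trans {Θ s t r a} : TmEq S Θ s t a → TmEq S Θ t r a → TmEq S Θ s r a
  | lam {Θ a b s t} : TmEq S (a :: Θ) s t b → TmEq S Θ (.lam a s) (.lam a t) (.arr a b)
  | app {Θ a b s s' t t'} : TmEq S Θ s s' (.arr a b) → TmEq S Θ t t' a →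
      TmEq S Θ (.app s t) (.app s' t') b
  | beta {Θ a b s t} : HasTy S (a :: Θ) s b → HasTy S Θ t a →
      TmEq S Θ (.app (.lam a s) t) (s.inst t) b
  | eta {Θ a b s} : HasTy S Θ s (.arr a b) →
      TmEq S Θ (.lam a (.app s.shift (.var 0))) s (.arr a b)

/-! ### The encoding of LF expressions -/

/-- The simple type `φ(P)` of a kind or type: `φ(A) = lf-obj` for a base type `A`,
`φ(Πx:A.P) = φ(A) → φ(P)` and `φ(Type) = lf-type`.  It is meant for canonical `P`
classifying something. -/
def Exp.phi : {c : Cat} → Exp c → HTy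
  | _, .typ => .lfType
  | _, .piK A K => .arr A.phi K.phi
  | _, .pi A B => .arr A.phi B.phi
  | _, _ => .lfObj

/-- The encoding `⟨P⟩` of an object or a base type `P`.  The value `⊤` at expressions with `Type` or
`Π` at the head, which have no encoding, is a dummy. -/
def enc : {c : Cat} → Exp c → Tm
  | _, .tvar u => .con u
  | _, .lamF A B => .lam A.phi (enc B)
  | _, .appF A M => .app (enc A) (enc M)
  | _, .var x => .var x
  | _, .lam A M => .lam A.phi (enc M)
  | _, .app M N => .app (enc M) (enc N)
  | _, _ => .log .top

/-- The `hohh` types of the type-level symbols of a context. -/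
def famSig : Ctx → List (ℕ × HTy)
  | [] => []
  | .fam u K :: Γ => (u, K.phi) :: famSig Γ
  | .obj _ :: Γ => famSig Γ

/-- The `hohh` types of the object-level symbols of a context. -/
def objSig : Ctx → List HTy
  | [] => []
  | .fam _ _ :: Γ => objSig Γ
  | .obj A :: Γ => A.phi :: objSig Γ

/-- The number of object variables of a context. -/
def objCount (Γ : Ctx) : ℕ := (objSig Γ).length

/-- `Sim S Θ σ P Q` is `(P ∼ Q)σ` for a substitution `σ` of `hohh` terms over the signature `S, Θ`:
for objects, the encoding of `P` equals the `σ`-instance of the encoding of `Q`; types and kinds are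
equal up to this relation on the objects within. -/
inductive Sim (S : List (ℕ × HTy)) :
    {c : Cat} → List HTy → (ℕ → Tm) → Exp c → Exp c → Prop where
  | obj {Θ σ} {M N : Obj} {a} : TmEq S Θ (enc M) ((enc N).subst σ) a → Sim S Θ σ M N
  | typ {Θ σ} : Sim S Θ σ .typ .typ
  | piK {Θ σ A A' K K'} : Sim S Θ σ A' A → Sim S (A'.phi :: Θ) (upTm σ) K' K →
      Sim S Θ σ (.piK A' K') (.piK A K)
  | tvar {Θ σ} (u) : Sim S Θ σ (.tvar u) (.tvar u)
  | pi {Θ σ A A' B B'} : Sim S Θ σ A' A → Sim S (A'.phi :: Θ) (upTm σ) B' B →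
      Sim S Θ σ (.pi A' B') (.pi A B)
  | lamF {Θ σ A A' B B'} : Sim S Θ σ A' A → Sim S (A'.phi :: Θ) (upTm σ) B' B →
      Sim S Θ σ (.lamF A' B') (.lamF A B)
  | appF {Θ σ A A' M M'} : Sim S Θ σ A' A → Sim S Θ σ M' M →
      Sim S Θ σ (.appF A' M') (.appF A M)

/-- `ExpSim Γ t Δ' P' P` is `(P' ∼ P)[t₁/x₁, …, tₙ/xₙ]` for `P'` over `Γ, Δ'` and `P` over
`Γ, x₁, …, xₙ, Δ`, where `Δ'` and `Δ` declare the same variables and the `tⱼ` are terms over `Γ`. -/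
def ExpSim {c : Cat} {n : ℕ} (Γ : Ctx) (t : Fin n → Tm) (Δ' : Ctx) (P' P : Exp c) : Prop :=
  Sim (famSig (Δ' ++ Γ)) (objSig (Δ' ++ Γ)) (upTm^[objCount Δ'] (instTm t)) P' P

/-- `(Δ' ∼ Δ)[t₁/x₁, …, tₙ/xₙ]` for contexts declaring the same variables. -/
inductive CtxSim {n : ℕ} (Γ : Ctx) (t : Fin n → Tm) : Ctx → Ctx → Prop where
  | nil : CtxSim Γ t [] []
  | fam {Δ' Δ K' K} (u) : CtxSim Γ t Δ' Δ → ExpSim Γ t Δ' K' K →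
      CtxSim Γ t (.fam u K' :: Δ') (.fam u K :: Δ)
  | obj {Δ' Δ A' A} : CtxSim Γ t Δ' Δ → ExpSim Γ t Δ' A' A →
      CtxSim Γ t (.obj A' :: Δ') (.obj A :: Δ)

/-! ### Rigid occurrences -/

/-- `M N₁ … Nₘ`. -/
def apps (M : Obj) (Ns : List Obj) : Obj := Ns.foldl Exp.app M

/-- `A N₁ … Nₘ` for a type family `A`. -/
def appsF (A : Fam) (Ns : List Obj) : Fam := Ns.foldl Exp.appF A

/-- `RigidObj G δ x M`: the judgment `G; δ; x ⊢ M` of a rigid occurrence of `x` in the object `M`.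
Sets of variables are shifted when a binder is crossed. -/
inductive RigidObj : Set ℕ → Set ℕ → ℕ → Obj → Prop where
  | init {G δ x} (ys : List ℕ) : (∀ y ∈ ys, y ∈ δ) → ys.Nodup →
      RigidObj G δ x (apps (.var x) (ys.map Exp.var))
  | app {G δ x y Ms M} : y ∉ G → M ∈ Ms → RigidObj G δ x M →
      RigidObj G δ x (apps (.var y) Ms)
  | abs {G δ x A M} : RigidObj (Nat.succ '' G) (insert 0 (Nat.succ '' δ)) (x + 1) M →
      RigidObj G δ x (.lam A M)

/-- `RigidFam G x A`: the judgment `G; x ⊢ A` of a rigid occurrence of `x` in the type `A`. -/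
inductive RigidFam : Set ℕ → ℕ → Fam → Prop where
  | app {G x c Ms M} : M ∈ Ms → RigidObj G ∅ x M → RigidFam G x (appsF (.tvar c) Ms)
  | pi {G x A B} : RigidFam (insert 0 (Nat.succ '' G)) (x + 1) B → RigidFam G x (.pi A B)

end RigidLF

/-!
# Rigid variables and the recovery of LF instances

Let `x` be one of the variables `x₁, …, xₙ`, `τ` the `hohh` term substituted for it, and `C` the
type over `Γ` that an LF instance of `x` must have.  Along a rigid occurrence of `x` in `M`, the
relation `M' ∼ M` can be followed downwards:

* at an abstraction both sides are abstractions and the bound variable is added on both sides;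
* at an application `y M₁ ⋯ Mₘ` with a head `y` that is not substituted for, both sides have the
  same head, because the encodings of canonical objects are `η`-long `β`-normal forms and these
  are unique for equal terms; hence the arguments correspond.  Their types correspond as well,
  since they arise from the related types of the head by instantiation with related arguments
  (`CtxRel.corr_args`, and `CtxRel.corr_argsF` for a head that is a type variable);
* at `x y₁ ⋯ yₘ` with distinct bound variables `yₖ`, the term `τ y₁ ⋯ yₘ` is equal to the encoding
  of a canonical LF object whose type corresponds to that of `x y₁ ⋯ yₘ`.  As the `yₖ` are fresh
  for `τ`, abstracting them one after the other turns this object into a canonical object of type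
  `C` whose encoding is `τ` (`TermOf.recovered`).

The whole descent is `RigidObj.recovered`.

The encoding keeps only the simple types of bound variables, so the last step has to recover the
annotations of abstractions.  They are determined by the type: two canonical types that correspond
to the same type are equal (`Derives.eq_of_sim`, which rests on `Derives.eq_of_enc` for objects),
and a canonical object whose encoding does not mention a variable of the context, and whose type
does not either, lives in the smaller context (`Derives.strengthen`).

Three bodies of theory carry this.

* For `hohh` terms: existence and uniqueness of long normal forms with respect to `βη`-equality
  (`TmEq.exists_ev`, `Ev.det`), by a Kripke logical relation `LR`.
* For LF: confluence, weak normalization of simply typed expressions (`ST.wn`), the substitution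
  lemma (`Derives.subst`), subject reduction (`Step.inherits`) and, as their consequence,
  well-formedness of the type of a normal object (`Derives.wf_type`).  The classifiers in the
  rules are normal forms, so the substitution lemma has to produce normal forms; simple types, to
  which well-typed expressions erase by `φ`, provide them.
* For the objects `t'ⱼ`, which are canonical but, apart from their encoding, not assumed to be
  well typed: the notions `Long` and `NoRedF`.  They are stable under substitution and
  `β`-reduction without any typing and suffice to carry `φ`, `∼` and full application over to the
  normal form `C` (`TeleHyp.termOf`, `TeleHyp.sim`); `Derives.full` returns from `Long` to full
  application.
-/

namespace RigidLF

open Relation (ReflTransGen)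

/-! ### Calculus of renamings and substitutions -/

/-- The assignment of `u` to the most recent variable and of `σ x` to the variable before it that
has index `x`. -/
def cons {α : Type} (u : α) (σ : ℕ → α) : ℕ → α
  | 0 => u
  | x + 1 => σ x

theorem upRen_comp (r r' : ℕ → ℕ) : (fun x => upRen r (upRen r' x)) = upRen fun x => r (r' x) := by
  funext x; cases x <;> rfl

theorem upRen_id : upRen (fun x => x) = fun x => x := by
  funext x; cases x <;> rfl

theorem upRen_injective {r : ℕ → ℕ} (h : Function.Injective r) : Function.Injective (upRen r) := by
  intro x y hxy
  cases x <;> cases y <;> simp_all [upRen]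
  exact h hxy

namespace Exp

theorem rename_rename {c : Cat} (P : Exp c) (r r' : ℕ → ℕ) :
    (P.rename r).rename r' = P.rename fun x => r' (r x) := by
  induction P generalizing r r' <;> simp_all [rename, upRen_comp]

theorem rename_id {c : Cat} (P : Exp c) : P.rename (fun x => x) = P := by
  induction P <;> simp_all [rename, upRen_id]

theorem rename_injective {c : Cat} (P Q : Exp c) {r : ℕ → ℕ} (hr : Function.Injective r)
    (h : P.rename r = Q.rename r) : P = Q := by
  induction P generalizing r with
  | typ => cases Q <;> simp_all [rename]
  | piK A K ihA ihK =>
    cases Q <;> simp_all [rename]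
    exact ⟨ihA _ hr h.1, ihK _ (upRen_injective hr) h.2⟩
  | tvar u => cases Q <;> simp_all [rename]
  | pi A K ihA ihK =>
    cases Q <;> simp_all [rename]
    exact ⟨ihA _ hr h.1, ihK _ (upRen_injective hr) h.2⟩
  | lamF A K ihA ihK =>
    cases Q <;> simp_all [rename]
    exact ⟨ihA _ hr h.1, ihK _ (upRen_injective hr) h.2⟩
  | appF A K ihA ihK =>
    cases Q <;> simp_all [rename]
    exact ⟨ihA _ hr h.1, ihK _ hr h.2⟩
  | var x =>
    cases Q <;> simp_all [rename]
    exact hr h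
  | lam A K ihA ihK =>
    cases Q <;> simp_all [rename]
    exact ⟨ihA _ hr h.1, ihK _ (upRen_injective hr) h.2⟩
  | app A K ihA ihK =>
    cases Q <;> simp_all [rename]
    exact ⟨ihA _ hr h.1, ihK _ hr h.2⟩

theorem shift_rename {c : Cat} (P : Exp c) (r : ℕ → ℕ) :
    P.shift.rename (upRen r) = (P.rename r).shift := by
  simp only [shift, rename_rename]; rfl

end Exp

theorem upSubst_upRen (s : ℕ → Obj) (r : ℕ → ℕ) :
    (fun x => upSubst s (upRen r x)) = upSubst fun x => s (r x) := by
  funext x; cases x <;> rfl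

theorem upSubst_rename (s : ℕ → Obj) (r : ℕ → ℕ) :
    (fun x => (upSubst s x).rename (upRen r)) = upSubst fun x => (s x).rename r := by
  funext x; cases x
  · rfl
  · exact Exp.shift_rename _ _

theorem upSubst_var : upSubst Exp.var = Exp.var := by
  funext x; cases x <;> rfl

namespace Exp

theorem subst_rename_left {c : Cat} (P : Exp c) (r : ℕ → ℕ) (s : ℕ → Obj) :
    (P.rename r).subst s = P.subst fun x => s (r x) := by
  induction P generalizing r s <;> simp_all [rename, subst, upSubst_upRen]

theorem rename_subst {c : Cat} (P : Exp c) (s : ℕ → Obj) (r : ℕ → ℕ) :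
    (P.subst s).rename r = P.subst fun x => (s x).rename r := by
  induction P generalizing r s <;> simp_all [rename, subst, upSubst_rename]

theorem subst_var {c : Cat} (P : Exp c) : P.subst .var = P := by
  induction P <;> simp_all [subst, upSubst_var]

theorem rename_eq_subst {c : Cat} (P : Exp c) (r : ℕ → ℕ) :
    P.rename r = P.subst fun x => .var (r x) := by
  rw [← subst_rename_left, subst_var]

theorem shift_subst {c : Cat} (P : Exp c) (s : ℕ → Obj) :
    P.shift.subst (upSubst s) = (P.subst s).shift := by
  simp only [shift, subst_rename_left, rename_subst]; rfl

end Exp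

theorem upSubst_subst (s s' : ℕ → Obj) :
    (fun x => (upSubst s x).subst (upSubst s')) = upSubst fun x => (s x).subst s' := by
  funext x; cases x
  · rfl
  · exact Exp.shift_subst _ _

namespace Exp

theorem subst_subst {c : Cat} (P : Exp c) (s s' : ℕ → Obj) :
    (P.subst s).subst s' = P.subst fun x => (s x).subst s' := by
  induction P generalizing s s' <;> simp_all [subst, upSubst_subst]

end Exp

@[simp] theorem instObj_zero (N : Obj) : instObj (fun _ : Fin 1 => N) 0 = N := rfl

@[simp] theorem instObj_succ (N : Obj) (x : ℕ) : instObj (fun _ : Fin 1 => N) (x + 1) = .var x := by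
  simp [instObj]

namespace Exp

theorem shift_inst {c : Cat} (P : Exp c) (N : Obj) : P.shift.inst N = P := by
  simp only [shift, inst, subst_rename_left, Nat.succ_eq_add_one, instObj_succ]
  exact subst_var P

theorem inst_rename {c : Cat} (P : Exp c) (N : Obj) (r : ℕ → ℕ) :
    (P.inst N).rename r = (P.rename (upRen r)).inst (N.rename r) := by
  simp only [inst, rename_subst, subst_rename_left]
  congr 1; funext x; cases x <;> simp [upRen, rename]

/-- Substitution under a binder followed by instantiation is one simultaneous substitution. -/
theorem subst_up_inst {c : Cat} (P : Exp c) (s : ℕ → Obj) (N : Obj) :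
    (P.subst (upSubst s)).inst N = P.subst (cons N s) := by
  simp only [inst, subst_subst]
  congr 1; funext x; cases x
  · simp [upSubst, subst, cons]
  · exact shift_inst _ _

theorem inst_subst {c : Cat} (P : Exp c) (N : Obj) (s : ℕ → Obj) :
    (P.inst N).subst s = (P.subst (upSubst s)).inst (N.subst s) := by
  rw [subst_up_inst]
  simp only [inst, subst_subst]
  congr 1; funext x; cases x <;> simp [subst, cons]

theorem inst_var {c : Cat} (P : Exp c) (y : ℕ) :
    P.inst (.var y) = P.rename (cons y fun x => x) := by
  rw [rename_eq_subst, inst]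
  congr 1; funext x; cases x <;> simp [cons]

/-- Renaming under a binder and then naming the bound variable. -/
theorem rename_up_inst_var {c : Cat} (P : Exp c) (r : ℕ → ℕ) (y : ℕ) :
    (P.rename (upRen r)).inst (.var y) = P.rename (cons y r) := by
  rw [inst_var, rename_rename]
  congr 1; funext x; cases x <;> rfl

theorem phi_rename {c : Cat} (P : Exp c) (r : ℕ → ℕ) : (P.rename r).phi = P.phi := by
  induction P generalizing r <;> simp_all [rename, phi]

theorem phi_shift {c : Cat} (P : Exp c) : P.shift.phi = P.phi := phi_rename P _

theorem phi_subst {c : Cat} (P : Exp c) (hc : c ≠ .obj) (s : ℕ → Obj) :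
    (P.subst s).phi = P.phi := by
  induction P generalizing s <;> simp_all [subst, phi]

theorem phi_subst_fam (A : Fam) (s : ℕ → Obj) : (A.subst s).phi = A.phi := phi_subst A nofun s

end Exp

/-! ### Renaming and substitution in `hohh` terms -/

namespace Tm

theorem rename_rename (P : Tm) (r r' : ℕ → ℕ) :
    (P.rename r).rename r' = P.rename fun x => r' (r x) := by
  induction P generalizing r r' <;> simp_all [rename, upRen_comp]

theorem rename_id (P : Tm) : P.rename (fun x => x) = P := by
  induction P <;> simp_all [rename, upRen_id]

theorem rename_injective (P Q : Tm) {r : ℕ → ℕ} (hr : Function.Injective r)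
    (h : P.rename r = Q.rename r) : P = Q := by
  induction P generalizing r Q with
  | var x =>
    cases Q <;> simp_all [rename]
    exact hr h
  | con u => cases Q <;> simp_all [rename]
  | log u => cases Q <;> simp_all [rename]
  | lam A K ihK =>
    cases Q <;> simp_all [rename]
    exact ihK _ (upRen_injective hr) h.2
  | app A K ihA ihK =>
    cases Q <;> simp_all [rename]
    exact ⟨ihA _ hr h.1, ihK _ hr h.2⟩

theorem shift_rename (P : Tm) (r : ℕ → ℕ) :
    P.shift.rename (upRen r) = (P.rename r).shift := by
  simp only [shift, rename_rename]; rfl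

end Tm

theorem upTm_upRen (s : ℕ → Tm) (r : ℕ → ℕ) :
    (fun x => upTm s (upRen r x)) = upTm fun x => s (r x) := by
  funext x; cases x <;> rfl

theorem upTm_rename (s : ℕ → Tm) (r : ℕ → ℕ) :
    (fun x => (upTm s x).rename (upRen r)) = upTm fun x => (s x).rename r := by
  funext x; cases x
  · rfl
  · exact Tm.shift_rename _ _

theorem upTm_var : upTm Tm.var = Tm.var := by
  funext x; cases x <;> rfl

namespace Tm

theorem subst_rename_left (P : Tm) (r : ℕ → ℕ) (s : ℕ → Tm) :
    (P.rename r).subst s = P.subst fun x => s (r x) := by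
  induction P generalizing r s <;> simp_all [rename, subst, upTm_upRen]

theorem rename_subst (P : Tm) (s : ℕ → Tm) (r : ℕ → ℕ) :
    (P.subst s).rename r = P.subst fun x => (s x).rename r := by
  induction P generalizing r s <;> simp_all [rename, subst, upTm_rename]

theorem subst_var (P : Tm) : P.subst .var = P := by
  induction P <;> simp_all [subst, upTm_var]

theorem shift_subst (P : Tm) (s : ℕ → Tm) :
    P.shift.subst (upTm s) = (P.subst s).shift := by
  simp only [shift, subst_rename_left, rename_subst]; rfl

end Tm

theorem upTm_subst (s s' : ℕ → Tm) :
    (fun x => (upTm s x).subst (upTm s')) = upTm fun x => (s x).subst s' := by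
  funext x; cases x
  · rfl
  · exact Tm.shift_subst _ _

namespace Tm

theorem subst_subst (P : Tm) (s s' : ℕ → Tm) :
    (P.subst s).subst s' = P.subst fun x => (s x).subst s' := by
  induction P generalizing s s' <;> simp_all [subst, upTm_subst]

end Tm

@[simp] theorem instTm_zero (N : Tm) : instTm (fun _ : Fin 1 => N) 0 = N := rfl

@[simp] theorem instTm_succ (N : Tm) (x : ℕ) : instTm (fun _ : Fin 1 => N) (x + 1) = .var x := by
  simp [instTm]

namespace Tm

theorem shift_inst (P N : Tm) : P.shift.inst N = P := by
  simp only [shift, inst, subst_rename_left, Nat.succ_eq_add_one, instTm_succ]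
  exact subst_var P

theorem inst_rename (P N : Tm) (r : ℕ → ℕ) :
    (P.inst N).rename r = (P.rename (upRen r)).inst (N.rename r) := by
  simp only [inst, rename_subst, subst_rename_left]
  congr 1; funext x; cases x <;> simp [upRen, rename]

/-- Substitution under a binder followed by instantiation is one simultaneous substitution. -/
theorem subst_up_inst (P : Tm) (s : ℕ → Tm) (N : Tm) :
    (P.subst (upTm s)).inst N = P.subst (cons N s) := by
  simp only [inst, subst_subst]
  congr 1; funext x; cases x
  · simp [upTm, subst, cons]
  · exact shift_inst _ _

theorem inst_subst (P N : Tm) (s : ℕ → Tm) :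
    (P.inst N).subst s = (P.subst (upTm s)).inst (N.subst s) := by
  rw [subst_up_inst]
  simp only [inst, subst_subst]
  congr 1; funext x; cases x <;> simp [subst, cons]

/-- Instantiating a weakened body with the new variable gives back the body. -/
theorem rename_up_succ_inst (P : Tm) : (P.rename (upRen Nat.succ)).inst (.var 0) = P := by
  simp only [inst, subst_rename_left]
  conv_rhs => rw [← subst_var P]
  congr 1; funext x; cases x <;> simp [upRen]

end Tm

/-! ### The encoding commutes with renaming and substitution -/

theorem enc_rename {c : Cat} (P : Exp c) (r : ℕ → ℕ) : enc (P.rename r) = (enc P).rename r := by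
  induction P generalizing r <;> simp_all [Exp.rename, enc, Tm.rename, Exp.phi_rename]

theorem upTm_enc (s : ℕ → Obj) : (fun x => enc (upSubst s x)) = upTm fun x => enc (s x) := by
  funext x; cases x
  · rfl
  · exact enc_rename _ _

theorem enc_subst {c : Cat} (P : Exp c) (s : ℕ → Obj) :
    enc (P.subst s) = (enc P).subst fun x => enc (s x) := by
  induction P generalizing s <;> simp_all [Exp.subst, enc, Tm.subst, Exp.phi_subst, upTm_enc]

theorem enc_inst {c : Cat} (P : Exp c) (N : Obj) : enc (P.inst N) = (enc P).inst (enc N) := by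
  unfold Exp.inst Tm.inst
  rw [enc_subst]
  congr 1; funext x; cases x <;> simp [enc]

/-! ### Typing and equality of `hohh` terms -/

/-- `ρ` is a type-preserving renaming from `Θ` to `Θ'`. -/
def HRen (Θ Θ' : List HTy) (ρ : ℕ → ℕ) : Prop := ∀ x a, Θ[x]? = some a → Θ'[ρ x]? = some a

theorem HRen.up {Θ Θ' ρ} (h : HRen Θ Θ' ρ) (a : HTy) : HRen (a :: Θ) (a :: Θ') (upRen ρ) := by
  intro x b hx
  cases x
  · exact hx
  · exact h _ _ hx

theorem HRen.succ (Θ : List HTy) (a : HTy) : HRen Θ (a :: Θ) Nat.succ := fun _ _ h => h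

/-- A signature gives each constant at most one type. -/
def SigFun (S : List (ℕ × HTy)) : Prop := ∀ u a b, (u, a) ∈ S → (u, b) ∈ S → a = b

theorem HasTy.rename {S S' Θ Θ' s a ρ} (h : HasTy S Θ s a) (hS : S ⊆ S') (hρ : HRen Θ Θ' ρ) :
    HasTy S' Θ' (s.rename ρ) a := by
  induction h generalizing Θ' ρ with
  | var h => exact .var (hρ _ _ h)
  | con h => exact .con (hS h)
  | log c => exact .log c
  | lam _ ih => exact .lam (ih (hρ.up _))
  | app _ _ ih₁ ih₂ => exact .app (ih₁ hρ) (ih₂ hρ)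

theorem HasTy.shift {S Θ s a} (h : HasTy S Θ s a) (b : HTy) : HasTy S (b :: Θ) s.shift a :=
  h.rename (List.Subset.refl _) (HRen.succ _ _)

/-- A term has at most one type; abstractions carry the type of the bound variable. -/
theorem HasTy.unique {S Θ s a b} (hS : SigFun S) (h : HasTy S Θ s a) (h' : HasTy S Θ s b) :
    a = b := by
  induction h generalizing b with
  | var h => cases h' with | var h' => simpa [h] using h'
  | con h => cases h' with | con h' => exact hS _ _ _ h h'
  | log c => cases h'; rfl
  | lam _ ih => cases h' with | lam h' => rw [ih h']
  | app _ _ ih₁ ih₂ => cases h' with | app h₁ h₂ => exact (HTy.arr.inj (ih₁ h₁)).2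

theorem HasTy.upTm {S Θ Θ' σ} (h : ∀ x a, Θ[x]? = some a → HasTy S Θ' (σ x) a) (b : HTy) :
    ∀ x a, (b :: Θ)[x]? = some a → HasTy S (b :: Θ') (upTm σ x) a := by
  intro x a hx
  cases x
  · exact .var hx
  · exact (h _ _ hx).shift _

theorem HasTy.subst {S Θ Θ' s a σ} (h : HasTy S Θ s a)
    (hσ : ∀ x a, Θ[x]? = some a → HasTy S Θ' (σ x) a) : HasTy S Θ' (s.subst σ) a := by
  induction h generalizing Θ' σ with
  | var h => exact hσ _ _ h
  | con h => exact .con h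
  | log c => exact .log c
  | lam _ ih => exact .lam (ih (HasTy.upTm hσ _))
  | app _ _ ih₁ ih₂ => exact .app (ih₁ hσ) (ih₂ hσ)

theorem HasTy.inst {S Θ a b s t} (h : HasTy S (a :: Θ) s b) (ht : HasTy S Θ t a) :
    HasTy S Θ (s.inst t) b := by
  refine h.subst fun x c hx => ?_
  cases x
  · cases hx; exact ht
  · simp only [instTm_succ]; exact .var hx

theorem TmEq.hasTy {S Θ s t a} (h : TmEq S Θ s t a) : HasTy S Θ s a ∧ HasTy S Θ t a := by
  induction h with
  | refl h => exact ⟨h, h⟩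
  | symm _ ih => exact ⟨ih.2, ih.1⟩
  | trans _ _ ih₁ ih₂ => exact ⟨ih₁.1, ih₂.2⟩
  | lam _ ih => exact ⟨.lam ih.1, .lam ih.2⟩
  | app _ _ ih₁ ih₂ => exact ⟨.app ih₁.1 ih₂.1, .app ih₁.2 ih₂.2⟩
  | beta h₁ h₂ => exact ⟨.app (.lam h₁) h₂, h₁.inst h₂⟩
  | eta h => exact ⟨.lam (.app (h.shift _) (.var rfl)), h⟩

theorem TmEq.rename {S S' Θ Θ' s t a ρ} (h : TmEq S Θ s t a) (hS : S ⊆ S') (hρ : HRen Θ Θ' ρ) :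
    TmEq S' Θ' (s.rename ρ) (t.rename ρ) a := by
  induction h generalizing Θ' ρ with
  | refl h => exact .refl (h.rename hS hρ)
  | symm _ ih => exact .symm (ih hρ)
  | trans _ _ ih₁ ih₂ => exact .trans (ih₁ hρ) (ih₂ hρ)
  | lam _ ih => exact .lam (ih (hρ.up _))
  | app _ _ ih₁ ih₂ => exact .app (ih₁ hρ) (ih₂ hρ)
  | beta h₁ h₂ =>
    rw [Tm.inst_rename]
    exact .beta (h₁.rename hS (hρ.up _)) (h₂.rename hS hρ)
  | eta h =>
    simp only [Tm.rename, Tm.shift_rename]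
    exact .eta (h.rename hS hρ)

theorem TmEq.shift {S Θ s t a} (h : TmEq S Θ s t a) (b : HTy) :
    TmEq S (b :: Θ) s.shift t.shift a :=
  h.rename (List.Subset.refl _) (HRen.succ _ _)

theorem TmEq.upTm {S Θ Θ' σ τ} (h : ∀ x a, Θ[x]? = some a → TmEq S Θ' (σ x) (τ x) a) (b : HTy) :
    ∀ x a, (b :: Θ)[x]? = some a → TmEq S (b :: Θ') (upTm σ x) (upTm τ x) a := by
  intro x a hx
  cases x
  · exact .refl (.var hx)
  · exact (h _ _ hx).shift _

/-- Substituting equal terms into a term gives equal terms. -/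
theorem HasTy.subst_eq {S Θ Θ' s a σ τ} (h : HasTy S Θ s a)
    (hσ : ∀ x a, Θ[x]? = some a → TmEq S Θ' (σ x) (τ x) a) :
    TmEq S Θ' (s.subst σ) (s.subst τ) a := by
  induction h generalizing Θ' σ τ with
  | var h => exact hσ _ _ h
  | con h => exact .refl (.con h)
  | log c => exact .refl (.log c)
  | lam _ ih => exact .lam (ih (TmEq.upTm hσ _))
  | app _ _ ih₁ ih₂ => exact .app (ih₁ hσ) (ih₂ hσ)

theorem TmEq.subst {S Θ Θ' s t a σ} (h : TmEq S Θ s t a)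
    (hσ : ∀ x a, Θ[x]? = some a → HasTy S Θ' (σ x) a) :
    TmEq S Θ' (s.subst σ) (t.subst σ) a := by
  induction h generalizing Θ' σ with
  | refl h => exact .refl (h.subst hσ)
  | symm _ ih => exact .symm (ih hσ)
  | trans _ _ ih₁ ih₂ => exact .trans (ih₁ hσ) (ih₂ hσ)
  | lam _ ih => exact .lam (ih (HasTy.upTm hσ _))
  | app _ _ ih₁ ih₂ => exact .app (ih₁ hσ) (ih₂ hσ)
  | beta h₁ h₂ =>
    rw [Tm.inst_subst]
    exact .beta (h₁.subst (HasTy.upTm hσ _)) (h₂.subst hσ)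
  | eta h =>
    simp only [Tm.subst, Tm.shift_subst]
    exact .eta (h.subst hσ)

/-- Equal substitutions into equal terms give equal terms. -/
theorem TmEq.subst_eq {S Θ Θ' s t a σ τ} (h : TmEq S Θ s t a)
    (hσ : ∀ x a, Θ[x]? = some a → TmEq S Θ' (σ x) (τ x) a) :
    TmEq S Θ' (s.subst σ) (t.subst τ) a :=
  (h.subst fun x a hx => (hσ x a hx).hasTy.1).trans (h.hasTy.2.subst_eq hσ)

theorem TmEq.app_var_zero {S Θ a b s t} (h : TmEq S Θ s t (.arr a b)) :
    TmEq S (a :: Θ) (.app s.shift (.var 0)) (.app t.shift (.var 0)) b :=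
  .app (h.shift a) (.refl (.var rfl))

theorem HasTy.beta_var_zero {S Θ a b s} (h : HasTy S (a :: Θ) s b) :
    TmEq S (a :: Θ) (.app (Tm.lam a s).shift (.var 0)) s b := by
  have h' := TmEq.beta (h.rename (List.Subset.refl _) ((HRen.succ Θ a).up a))
    (HasTy.var (S := S) (Θ := a :: Θ) (x := 0) rfl)
  rwa [Tm.rename_up_succ_inst] at h'

/-- Equal abstractions have equal bodies. -/
theorem TmEq.lam_inv {S Θ a b s t}
    (h : TmEq S Θ (.lam a s) (.lam a t) (.arr a b)) : TmEq S (a :: Θ) s t b := by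
  have ⟨h₁, h₂⟩ := h.hasTy
  cases h₁ with | lam h₁ =>
  cases h₂ with | lam h₂ =>
  exact h₁.beta_var_zero.symm.trans (h.app_var_zero.trans h₂.beta_var_zero)

/-- If `s x` equals `t` for a new variable `x`, then `s` equals `λx. t`. -/
theorem TmEq.lam_of_app {S Θ a b s t} (hs : HasTy S Θ s (.arr a b))
    (h : TmEq S (a :: Θ) (.app s.shift (.var 0)) t b) : TmEq S Θ s (.lam a t) (.arr a b) :=
  (TmEq.eta hs).symm.trans h.lam

/-! ### Long normal forms of `hohh` terms -/

/-- The number of arguments that a term of the given type takes. -/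
def HTy.arity : HTy → ℕ
  | .arr _ b => b.arity + 1
  | _ => 0

/-- Weak head `β`-reduction. -/
inductive Whr : Tm → Tm → Prop where
  | beta (a s t) : Whr (.app (.lam a s) t) (s.inst t)
  | app {s s'} (t) : Whr s s' → Whr (.app s t) (.app s' t)

/-- A variable or constant applied to arguments. -/
def Tm.Neutral : Tm → Prop
  | .app s _ => s.Neutral
  | .lam _ _ => False
  | _ => True

/-- Evaluation to `η`-long `β`-normal form: `Ev S false Θ s n a` says that `n` is the long normal
form of `s` at type `a`; `Ev S true Θ s n a` says that `s` is neutral, that its type is `a`, and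
that `n` arises from it by taking long normal forms of the arguments. -/
inductive Ev (S : List (ℕ × HTy)) : Bool → List HTy → Tm → Tm → HTy → Prop where
  | var {Θ x a} : Θ[x]? = some a → Ev S true Θ (.var x) (.var x) a
  | con {Θ u a} : (u, a) ∈ S → Ev S true Θ (.con u) (.con u) a
  | log {Θ} (c) : Ev S true Θ (.log c) (.log c) c.ty
  | app {Θ p n s m a b} : Ev S true Θ p n (.arr a b) → Ev S false Θ s m a →
      Ev S true Θ (.app p s) (.app n m) b
  | base {Θ s p n a} : a.arity = 0 → Relation.ReflTransGen Whr s p → Ev S true Θ p n a →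
      Ev S false Θ s n a
  | arr {Θ s n a b} : Ev S false (a :: Θ) (.app s.shift (.var 0)) n b →
      Ev S false Θ s (.lam a n) (.arr a b)

theorem Whr.rename {s t} (h : Whr s t) (ρ : ℕ → ℕ) : Whr (s.rename ρ) (t.rename ρ) := by
  induction h with
  | beta a s t => rw [Tm.inst_rename]; exact .beta _ _ _
  | app t _ ih => exact .app _ ih

theorem Whr.det {s t t'} (h : Whr s t) (h' : Whr s t') : t = t' := by
  induction h generalizing t' with
  | beta a s t =>
    cases h' with
    | beta => rfl
    | app _ h => cases h
  | app t h ih =>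
    cases h' with
    | beta => cases h
    | app _ h => rw [ih h]

theorem Tm.Neutral.not_whr {p q : Tm} (hp : p.Neutral) : ¬ Whr p q := by
  intro h
  induction h with
  | beta => exact hp
  | app _ _ ih => exact ih hp

theorem Ev.neutral {S Θ p n a} (h : Ev S true Θ p n a) : p.Neutral := by
  generalize hk : true = k at h
  induction h <;> simp_all [Tm.Neutral]

theorem Tm.Neutral.eq_of_whr {p q : Tm} (hp : p.Neutral) (h : Relation.ReflTransGen Whr p q) :
    p = q := by
  rcases Relation.ReflTransGen.cases_head h with h | ⟨r, h, _⟩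
  · exact h
  · exact (hp.not_whr h).elim

theorem Whr.neutral_unique {s p q : Tm} (hp : p.Neutral) (hq : q.Neutral)
    (h : Relation.ReflTransGen Whr s p) (h' : Relation.ReflTransGen Whr s q) : p = q := by
  induction h using Relation.ReflTransGen.head_induction_on with
  | refl => exact hp.eq_of_whr h'
  | head h₁ _ ih =>
    rcases Relation.ReflTransGen.cases_head h' with h | ⟨r, h, h₂⟩
    · subst h; exact (hq.not_whr h₁).elim
    · rw [h₁.det h] at ih
      exact ih h₂

theorem Ev.rename {S S' k Θ Θ' s n a ρ} (h : Ev S k Θ s n a) (hS : S ⊆ S') (hρ : HRen Θ Θ' ρ) :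
    Ev S' k Θ' (s.rename ρ) (n.rename ρ) a := by
  induction h generalizing Θ' ρ with
  | var h => exact .var (hρ _ _ h)
  | con h => exact .con (hS h)
  | log c => exact .log c
  | app _ _ ih₁ ih₂ => exact .app (ih₁ hρ) (ih₂ hρ)
  | base ha hs _ ih =>
    exact .base ha (hs.lift (fun t => t.rename ρ) fun _ _ h => h.rename ρ) (ih hρ)
  | arr _ ih =>
    have := ih (hρ.up _)
    simp only [Tm.rename, Tm.shift_rename] at this
    exact .arr this

theorem Ev.expand {S Θ s s' n a} (hs : Whr s s') (h : Ev S false Θ s' n a) :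
    Ev S false Θ s n a := by
  generalize hk : false = k at h
  induction h generalizing s with
  | base ha h hp => exact .base ha (.head hs h) hp
  | arr _ ih => exact .arr (ih (.app _ (hs.rename _)) rfl)
  | _ => cases hk

/-- Evaluation is deterministic.  The type of a neutral term is determined by the term; otherwise it
has to be given. -/
theorem Ev.det {S k Θ s n a} (hS : SigFun S) (h : Ev S k Θ s n a) :
    ∀ n' a', Ev S k Θ s n' a' → (k = false → a = a') → n = n' ∧ a = a' := by
  induction h with
  | var h => intro n' a' h' _; cases h' with | var h' => exact ⟨rfl, by simpa [h] using h'⟩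
  | con h => intro n' a' h' _; cases h' with | con h' => exact ⟨rfl, hS _ _ _ h h'⟩
  | log c => intro n' a' h' _; cases h'; exact ⟨rfl, rfl⟩
  | app _ _ ih₁ ih₂ =>
    intro n' a' h' _
    cases h' with
    | app h₁ h₂ =>
      have ⟨e₁, e₂⟩ := ih₁ _ _ h₁ nofun
      cases e₂
      rw [e₁, (ih₂ _ _ h₂ fun _ => rfl).1]
      exact ⟨rfl, rfl⟩
  | base ha hs hp ih =>
    intro n' a' h' e
    cases e rfl
    cases h' with
    | base _ hs' hp' =>
      cases Whr.neutral_unique hp.neutral hp'.neutral hs hs'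
      exact ih _ _ hp' nofun
    | arr => simp [HTy.arity] at ha
  | arr _ ih =>
    intro n' a' h' e
    cases e rfl
    cases h' with
    | base ha => simp [HTy.arity] at ha
    | arr h => rw [(ih _ _ h fun _ => rfl).1]; exact ⟨rfl, rfl⟩

theorem Whr.tmEq {S Θ s t a} (h : Whr s t) (hs : HasTy S Θ s a) : TmEq S Θ s t a := by
  induction h generalizing a with
  | beta => cases hs with | app h₁ h₂ => cases h₁ with | lam h₁ => exact .beta h₁ h₂
  | app _ _ ih => cases hs with | app h₁ h₂ => exact .app (ih h₁) (.refl h₂)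

theorem Whr.tmEq_star {S Θ s t a} (h : Relation.ReflTransGen Whr s t) (hs : HasTy S Θ s a) :
    TmEq S Θ s t a := by
  induction h with
  | refl => exact .refl hs
  | tail _ h ih => exact ih.trans (h.tmEq ih.hasTy.2)

/-- A typed term equals its long normal form. -/
theorem Ev.sound {S k Θ s n a} (hS : SigFun S) (h : Ev S k Θ s n a) :
    ∀ b, HasTy S Θ s b → (k = false → a = b) → a = b ∧ TmEq S Θ s n a := by
  induction h with
  | var h => intro b hb _; exact ⟨(HasTy.var h).unique hS hb, .refl (.var h)⟩
  | con h => intro b hb _; exact ⟨(HasTy.con h).unique hS hb, .refl (.con h)⟩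
  | log c => intro b hb _; cases hb; exact ⟨rfl, .refl (.log c)⟩
  | app _ _ ih₁ ih₂ =>
    intro b hb _
    cases hb with
    | app h₁ h₂ =>
      have ⟨e₁, e₂⟩ := ih₁ _ h₁ nofun
      cases e₁
      exact ⟨rfl, .app e₂ (ih₂ _ h₂ fun _ => rfl).2⟩
  | base ha hs _ ih =>
    intro b hb e
    cases e rfl
    have h := Whr.tmEq_star hs hb
    exact ⟨rfl, h.trans (ih _ h.hasTy.2 nofun).2⟩
  | arr _ ih =>
    intro b hb e
    cases e rfl
    exact ⟨rfl, .lam_of_app hb (ih _ (.app (hb.shift _) (.var rfl)) fun _ => rfl).2⟩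

/-! ### A logical relation for `βη`-equality -/

/-- The Kripke logical relation: at atomic types, having a common long normal form. -/
def LR (S : List (ℕ × HTy)) : HTy → List HTy → Tm → Tm → Prop
  | .arr a b, Θ, s, t => ∀ Θ' ρ, HRen Θ Θ' ρ → ∀ u v, LR S a Θ' u v →
      LR S b Θ' (.app (s.rename ρ) u) (.app (t.rename ρ) v)
  | .o, Θ, s, t => ∃ n, Ev S false Θ s n .o ∧ Ev S false Θ t n .o
  | .lfObj, Θ, s, t => ∃ n, Ev S false Θ s n .lfObj ∧ Ev S false Θ t n .lfObj
  | .lfType, Θ, s, t => ∃ n, Ev S false Θ s n .lfType ∧ Ev S false Θ t n .lfType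

namespace LR

variable {S : List (ℕ × HTy)}

theorem symm {a : HTy} {Θ s t} (h : LR S a Θ s t) : LR S a Θ t s := by
  induction a generalizing Θ s t with
  | arr a b iha ihb => exact fun Θ' ρ hρ u v huv => ihb (h Θ' ρ hρ v u (iha huv))
  | _ => obtain ⟨n, h₁, h₂⟩ := h; exact ⟨n, h₂, h₁⟩

theorem trans (hS : SigFun S) {a : HTy} {Θ s t r} (h : LR S a Θ s t) (h' : LR S a Θ t r) :
    LR S a Θ s r := by
  induction a generalizing Θ s t r with
  | arr a b iha ihb =>
    exact fun Θ' ρ hρ u v huv => ihb (h Θ' ρ hρ u v huv) (h' Θ' ρ hρ v v (iha huv.symm huv))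
  | _ =>
    obtain ⟨n, h₁, h₂⟩ := h
    obtain ⟨m, h₃, h₄⟩ := h'
    cases (h₂.det hS _ _ h₃ fun _ => rfl).1
    exact ⟨n, h₁, h₄⟩

theorem rename {a : HTy} {Θ Θ' s t ρ} (h : LR S a Θ s t) (hρ : HRen Θ Θ' ρ) :
    LR S a Θ' (s.rename ρ) (t.rename ρ) := by
  cases a with
  | arr a b =>
    intro Θ'' ρ' hρ' u v huv
    rw [Tm.rename_rename, Tm.rename_rename]
    exact h Θ'' _ (fun x c hx => hρ' _ _ (hρ _ _ hx)) u v huv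
  | _ =>
    obtain ⟨n, h₁, h₂⟩ := h
    exact ⟨_, h₁.rename (List.Subset.refl _) hρ, h₂.rename (List.Subset.refl _) hρ⟩

theorem expand {a : HTy} {Θ s s' t} (hs : Whr s s') (h : LR S a Θ s' t) : LR S a Θ s t := by
  induction a generalizing Θ s s' t with
  | arr a b _ ihb => exact fun Θ' ρ hρ u v huv => ihb (.app _ (hs.rename _)) (h Θ' ρ hρ u v huv)
  | _ => obtain ⟨n, h₁, h₂⟩ := h; exact ⟨n, h₁.expand hs, h₂⟩

/-- Related terms have a common long normal form, and neutral terms with a common evaluation are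
related. -/
theorem reify_reflect (a : HTy) :
    (∀ Θ s t, LR S a Θ s t → ∃ n, Ev S false Θ s n a ∧ Ev S false Θ t n a) ∧
    (∀ Θ p q n, Ev S true Θ p n a → Ev S true Θ q n a → LR S a Θ p q) := by
  induction a with
  | arr a b iha ihb =>
    refine ⟨fun Θ s t h => ?_, fun Θ p q n hp hq Θ' ρ hρ u v huv => ?_⟩
    · obtain ⟨n, h₁, h₂⟩ := ihb.1 _ _ _ (h (a :: Θ) Nat.succ (HRen.succ _ _) (.var 0) (.var 0)
        (iha.2 _ _ _ _ (.var rfl) (.var rfl)))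
      exact ⟨_, .arr h₁, .arr h₂⟩
    · obtain ⟨m, h₁, h₂⟩ := iha.1 _ _ _ huv
      exact ihb.2 _ _ _ _ (.app (hp.rename (List.Subset.refl _) hρ) h₁)
        (.app (hq.rename (List.Subset.refl _) hρ) h₂)
  | _ => exact ⟨fun Θ s t h => h, fun Θ p q n hp hq => ⟨n, .base rfl .refl hp, .base rfl .refl hq⟩⟩

/-- Pointwise related substitutions from `Θ` to `Θ'`. -/
def Env (S : List (ℕ × HTy)) (Θ Θ' : List HTy) (σ τ : ℕ → Tm) : Prop :=
  ∀ x a, Θ[x]? = some a → LR S a Θ' (σ x) (τ x)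

theorem Env.cons {Θ Θ' Θ'' σ τ ρ a u v} (h : Env S Θ Θ' σ τ) (hρ : HRen Θ' Θ'' ρ)
    (huv : LR S a Θ'' u v) :
    Env S (a :: Θ) Θ'' (cons u fun x => (σ x).rename ρ)
      (cons v fun x => (τ x).rename ρ) := by
  intro x b hx
  cases x
  · cases hx; exact huv
  · exact (h _ _ hx).rename hρ

theorem whr_lam (s : Tm) (σ : ℕ → Tm) (ρ : ℕ → ℕ) (a : HTy) (u : Tm) :
    Whr (.app (((Tm.lam a s).subst σ).rename ρ) u)
      (s.subst (cons u fun x => (σ x).rename ρ)) := by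
  rw [← Tm.subst_up_inst s (fun x => (σ x).rename ρ), ← upTm_rename, ← Tm.rename_subst]
  exact .beta _ _ _

/-- The fundamental lemma for a single term. -/
theorem of_hasTy {Θ s a} (h : HasTy S Θ s a) :
    ∀ Θ' σ τ, Env S Θ Θ' σ τ → LR S a Θ' (s.subst σ) (s.subst τ) := by
  induction h with
  | var h => exact fun Θ' σ τ hστ => hστ _ _ h
  | con h => exact fun Θ' σ τ _ => (reify_reflect _).2 _ _ _ _ (.con h) (.con h)
  | log c => exact fun Θ' σ τ _ => (reify_reflect _).2 _ _ _ _ (.log c) (.log c)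
  | lam _ ih =>
    intro Θ' σ τ hστ Θ'' ρ hρ u v huv
    exact expand (whr_lam _ _ _ _ _) (symm (expand (whr_lam _ _ _ _ _)
      (symm (ih _ _ _ (hστ.cons hρ huv)))))
  | app _ _ ih₁ ih₂ =>
    intro Θ' σ τ hστ
    have := ih₁ _ _ _ hστ Θ' (fun x => x) (fun _ _ h => h) _ _ (ih₂ _ _ _ hστ)
    rwa [Tm.rename_id, Tm.rename_id] at this

/-- Equal terms are related under related substitutions. -/
theorem of_tmEq (hS : SigFun S) {Θ s t a} (h : TmEq S Θ s t a) :
    ∀ Θ' σ τ, Env S Θ Θ' σ τ → LR S a Θ' (s.subst σ) (t.subst τ) := by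
  induction h with
  | refl h => exact of_hasTy h
  | symm _ ih => exact fun Θ' σ τ h => (ih Θ' τ σ fun x a hx => (h x a hx).symm).symm
  | trans _ _ ih₁ ih₂ =>
    -- `τ` is related to itself by symmetry and transitivity
    exact fun Θ' σ τ h => (ih₁ Θ' σ τ h).trans hS
      (ih₂ Θ' τ τ fun x a hx => (h x a hx).symm.trans hS (h x a hx))
  | lam _ ih =>
    intro Θ' σ τ hστ Θ'' ρ hρ u v huv
    exact expand (whr_lam _ _ _ _ _) (symm (expand (whr_lam _ _ _ _ _)
      (symm (ih _ _ _ (hστ.cons hρ huv)))))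
  | app _ _ ih₁ ih₂ =>
    intro Θ' σ τ hστ
    have := ih₁ _ _ _ hστ Θ' (fun x => x) (fun _ _ h => h) _ _ (ih₂ _ _ _ hστ)
    rwa [Tm.rename_id, Tm.rename_id] at this
  | @beta Θ a b s t h₁ h₂ =>
    intro Θ' σ τ hστ
    refine expand (.beta _ _ _) ?_
    rw [Tm.subst_up_inst]
    have := of_hasTy h₁ _ _ _ (hστ.cons (ρ := fun x => x) (fun _ _ h => h) (of_hasTy h₂ _ _ _ hστ))
    simp only [Tm.rename_id] at this
    rw [Tm.inst_subst, Tm.subst_up_inst]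
    exact this
  | eta h =>
    intro Θ' σ τ hστ Θ'' ρ hρ u v huv
    refine expand (.beta _ _ _) ?_
    have := of_hasTy h _ _ _ hστ Θ'' ρ hρ u v huv
    simp only [Tm.subst, Tm.rename, Tm.inst, upTm, upRen, instTm_zero, Tm.shift_subst,
      Tm.shift_rename] at this ⊢
    rw [show (Tm.shift _).subst _ = _ from Tm.shift_inst _ u]
    exact this

end LR

/-- Equal terms have a common long normal form. -/
theorem TmEq.exists_ev {S Θ s t a} (hS : SigFun S) (h : TmEq S Θ s t a) :
    ∃ n, Ev S false Θ s n a ∧ Ev S false Θ t n a := by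
  have := LR.of_tmEq hS h Θ .var .var fun x b hx =>
    (LR.reify_reflect b).2 _ _ _ _ (.var hx) (.var hx)
  rw [Tm.subst_var, Tm.subst_var] at this
  exact (LR.reify_reflect a).1 _ _ _ this

theorem TmEq.ev_eq {S Θ s t a n m} (hS : SigFun S) (h : TmEq S Θ s t a)
    (hs : Ev S false Θ s n a) (ht : Ev S false Θ t m a) : n = m := by
  obtain ⟨k, h₁, h₂⟩ := h.exists_ev hS
  rw [(hs.det hS _ _ h₁ fun _ => rfl).1, (ht.det hS _ _ h₂ fun _ => rfl).1]

/-! ### Confluence of `β`-reduction of LF expressions -/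

/-- Parallel `β`-reduction. -/
inductive Par : {c : Cat} → Exp c → Exp c → Prop where
  | typ : Par .typ .typ
  | tvar (u) : Par (.tvar u) (.tvar u)
  | var (x) : Par (.var x) (.var x)
  | piK {A A' K K'} : Par A A' → Par K K' → Par (.piK A K) (.piK A' K')
  | pi {A A' B B'} : Par A A' → Par B B' → Par (.pi A B) (.pi A' B')
  | lamF {A A' B B'} : Par A A' → Par B B' → Par (.lamF A B) (.lamF A' B')
  | appF {A A' M M'} : Par A A' → Par M M' → Par (.appF A M) (.appF A' M')
  | lam {A A' M M'} : Par A A' → Par M M' → Par (.lam A M) (.lam A' M')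
  | app {M M' N N'} : Par M M' → Par N N' → Par (.app M N) (.app M' N')
  | betaF {A A' B B' M M'} : Par A A' → Par B B' → Par M M' →
      Par (.appF (.lamF A B) M) (B'.inst M')
  | beta {A A' M M' N N'} : Par A A' → Par M M' → Par N N' → Par (.app (.lam A M) N) (M'.inst N')

namespace Par

theorem refl {c : Cat} (P : Exp c) : Par P P := by
  induction P <;> constructor <;> assumption

theorem rename {c : Cat} {P Q : Exp c} (h : Par P Q) (r : ℕ → ℕ) :
    Par (P.rename r) (Q.rename r) := by
  induction h generalizing r with
  | betaF _ _ _ ih₁ ih₂ ih₃ => rw [Exp.inst_rename]; exact .betaF (ih₁ _) (ih₂ _) (ih₃ _)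
  | beta _ _ _ ih₁ ih₂ ih₃ => rw [Exp.inst_rename]; exact .beta (ih₁ _) (ih₂ _) (ih₃ _)
  | _ => constructor <;> solve_by_elim

theorem upSubst {s s' : ℕ → Obj} (hs : ∀ x, Par (s x) (s' x)) :
    ∀ x, Par (upSubst s x) (upSubst s' x)
  | 0 => refl _
  | x + 1 => (hs x).rename _

theorem subst {c : Cat} {P Q : Exp c} (h : Par P Q) {s s' : ℕ → Obj}
    (hs : ∀ x, Par (s x) (s' x)) : Par (P.subst s) (Q.subst s') := by
  induction h generalizing s s' with
  | betaF _ _ _ ih₁ ih₂ ih₃ =>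
    rw [Exp.inst_subst]; exact .betaF (ih₁ hs) (ih₂ (upSubst hs)) (ih₃ hs)
  | beta _ _ _ ih₁ ih₂ ih₃ =>
    rw [Exp.inst_subst]; exact .beta (ih₁ hs) (ih₂ (upSubst hs)) (ih₃ hs)
  | var x => exact hs x
  | typ => exact .typ
  | tvar u => exact .tvar u
  | piK _ _ ih₁ ih₂ => exact .piK (ih₁ hs) (ih₂ (upSubst hs))
  | pi _ _ ih₁ ih₂ => exact .pi (ih₁ hs) (ih₂ (upSubst hs))
  | lamF _ _ ih₁ ih₂ => exact .lamF (ih₁ hs) (ih₂ (upSubst hs))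
  | lam _ _ ih₁ ih₂ => exact .lam (ih₁ hs) (ih₂ (upSubst hs))
  | appF _ _ ih₁ ih₂ => exact .appF (ih₁ hs) (ih₂ hs)
  | app _ _ ih₁ ih₂ => exact .app (ih₁ hs) (ih₂ hs)

theorem inst {c : Cat} {P Q : Exp c} {N N' : Obj} (h : Par P Q) (hN : Par N N') :
    Par (P.inst N) (Q.inst N') := by
  refine h.subst fun x => ?_
  cases x
  · exact hN
  · simp only [instObj_succ]; exact refl _

/-- The diamond property. -/
theorem diamond {c : Cat} {P Q₁ Q₂ : Exp c} (h₁ : Par P Q₁) (h₂ : Par P Q₂) :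
    ∃ R, Par Q₁ R ∧ Par Q₂ R := by
  induction h₁ with
  | typ => exact ⟨_, h₂, refl _⟩
  | tvar u => exact ⟨_, h₂, refl _⟩
  | var x => exact ⟨_, h₂, refl _⟩
  | piK _ _ ih₁ ih₂ =>
    cases h₂ with | piK a b =>
    obtain ⟨_, a₁, a₂⟩ := ih₁ a
    obtain ⟨_, b₁, b₂⟩ := ih₂ b
    exact ⟨_, .piK a₁ b₁, .piK a₂ b₂⟩
  | pi _ _ ih₁ ih₂ =>
    cases h₂ with | pi a b =>
    obtain ⟨_, a₁, a₂⟩ := ih₁ a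
    obtain ⟨_, b₁, b₂⟩ := ih₂ b
    exact ⟨_, .pi a₁ b₁, .pi a₂ b₂⟩
  | lamF _ _ ih₁ ih₂ =>
    cases h₂ with | lamF a b =>
    obtain ⟨_, a₁, a₂⟩ := ih₁ a
    obtain ⟨_, b₁, b₂⟩ := ih₂ b
    exact ⟨_, .lamF a₁ b₁, .lamF a₂ b₂⟩
  | lam _ _ ih₁ ih₂ =>
    cases h₂ with | lam a b =>
    obtain ⟨_, a₁, a₂⟩ := ih₁ a
    obtain ⟨_, b₁, b₂⟩ := ih₂ b
    exact ⟨_, .lam a₁ b₁, .lam a₂ b₂⟩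
  | appF h₁ _ ih₁ ih₂ =>
    cases h₂ with
    | appF a b =>
      obtain ⟨_, a₁, a₂⟩ := ih₁ a
      obtain ⟨_, b₁, b₂⟩ := ih₂ b
      exact ⟨_, .appF a₁ b₁, .appF a₂ b₂⟩
    | betaF a b m =>
      obtain ⟨_, m₁, m₂⟩ := ih₂ m
      obtain ⟨_, c₁, c₂⟩ := ih₁ (.lamF a b)
      cases h₁ with | lamF =>
      cases c₁ with | lamF a₁ b₁ =>
      cases c₂ with | lamF a₂ b₂ =>
      exact ⟨_, .betaF a₁ b₁ m₁, b₂.inst m₂⟩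
  | app h₁ _ ih₁ ih₂ =>
    cases h₂ with
    | app a b =>
      obtain ⟨_, a₁, a₂⟩ := ih₁ a
      obtain ⟨_, b₁, b₂⟩ := ih₂ b
      exact ⟨_, .app a₁ b₁, .app a₂ b₂⟩
    | beta a b m =>
      obtain ⟨_, m₁, m₂⟩ := ih₂ m
      obtain ⟨_, c₁, c₂⟩ := ih₁ (.lam a b)
      cases h₁ with | lam =>
      cases c₁ with | lam a₁ b₁ =>
      cases c₂ with | lam a₂ b₂ =>
      exact ⟨_, .beta a₁ b₁ m₁, b₂.inst m₂⟩
  | betaF _ _ _ ih₁ ih₂ ih₃ =>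
    cases h₂ with
    | appF a m =>
      cases a with | lamF a b =>
      obtain ⟨_, a₁, a₂⟩ := ih₁ a
      obtain ⟨_, b₁, b₂⟩ := ih₂ b
      obtain ⟨_, m₁, m₂⟩ := ih₃ m
      exact ⟨_, b₁.inst m₁, .betaF a₂ b₂ m₂⟩
    | betaF a b m =>
      obtain ⟨_, b₁, b₂⟩ := ih₂ b
      obtain ⟨_, m₁, m₂⟩ := ih₃ m
      exact ⟨_, b₁.inst m₁, b₂.inst m₂⟩
  | beta _ _ _ ih₁ ih₂ ih₃ =>
    cases h₂ with
    | app a m =>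
      cases a with | lam a b =>
      obtain ⟨_, a₁, a₂⟩ := ih₁ a
      obtain ⟨_, b₁, b₂⟩ := ih₂ b
      obtain ⟨_, m₁, m₂⟩ := ih₃ m
      exact ⟨_, b₁.inst m₁, .beta a₂ b₂ m₂⟩
    | beta a b m =>
      obtain ⟨_, b₁, b₂⟩ := ih₂ b
      obtain ⟨_, m₁, m₂⟩ := ih₃ m
      exact ⟨_, b₁.inst m₁, b₂.inst m₂⟩

end Par

theorem Step.par {c : Cat} {P Q : Exp c} (h : Step P Q) : Par P Q := by
  induction h with
  | betaF => exact .betaF (.refl _) (.refl _) (.refl _)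
  | beta => exact .beta (.refl _) (.refl _) (.refl _)
  | _ => constructor <;> first | assumption | exact .refl _

/-- Many-step reduction. -/
abbrev Steps {c : Cat} (P Q : Exp c) : Prop := ReflTransGen Step P Q

namespace Steps

theorem piK {A A' K K'} (h : Steps A A') (h' : Steps K K') :
    Steps (Exp.piK A K) (.piK A' K') :=
  (h.lift (fun A => Exp.piK A K) fun _ _ h => .piK₁ _ h).trans
    (h'.lift (fun K => Exp.piK A' K) fun _ _ h => .piK₂ _ h)

theorem pi {A A' K K'} (h : Steps A A') (h' : Steps K K') :
    Steps (Exp.pi A K) (.pi A' K') :=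
  (h.lift (fun A => Exp.pi A K) fun _ _ h => .pi₁ _ h).trans
    (h'.lift (fun K => Exp.pi A' K) fun _ _ h => .pi₂ _ h)

theorem lamF {A A' K K'} (h : Steps A A') (h' : Steps K K') :
    Steps (Exp.lamF A K) (.lamF A' K') :=
  (h.lift (fun A => Exp.lamF A K) fun _ _ h => .lamF₁ _ h).trans
    (h'.lift (fun K => Exp.lamF A' K) fun _ _ h => .lamF₂ _ h)

theorem appF {A A' K K'} (h : Steps A A') (h' : Steps K K') :
    Steps (Exp.appF A K) (.appF A' K') :=
  (h.lift (fun A => Exp.appF A K) fun _ _ h => .appF₁ _ h).trans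
    (h'.lift (fun K => Exp.appF A' K) fun _ _ h => .appF₂ _ h)

theorem lam {A A' K K'} (h : Steps A A') (h' : Steps K K') :
    Steps (Exp.lam A K) (.lam A' K') :=
  (h.lift (fun A => Exp.lam A K) fun _ _ h => .lam₁ _ h).trans
    (h'.lift (fun K => Exp.lam A' K) fun _ _ h => .lam₂ _ h)

theorem app {A A' K K'} (h : Steps A A') (h' : Steps K K') :
    Steps (Exp.app A K) (.app A' K') :=
  (h.lift (fun A => Exp.app A K) fun _ _ h => .app₁ _ h).trans
    (h'.lift (fun K => Exp.app A' K) fun _ _ h => .app₂ _ h)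

end Steps

theorem Par.steps {c : Cat} {P Q : Exp c} (h : Par P Q) : Steps P Q := by
  induction h with
  | typ => exact .refl
  | tvar => exact .refl
  | var => exact .refl
  | piK _ _ h₁ h₂ => exact h₁.piK h₂
  | pi _ _ h₁ h₂ => exact h₁.pi h₂
  | lamF _ _ h₁ h₂ => exact h₁.lamF h₂
  | appF _ _ h₁ h₂ => exact h₁.appF h₂
  | lam _ _ h₁ h₂ => exact h₁.lam h₂
  | app _ _ h₁ h₂ => exact h₁.app h₂
  | betaF _ _ _ h₁ h₂ h₃ => exact ((h₁.lamF h₂).appF h₃).tail (.betaF _ _ _)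
  | beta _ _ _ h₁ h₂ h₃ => exact ((h₁.lam h₂).app h₃).tail (.beta _ _ _)

theorem Steps.confluent {c : Cat} {P Q₁ Q₂ : Exp c} (h₁ : Steps P Q₁) (h₂ : Steps P Q₂) :
    ∃ R, Steps Q₁ R ∧ Steps Q₂ R := by
  have hp : ∀ {P Q : Exp c}, ReflTransGen Par P Q → Steps P Q := fun h => by
    induction h with
    | refl => exact .refl
    | tail _ h ih => exact ih.trans h.steps
  obtain ⟨R, h₁, h₂⟩ := Relation.church_rosser
    (fun a b c h h' => by
      obtain ⟨d, h, h'⟩ := Par.diamond h h'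
      exact ⟨d, .single h, .single h'⟩)
    (ReflTransGen.mono (fun _ _ h => Step.par h) _ _ h₁)
    (ReflTransGen.mono (fun _ _ h => Step.par h) _ _ h₂)
  exact ⟨R, hp h₁, hp h₂⟩

theorem Normal.eq_of_steps {c : Cat} {P Q : Exp c} (hP : Normal P) (h : Steps P Q) : P = Q := by
  rcases ReflTransGen.cases_head h with h | ⟨R, h, _⟩
  · exact h
  · exact (hP _ h).elim

namespace NormalFormOf

theorem of_normal {c : Cat} {P : Exp c} (h : Normal P) : NormalFormOf P P := ⟨.refl, h⟩

theorem eq_of_normal {c : Cat} {P Q : Exp c} (h : NormalFormOf P Q) (hP : Normal P) : P = Q :=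
  hP.eq_of_steps h.1

/-- Any reduct of `P` has the same normal form. -/
theorem of_steps {c : Cat} {P P' Q : Exp c} (h : NormalFormOf P Q) (hP : Steps P P') :
    NormalFormOf P' Q := by
  obtain ⟨R, h₁, h₂⟩ := Steps.confluent h.1 hP
  rw [← h.2.eq_of_steps h₁] at h₂
  exact ⟨h₂, h.2⟩

theorem head {c : Cat} {P P' Q : Exp c} (h : NormalFormOf P' Q) (hP : Steps P P') :
    NormalFormOf P Q := ⟨hP.trans h.1, h.2⟩

theorem unique {c : Cat} {P Q Q' : Exp c} (h : NormalFormOf P Q) (h' : NormalFormOf P Q') :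
    Q = Q' := (h.of_steps h'.1).eq_of_normal h'.2 |>.symm

end NormalFormOf

theorem Step.rename {c : Cat} {P Q : Exp c} (h : Step P Q) (r : ℕ → ℕ) :
    Step (P.rename r) (Q.rename r) := by
  induction h generalizing r with
  | betaF => rw [Exp.inst_rename]; exact .betaF _ _ _
  | beta => rw [Exp.inst_rename]; exact .beta _ _ _
  | piK₁ _ _ ih => exact .piK₁ _ (ih _)
  | piK₂ _ _ ih => exact .piK₂ _ (ih _)
  | pi₁ _ _ ih => exact .pi₁ _ (ih _)
  | pi₂ _ _ ih => exact .pi₂ _ (ih _)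
  | lamF₁ _ _ ih => exact .lamF₁ _ (ih _)
  | lamF₂ _ _ ih => exact .lamF₂ _ (ih _)
  | appF₁ _ _ ih => exact .appF₁ _ (ih _)
  | appF₂ _ _ ih => exact .appF₂ _ (ih _)
  | lam₁ _ _ ih => exact .lam₁ _ (ih _)
  | lam₂ _ _ ih => exact .lam₂ _ (ih _)
  | app₁ _ _ ih => exact .app₁ _ (ih _)
  | app₂ _ _ ih => exact .app₂ _ (ih _)

theorem Step.subst {c : Cat} {P Q : Exp c} (h : Step P Q) (s : ℕ → Obj) :
    Step (P.subst s) (Q.subst s) := by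
  induction h generalizing s with
  | betaF => rw [Exp.inst_subst]; exact .betaF _ _ _
  | beta => rw [Exp.inst_subst]; exact .beta _ _ _
  | piK₁ _ _ ih => exact .piK₁ _ (ih _)
  | piK₂ _ _ ih => exact .piK₂ _ (ih _)
  | pi₁ _ _ ih => exact .pi₁ _ (ih _)
  | pi₂ _ _ ih => exact .pi₂ _ (ih _)
  | lamF₁ _ _ ih => exact .lamF₁ _ (ih _)
  | lamF₂ _ _ ih => exact .lamF₂ _ (ih _)
  | appF₁ _ _ ih => exact .appF₁ _ (ih _)
  | appF₂ _ _ ih => exact .appF₂ _ (ih _)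
  | lam₁ _ _ ih => exact .lam₁ _ (ih _)
  | lam₂ _ _ ih => exact .lam₂ _ (ih _)
  | app₁ _ _ ih => exact .app₁ _ (ih _)
  | app₂ _ _ ih => exact .app₂ _ (ih _)

theorem Steps.rename {c : Cat} {P Q : Exp c} (h : Steps P Q) (r : ℕ → ℕ) :
    Steps (P.rename r) (Q.rename r) := h.lift (fun P => P.rename r) fun _ _ h => h.rename r

theorem Steps.subst {c : Cat} {P Q : Exp c} (h : Steps P Q) (s : ℕ → Obj) :
    Steps (P.subst s) (Q.subst s) := h.lift (fun P => P.subst s) fun _ _ h => h.subst s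

theorem Step.inst_right {c : Cat} (P : Exp c) {N N' : Obj} (h : Step N N') :
    Steps (P.inst N) (P.inst N') := ((Par.refl P).inst h.par).steps

/-- Every step of a renamed expression comes from a step of the expression. -/
theorem Step.of_rename {c : Cat} {P Q : Exp c} {r : ℕ → ℕ} (h : Step (P.rename r) Q) :
    ∃ Q', Step P Q' ∧ Q = Q'.rename r := by
  generalize hP : P.rename r = P' at h
  induction h generalizing r with
  | betaF =>
    cases P <;> simp [Exp.rename] at hP
    obtain ⟨hP, rfl⟩ := hP
    rename_i A M
    cases A <;> simp [Exp.rename] at hP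
    obtain ⟨rfl, rfl⟩ := hP
    exact ⟨_, .betaF _ _ _, (Exp.inst_rename _ _ _).symm⟩
  | beta =>
    cases P <;> simp [Exp.rename] at hP
    obtain ⟨hP, rfl⟩ := hP
    rename_i A M
    cases A <;> simp [Exp.rename] at hP
    obtain ⟨rfl, rfl⟩ := hP
    exact ⟨_, .beta _ _ _, (Exp.inst_rename _ _ _).symm⟩
  | piK₁ _ _ ih =>
    cases P <;> simp [Exp.rename] at hP
    obtain ⟨rfl, rfl⟩ := hP
    obtain ⟨Q', h, rfl⟩ := ih rfl
    exact ⟨_, .piK₁ _ h, rfl⟩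
  | piK₂ _ _ ih =>
    cases P <;> simp [Exp.rename] at hP
    obtain ⟨rfl, rfl⟩ := hP
    obtain ⟨Q', h, rfl⟩ := ih rfl
    exact ⟨_, .piK₂ _ h, rfl⟩
  | pi₁ _ _ ih =>
    cases P <;> simp [Exp.rename] at hP
    obtain ⟨rfl, rfl⟩ := hP
    obtain ⟨Q', h, rfl⟩ := ih rfl
    exact ⟨_, .pi₁ _ h, rfl⟩
  | pi₂ _ _ ih =>
    cases P <;> simp [Exp.rename] at hP
    obtain ⟨rfl, rfl⟩ := hP
    obtain ⟨Q', h, rfl⟩ := ih rfl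
    exact ⟨_, .pi₂ _ h, rfl⟩
  | lamF₁ _ _ ih =>
    cases P <;> simp [Exp.rename] at hP
    obtain ⟨rfl, rfl⟩ := hP
    obtain ⟨Q', h, rfl⟩ := ih rfl
    exact ⟨_, .lamF₁ _ h, rfl⟩
  | lamF₂ _ _ ih =>
    cases P <;> simp [Exp.rename] at hP
    obtain ⟨rfl, rfl⟩ := hP
    obtain ⟨Q', h, rfl⟩ := ih rfl
    exact ⟨_, .lamF₂ _ h, rfl⟩
  | appF₁ _ _ ih =>
    cases P <;> simp [Exp.rename] at hP
    obtain ⟨rfl, rfl⟩ := hP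
    obtain ⟨Q', h, rfl⟩ := ih rfl
    exact ⟨_, .appF₁ _ h, rfl⟩
  | appF₂ _ _ ih =>
    cases P <;> simp [Exp.rename] at hP
    obtain ⟨rfl, rfl⟩ := hP
    obtain ⟨Q', h, rfl⟩ := ih rfl
    exact ⟨_, .appF₂ _ h, rfl⟩
  | lam₁ _ _ ih =>
    cases P <;> simp [Exp.rename] at hP
    obtain ⟨rfl, rfl⟩ := hP
    obtain ⟨Q', h, rfl⟩ := ih rfl
    exact ⟨_, .lam₁ _ h, rfl⟩
  | lam₂ _ _ ih =>
    cases P <;> simp [Exp.rename] at hP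
    obtain ⟨rfl, rfl⟩ := hP
    obtain ⟨Q', h, rfl⟩ := ih rfl
    exact ⟨_, .lam₂ _ h, rfl⟩
  | app₁ _ _ ih =>
    cases P <;> simp [Exp.rename] at hP
    obtain ⟨rfl, rfl⟩ := hP
    obtain ⟨Q', h, rfl⟩ := ih rfl
    exact ⟨_, .app₁ _ h, rfl⟩
  | app₂ _ _ ih =>
    cases P <;> simp [Exp.rename] at hP
    obtain ⟨rfl, rfl⟩ := hP
    obtain ⟨Q', h, rfl⟩ := ih rfl
    exact ⟨_, .app₂ _ h, rfl⟩

theorem Normal.rename {c : Cat} {P : Exp c} (h : Normal P) (r : ℕ → ℕ) : Normal (P.rename r) := by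
  intro Q hQ
  obtain ⟨Q', hQ', _⟩ := hQ.of_rename
  exact h _ hQ'

theorem Normal.of_rename {c : Cat} {P : Exp c} {r : ℕ → ℕ} (h : Normal (P.rename r)) : Normal P :=
  fun _ hQ => h _ (hQ.rename r)

theorem NormalFormOf.rename {c : Cat} {P Q : Exp c} (h : NormalFormOf P Q) (r : ℕ → ℕ) :
    NormalFormOf (P.rename r) (Q.rename r) := ⟨Steps.rename h.1 r, h.2.rename r⟩

theorem NormalFormOf.of_rename {c : Cat} {P Q : Exp c} {r : ℕ → ℕ}
    (h : NormalFormOf (P.rename r) Q) : ∃ Q', NormalFormOf P Q' ∧ Q = Q'.rename r := by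
  obtain ⟨h, hQ⟩ := h
  have : ∃ Q', Steps P Q' ∧ Q = Q'.rename r := by
    clear hQ
    induction h with
    | refl => exact ⟨_, .refl, rfl⟩
    | tail _ h ih =>
      obtain ⟨Q', h', rfl⟩ := ih
      obtain ⟨Q'', h'', rfl⟩ := h.of_rename
      exact ⟨_, h'.tail h'', rfl⟩
  obtain ⟨Q', h', rfl⟩ := this
  exact ⟨_, ⟨h', hQ.of_rename⟩, rfl⟩

/-! ### Normal forms and the constructors -/

theorem Normal.piK {A K} (h : Normal (.piK A K)) : Normal A ∧ Normal K :=
  ⟨fun _ h' => h _ (.piK₁ _ h'), fun _ h' => h _ (.piK₂ _ h')⟩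

theorem Normal.pi {A B} (h : Normal (.pi A B)) : Normal A ∧ Normal B :=
  ⟨fun _ h' => h _ (.pi₁ _ h'), fun _ h' => h _ (.pi₂ _ h')⟩

theorem Normal.lamF {A B} (h : Normal (.lamF A B)) : Normal A ∧ Normal B :=
  ⟨fun _ h' => h _ (.lamF₁ _ h'), fun _ h' => h _ (.lamF₂ _ h')⟩

theorem Normal.lam {A M} (h : Normal (.lam A M)) : Normal A ∧ Normal M :=
  ⟨fun _ h' => h _ (.lam₁ _ h'), fun _ h' => h _ (.lam₂ _ h')⟩

theorem Normal.appF {A M} (h : Normal (.appF A M)) :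
    Normal A ∧ Normal M ∧ ∀ B C, A ≠ .lamF B C :=
  ⟨fun _ h' => h _ (.appF₁ _ h'), fun _ h' => h _ (.appF₂ _ h'),
    fun _ _ e => by subst e; exact h _ (.betaF _ _ _)⟩

theorem Normal.app {M N} (h : Normal (.app M N)) : Normal M ∧ Normal N ∧ ∀ A L, M ≠ .lam A L :=
  ⟨fun _ h' => h _ (.app₁ _ h'), fun _ h' => h _ (.app₂ _ h'),
    fun _ _ e => by subst e; exact h _ (.beta _ _ _)⟩

theorem Normal.typ : Normal .typ := fun _ h => nomatch h

theorem Normal.tvar (u : ℕ) : Normal (.tvar u) := fun _ h => nomatch h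

theorem Normal.var (x : ℕ) : Normal (.var x) := fun _ h => nomatch h

theorem Normal.mk_piK {A K} (h : Normal A) (h' : Normal K) : Normal (.piK A K) := by
  intro Q hQ
  cases hQ with
  | piK₁ _ hQ => exact h _ hQ
  | piK₂ _ hQ => exact h' _ hQ

theorem Normal.mk_pi {A B} (h : Normal A) (h' : Normal B) : Normal (.pi A B) := by
  intro Q hQ
  cases hQ with
  | pi₁ _ hQ => exact h _ hQ
  | pi₂ _ hQ => exact h' _ hQ

theorem Normal.mk_lam {A M} (h : Normal A) (h' : Normal M) : Normal (.lam A M) := by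
  intro Q hQ
  cases hQ with
  | lam₁ _ hQ => exact h _ hQ
  | lam₂ _ hQ => exact h' _ hQ

theorem Normal.mk_app {M N} (h : Normal M) (h' : Normal N) (hM : ∀ A L, M ≠ .lam A L) :
    Normal (.app M N) := by
  intro Q hQ
  cases hQ with
  | beta A M N => exact hM _ _ rfl
  | app₁ _ hQ => exact h _ hQ
  | app₂ _ hQ => exact h' _ hQ

theorem NormalFormOf.mk_pi {A A' B B'} (h : NormalFormOf A A') (h' : NormalFormOf B B') :
    NormalFormOf (.pi A B) (.pi A' B') := ⟨Steps.pi h.1 h'.1, h.2.mk_pi h'.2⟩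

theorem NormalFormOf.mk_piK {A A' B B'} (h : NormalFormOf A A') (h' : NormalFormOf B B') :
    NormalFormOf (.piK A B) (.piK A' B') := ⟨Steps.piK h.1 h'.1, h.2.mk_piK h'.2⟩

theorem NormalFormOf.pi_inv {A B Q} (h : NormalFormOf (.pi A B) Q) :
    ∃ A' B', Q = .pi A' B' ∧ NormalFormOf A A' ∧ NormalFormOf B B' := by
  obtain ⟨h, hQ⟩ := h
  have : ∃ A' B', Q = .pi A' B' ∧ Steps A A' ∧ Steps B B' := by
    clear hQ
    induction h with
    | refl => exact ⟨_, _, rfl, .refl, .refl⟩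
    | tail _ h ih =>
      obtain ⟨A', B', rfl, h₁, h₂⟩ := ih
      cases h with
      | pi₁ _ h => exact ⟨_, _, rfl, h₁.tail h, h₂⟩
      | pi₂ _ h => exact ⟨_, _, rfl, h₁, h₂.tail h⟩
  obtain ⟨A', B', rfl, h₁, h₂⟩ := this
  exact ⟨_, _, rfl, ⟨h₁, hQ.pi.1⟩, ⟨h₂, hQ.pi.2⟩⟩

theorem NormalFormOf.piK_inv {A K Q} (h : NormalFormOf (.piK A K) Q) :
    ∃ A' K', Q = .piK A' K' ∧ NormalFormOf A A' ∧ NormalFormOf K K' := by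
  obtain ⟨h, hQ⟩ := h
  have : ∃ A' B', Q = .piK A' B' ∧ Steps A A' ∧ Steps K B' := by
    clear hQ
    induction h with
    | refl => exact ⟨_, _, rfl, .refl, .refl⟩
    | tail _ h ih =>
      obtain ⟨A', B', rfl, h₁, h₂⟩ := ih
      cases h with
      | piK₁ _ h => exact ⟨_, _, rfl, h₁.tail h, h₂⟩
      | piK₂ _ h => exact ⟨_, _, rfl, h₁, h₂.tail h⟩
  obtain ⟨A', B', rfl, h₁, h₂⟩ := this
  exact ⟨_, _, rfl, ⟨h₁, hQ.piK.1⟩, ⟨h₂, hQ.piK.2⟩⟩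

/-! ### Expressions without redexes at the level of types -/

/-- No subexpression of `P` is a type-level `β`-redex.  Contracting such a redex can change `φ`,
which has the dummy value `lf-obj` at type-level applications and abstractions; all other reductions
preserve `φ`.  The condition holds for normal expressions and is stable under substitution, which
concerns object variables only, and under reduction, all without any typing. -/
def NoRedF : {c : Cat} → Exp c → Prop
  | _, .typ => True
  | _, .piK A K => NoRedF A ∧ NoRedF K
  | _, .tvar _ => True
  | _, .pi A B => NoRedF A ∧ NoRedF B
  | _, .lamF A B => NoRedF A ∧ NoRedF B
  | _, .appF A M => (∀ B C, A ≠ .lamF B C) ∧ NoRedF A ∧ NoRedF M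
  | _, .var _ => True
  | _, .lam A M => NoRedF A ∧ NoRedF M
  | _, .app M N => NoRedF M ∧ NoRedF N

theorem Normal.noRedF {c : Cat} {P : Exp c} (h : Normal P) : NoRedF P := by
  induction P with
  | typ => trivial
  | tvar => trivial
  | var => trivial
  | piK _ _ ih₁ ih₂ => exact ⟨ih₁ h.piK.1, ih₂ h.piK.2⟩
  | pi _ _ ih₁ ih₂ => exact ⟨ih₁ h.pi.1, ih₂ h.pi.2⟩
  | lamF _ _ ih₁ ih₂ => exact ⟨ih₁ h.lamF.1, ih₂ h.lamF.2⟩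
  | lam _ _ ih₁ ih₂ => exact ⟨ih₁ h.lam.1, ih₂ h.lam.2⟩
  | appF _ _ ih₁ ih₂ => exact ⟨h.appF.2.2, ih₁ h.appF.1, ih₂ h.appF.2.1⟩
  | app _ _ ih₁ ih₂ => exact ⟨ih₁ h.app.1, ih₂ h.app.2.1⟩

theorem NoRedF.rename {c : Cat} {P : Exp c} (h : NoRedF P) (r : ℕ → ℕ) : NoRedF (P.rename r) := by
  induction P generalizing r with
  | appF A M ih₁ ih₂ =>
    refine ⟨?_, ih₁ h.2.1 _, ih₂ h.2.2 _⟩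
    intro B C e
    cases A <;> simp [Exp.rename] at e
    exact h.1 _ _ rfl
  | typ => trivial
  | tvar => trivial
  | var => trivial
  | _ => constructor <;> simp_all [NoRedF]

theorem NoRedF.subst {c : Cat} {P : Exp c} (h : NoRedF P) {s : ℕ → Obj} (hs : ∀ x, NoRedF (s x)) :
    NoRedF (P.subst s) := by
  have up : ∀ {s : ℕ → Obj}, (∀ x, NoRedF (s x)) → ∀ x, NoRedF (upSubst s x) := by
    intro s hs x
    cases x
    · trivial
    · exact (hs _).rename _
  induction P generalizing s with
  | appF A M ih₁ ih₂ =>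
    refine ⟨?_, ih₁ h.2.1 hs, ih₂ h.2.2 hs⟩
    intro B C e
    cases A <;> simp [Exp.subst] at e
    exact h.1 _ _ rfl
  | typ => trivial
  | tvar => trivial
  | var => exact hs _
  | app _ _ ih₁ ih₂ => exact ⟨ih₁ h.1 hs, ih₂ h.2 hs⟩
  | piK _ _ ih₁ ih₂ => exact ⟨ih₁ h.1 hs, ih₂ h.2 (up hs)⟩
  | pi _ _ ih₁ ih₂ => exact ⟨ih₁ h.1 hs, ih₂ h.2 (up hs)⟩
  | lamF _ _ ih₁ ih₂ => exact ⟨ih₁ h.1 hs, ih₂ h.2 (up hs)⟩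
  | lam _ _ ih₁ ih₂ => exact ⟨ih₁ h.1 hs, ih₂ h.2 (up hs)⟩

theorem NoRedF.inst {c : Cat} {P : Exp c} (h : NoRedF P) {N : Obj} (hN : NoRedF N) :
    NoRedF (P.inst N) := by
  refine h.subst fun x => ?_
  cases x
  · exact hN
  · simp only [instObj_succ]; trivial

/-- Without type-level redexes, reduction does not change the `Π`-structure. -/
theorem Step.noRedF {c : Cat} {P Q : Exp c} (h : Step P Q) (hP : NoRedF P) :
    NoRedF Q ∧ (c ≠ .obj → Q.phi = P.phi) := by
  have aux : ∀ {A A' : Fam}, Step A A' → (∀ B C, A ≠ .lamF B C) → NoRedF A →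
      ∀ B C, A' ≠ .lamF B C := by
    intro A A' h h₁ h₂ B C e
    cases h with
    | betaF => exact h₂.1 _ _ rfl
    | lamF₁ => exact h₁ _ _ rfl
    | lamF₂ => exact h₁ _ _ rfl
    | _ => cases e
  induction h with
  | betaF => exact (hP.1 _ _ rfl).elim
  | beta => exact ⟨hP.1.2.inst hP.2, fun h => (h rfl).elim⟩
  | appF₁ _ h ih => exact ⟨⟨aux h hP.1 hP.2.1, (ih hP.2.1).1, hP.2.2⟩, fun _ => rfl⟩
  | appF₂ _ _ ih => exact ⟨⟨hP.1, hP.2.1, (ih hP.2.2).1⟩, fun _ => rfl⟩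
  | piK₁ _ _ ih | pi₁ _ _ ih | lamF₁ _ _ ih =>
    exact ⟨⟨(ih hP.1).1, hP.2⟩, by simp [Exp.phi, ih hP.1]⟩
  | piK₂ _ _ ih | pi₂ _ _ ih | lamF₂ _ _ ih =>
    exact ⟨⟨hP.1, (ih hP.2).1⟩, by simp [Exp.phi, ih hP.2]⟩
  | lam₁ _ _ ih => exact ⟨⟨(ih hP.1).1, hP.2⟩, fun h => (h rfl).elim⟩
  | lam₂ _ _ ih => exact ⟨⟨hP.1, (ih hP.2).1⟩, fun h => (h rfl).elim⟩
  | app₁ _ _ ih => exact ⟨⟨(ih hP.1).1, hP.2⟩, fun h => (h rfl).elim⟩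
  | app₂ _ _ ih => exact ⟨⟨hP.1, (ih hP.2).1⟩, fun h => (h rfl).elim⟩

theorem Steps.noRedF {c : Cat} {P Q : Exp c} (h : Steps P Q) (hP : NoRedF P) :
    NoRedF Q ∧ (c ≠ .obj → Q.phi = P.phi) := by
  induction h with
  | refl => exact ⟨hP, fun _ => rfl⟩
  | tail _ h ih => exact ⟨(h.noRedF ih.1).1, fun hc => ((h.noRedF ih.1).2 hc).trans (ih.2 hc)⟩

theorem Exp.phi_arity {c : Cat} (P : Exp c) : P.phi.arity = P.piCount := by
  induction P <;> simp_all [Exp.phi, Exp.piCount, HTy.arity]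

/-! ### Simple typing of LF expressions and weak normalization -/

/-- Simple typing of LF expressions, dependencies being erased by `φ`.  It covers the types that
annotate abstractions, and it excludes type-level abstractions.  The simple type of a kind or a type
is the dummy `o`. -/
inductive ST : {c : Cat} → List HTy → Exp c → HTy → Prop where
  | typ {Θ} : ST Θ .typ .o
  | piK {Θ A K} : ST Θ A .o → ST (A.phi :: Θ) K .o → ST Θ (.piK A K) .o
  | tvar {Θ} (u) : ST Θ (.tvar u) .o
  | pi {Θ A B} : ST Θ A .o → ST (A.phi :: Θ) B .o → ST Θ (.pi A B) .o
  | appF {Θ A M a} : ST Θ A .o → ST Θ M a → ST Θ (.appF A M) .o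
  | var {Θ x a} : Θ[x]? = some a → ST Θ (.var x) a
  | lam {Θ A M b} : ST Θ A .o → ST (A.phi :: Θ) M b → ST Θ (.lam A M) (.arr A.phi b)
  | app {Θ M N a b} : ST Θ M (.arr a b) → ST Θ N a → ST Θ (.app M N) b

namespace ST

theorem hasTy_enc {c : Cat} {Θ} {P : Exp c} {a} (h : ST Θ P a) (hc : c = .obj)
    (S : List (ℕ × HTy)) : HasTy S Θ (enc P) a := by
  induction h with
  | var h => exact .var h
  | lam _ _ _ ih => exact .lam (ih rfl)
  | app _ _ ih₁ ih₂ => exact .app (ih₁ rfl) (ih₂ rfl)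
  | _ => cases hc

theorem hasTy {Θ} {M : Obj} {a} (h : ST Θ M a) (S : List (ℕ × HTy)) : HasTy S Θ (enc M) a :=
  h.hasTy_enc rfl S

theorem noRedF {c : Cat} {Θ} {P : Exp c} {a} (h : ST Θ P a) : NoRedF P := by
  induction h with
  | appF h _ ih₁ ih₂ => exact ⟨fun B C e => by (subst e; cases h), ih₁, ih₂⟩
  | typ => trivial
  | tvar => trivial
  | var => trivial
  | _ => constructor <;> assumption

theorem rename {c : Cat} {Θ Θ'} {P : Exp c} {a ρ} (h : ST Θ P a) (hρ : HRen Θ Θ' ρ) :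
    ST Θ' (P.rename ρ) a := by
  induction h generalizing Θ' ρ with
  | typ => exact .typ
  | tvar u => exact .tvar u
  | var h => exact .var (hρ _ _ h)
  | piK _ _ ih₁ ih₂ => exact .piK (ih₁ hρ) (by rw [Exp.phi_rename]; exact ih₂ (hρ.up _))
  | pi _ _ ih₁ ih₂ => exact .pi (ih₁ hρ) (by rw [Exp.phi_rename]; exact ih₂ (hρ.up _))
  | lam _ _ ih₁ ih₂ =>
    rw [← Exp.phi_rename _ ρ]
    exact .lam (ih₁ hρ) (by rw [Exp.phi_rename]; exact ih₂ (hρ.up _))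
  | appF _ _ ih₁ ih₂ => exact .appF (ih₁ hρ) (ih₂ hρ)
  | app _ _ ih₁ ih₂ => exact .app (ih₁ hρ) (ih₂ hρ)

theorem up {Θ Θ' s} (hs : ∀ x a, Θ[x]? = some a → ST Θ' (s x) a) (b : HTy) :
    ∀ x a, (b :: Θ)[x]? = some a → ST (b :: Θ') (upSubst s x) a := by
  intro x a hx
  cases x
  · exact .var hx
  · exact (hs _ _ hx).rename (HRen.succ _ _)

theorem subst {c : Cat} {Θ Θ'} {P : Exp c} {a s} (h : ST Θ P a)
    (hs : ∀ x a, Θ[x]? = some a → ST Θ' (s x) a) : ST Θ' (P.subst s) a := by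
  induction h generalizing Θ' s with
  | typ => exact .typ
  | tvar u => exact .tvar u
  | var h => exact hs _ _ h
  | piK _ _ ih₁ ih₂ => exact .piK (ih₁ hs) (by rw [Exp.phi_subst_fam]; exact ih₂ (up hs _))
  | pi _ _ ih₁ ih₂ => exact .pi (ih₁ hs) (by rw [Exp.phi_subst_fam]; exact ih₂ (up hs _))
  | @lam _ A _ _ _ _ ih₁ ih₂ =>
    rw [← Exp.phi_subst_fam A s]
    exact .lam (ih₁ hs) (by rw [Exp.phi_subst_fam]; exact ih₂ (up hs _))
  | appF _ _ ih₁ ih₂ => exact .appF (ih₁ hs) (ih₂ hs)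
  | app _ _ ih₁ ih₂ => exact .app (ih₁ hs) (ih₂ hs)

theorem inst {c : Cat} {Θ} {P : Exp c} {a b N} (h : ST (b :: Θ) P a) (hN : ST Θ N b) :
    ST Θ (P.inst N) a := by
  refine h.subst fun x c hx => ?_
  cases x
  · cases hx; exact hN
  · simp only [instObj_succ]; exact .var hx

theorem step {c : Cat} {Θ} {P Q : Exp c} {a} (h : ST Θ P a) (hPQ : Step P Q) : ST Θ Q a := by
  induction hPQ generalizing Θ a with
  | betaF => cases h with | appF h _ => cases h
  | beta => cases h with | app h₁ h₂ => cases h₁ with | lam _ h₁ => exact h₁.inst h₂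
  | piK₁ _ h₁ ih =>
    cases h with | piK h h' => exact .piK (ih h) (by rwa [(h₁.noRedF h.noRedF).2 nofun])
  | piK₂ _ _ ih => cases h with | piK h h' => exact .piK h (ih h')
  | pi₁ _ h₁ ih =>
    cases h with | pi h h' => exact .pi (ih h) (by rwa [(h₁.noRedF h.noRedF).2 nofun])
  | pi₂ _ _ ih => cases h with | pi h h' => exact .pi h (ih h')
  | lamF₁ => cases h
  | lamF₂ => cases h
  | appF₁ _ _ ih => cases h with | appF h h' => exact .appF (ih h) h'
  | appF₂ _ _ ih => cases h with | appF h h' => exact .appF h (ih h')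
  | lam₁ _ h₁ ih =>
    cases h with | lam h h' =>
    have e := (h₁.noRedF h.noRedF).2 nofun
    rw [← e] at h' ⊢
    exact .lam (ih h) h'
  | lam₂ _ _ ih => cases h with | lam h h' => exact .lam h (ih h')
  | app₁ _ _ ih => cases h with | app h h' => exact .app (ih h) h'
  | app₂ _ _ ih => cases h with | app h h' => exact .app h (ih h')

theorem steps {c : Cat} {Θ} {P Q : Exp c} {a} (h : ST Θ P a) (hPQ : Steps P Q) : ST Θ Q a := by
  induction hPQ with
  | refl => exact h
  | tail _ h' ih => exact ih.step h'

end ST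

/-- The expression is not a type-level abstraction applied to any number of arguments, including
none. -/
def FamHead : {c : Cat} → Exp c → Prop
  | _, .lamF _ _ => False
  | _, .appF A _ => FamHead A
  | _, _ => True

theorem ST.famHead_subst {c : Cat} {Θ} {P : Exp c} {a} (h : ST Θ P a) (hc : c = .fam)
    (s : ℕ → Obj) : FamHead (P.subst s) := by
  induction h with
  | tvar => trivial
  | pi => trivial
  | appF _ _ ih => exact ih rfl
  | _ => cases hc

theorem FamHead.step {c : Cat} {P Q : Exp c} (h : Step P Q) (hc : c = .fam) (hP : FamHead P) :
    FamHead Q := by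
  induction h with
  | pi₁ => trivial
  | pi₂ => trivial
  | appF₁ _ _ ih => exact ih rfl hP
  | appF₂ => exact hP
  | betaF => exact hP.elim
  | lamF₁ => exact hP.elim
  | lamF₂ => exact hP.elim
  | _ => cases hc

theorem FamHead.steps {A A' : Fam} (h : Steps A A') (hA : FamHead A) : FamHead A' := by
  induction h with
  | refl => exact hA
  | tail _ h ih => exact ih.step h rfl

/-- Reducibility: having a normal form and, at arrow types, preserving reducibility. -/
def Red : HTy → Obj → Prop
  | .arr a b, M => (∃ Q, NormalFormOf M Q) ∧
      ∀ (ρ : ℕ → ℕ) N, Red a N → Red b (.app (M.rename ρ) N)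
  | _, M => ∃ Q, NormalFormOf M Q

namespace Red

theorem wn {a : HTy} {M : Obj} (h : Red a M) : ∃ Q, NormalFormOf M Q := by
  cases a
  case arr => exact h.1
  all_goals exact h

theorem expand {a : HTy} {M M' : Obj} (hM : Step M M') (h : Red a M') : Red a M := by
  have wn : (∃ Q, NormalFormOf M' Q) → ∃ Q, NormalFormOf M Q :=
    fun ⟨Q, hQ⟩ => ⟨Q, hQ.head (.single hM)⟩
  induction a generalizing M M' with
  | arr a b _ ihb =>
    refine ⟨wn h.1, fun ρ N hN => ihb (.app₁ N (hM.rename ρ)) (h.2 ρ N hN) ?_⟩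
    exact fun ⟨Q, hQ⟩ => ⟨Q, hQ.head (.single (.app₁ N (hM.rename ρ)))⟩
  | _ => exact wn h

theorem rename {a : HTy} {M : Obj} (h : Red a M) (ρ : ℕ → ℕ) : Red a (M.rename ρ) := by
  have wn : (∃ Q, NormalFormOf M Q) → ∃ Q, NormalFormOf (M.rename ρ) Q :=
    fun ⟨Q, hQ⟩ => ⟨_, hQ.rename ρ⟩
  cases a with
  | arr a b =>
    refine ⟨wn h.1, fun ρ' N hN => ?_⟩
    rw [Exp.rename_rename]
    exact h.2 _ N hN
  | _ => exact wn h

theorem of_neutral {a : HTy} {M Q : Obj} (h : NormalFormOf M Q) (hQ : ∀ A L, Q ≠ .lam A L) :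
    Red a M := by
  induction a generalizing M Q with
  | arr a b _ ihb =>
    refine ⟨⟨Q, h⟩, fun ρ N hN => ?_⟩
    obtain ⟨N', hN'⟩ := hN.wn
    have hQρ : ∀ A L, Q.rename ρ ≠ .lam A L := by
      intro A L e
      cases Q <;> simp [Exp.rename] at e
      exact hQ _ _ rfl
    exact ihb (Q := .app (Q.rename ρ) N') ⟨Steps.app (Steps.rename h.1 ρ) hN'.1,
      (h.2.rename ρ).mk_app hN'.2 hQρ⟩ nofun
  | _ => exact ⟨Q, h⟩

theorem var (a : HTy) (x : ℕ) : Red a (.var x) :=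
  of_neutral (.of_normal (.var x)) nofun

end Red

/-- Reducibility for objects, having a normal form for kinds and types. -/
def RedAt : {c : Cat} → HTy → Exp c → Prop
  | .obj, a, M => Red a M
  | _, _, P => ∃ Q, NormalFormOf P Q

theorem RedAt.wn {c : Cat} {a : HTy} {P : Exp c} (h : RedAt a P) : ∃ Q, NormalFormOf P Q := by
  cases c
  case obj => exact Red.wn h
  all_goals exact h

/-- Simply typed objects are reducible under reducible substitutions; simply typed kinds and types
have normal forms under such substitutions. -/
theorem Red.of_st {c : Cat} {Θ} {P : Exp c} {a} (h : ST Θ P a) :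
    ∀ s : ℕ → Obj, (∀ x b, Θ[x]? = some b → Red b (s x)) →
      RedAt a (P.subst s) := by
  have up : ∀ {Θ : List HTy} {b : HTy} {s : ℕ → Obj}, (∀ x b, Θ[x]? = some b → Red b (s x)) →
      ∀ x a, (b :: Θ)[x]? = some a → Red a (upSubst s x) := by
    intro Θ b s hs x a hx
    cases x
    · exact var _ _
    · exact (hs _ _ hx).rename _
  induction h with
  | typ => exact fun s _ => ⟨_, .of_normal .typ⟩
  | tvar u => exact fun s _ => ⟨_, .of_normal (.tvar u)⟩
  | piK _ _ ih₁ ih₂ =>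
    intro s hs
    obtain ⟨_, h₁⟩ := (ih₁ s hs).wn
    obtain ⟨_, h₂⟩ := (ih₂ _ (up hs)).wn
    exact ⟨_, h₁.mk_piK h₂⟩
  | pi _ _ ih₁ ih₂ =>
    intro s hs
    obtain ⟨_, h₁⟩ := (ih₁ s hs).wn
    obtain ⟨_, h₂⟩ := (ih₂ _ (up hs)).wn
    exact ⟨_, h₁.mk_pi h₂⟩
  | @appF Θ A M a hA _ ih₁ ih₂ =>
    intro s hs
    obtain ⟨A', h₁⟩ := (ih₁ s hs).wn
    obtain ⟨M', h₂⟩ := (ih₂ s hs).wn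
    refine ⟨.appF A' M', Steps.appF h₁.1 h₂.1, ?_⟩
    have hA' := (hA.famHead_subst rfl s).steps h₁.1
    intro Q hQ
    cases hQ with
    | betaF => exact hA'
    | appF₁ _ h => exact h₁.2 _ h
    | appF₂ _ h => exact h₂.2 _ h
  | var h => exact fun s hs => hs _ _ h
  | @lam Θ A M b _ _ ih₁ ih₂ =>
    intro s hs
    obtain ⟨A', h₁⟩ := (ih₁ s hs).wn
    obtain ⟨M', h₂⟩ := (ih₂ _ (up hs)).wn
    have hwn : ∃ Q, NormalFormOf ((Exp.lam A M).subst s) Q :=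
      ⟨.lam A' M', Steps.lam h₁.1 h₂.1, h₁.2.mk_lam h₂.2⟩
    refine ⟨hwn, fun ρ N hN => ?_⟩
    refine expand (.beta _ _ _) ?_
    rw [Exp.rename_subst, upSubst_rename, Exp.subst_up_inst]
    refine ih₂ _ fun x c hx => ?_
    cases x
    · cases hx; exact hN
    · exact (hs _ _ hx).rename ρ
  | app _ _ ih₁ ih₂ =>
    intro s hs
    have := (ih₁ s hs).2 (fun x => x) _ (ih₂ s hs)
    rw [Exp.rename_id] at this
    exact this

/-- Simply typed expressions have normal forms. -/
theorem ST.wn {c : Cat} {Θ} {P : Exp c} {a} (h : ST Θ P a) : ∃ Q, NormalFormOf P Q := by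
  have := (Red.of_st h .var fun x b _ => Red.var b x).wn
  rwa [Exp.subst_var] at this

/-! ### Contexts and renaming in LF derivations -/

theorem ObjIn.functional {Γ x A A'} (h : ObjIn Γ x A) (h' : ObjIn Γ x A') : A = A' := by
  induction h generalizing A' with
  | here => cases h'; rfl
  | skipFam _ _ _ ih => cases h' with | skipFam _ _ h' => exact ih h'
  | skipObj _ _ ih => cases h' with | skipObj _ h' => rw [ih h']

theorem ObjIn.objSig {Γ x A} (h : ObjIn Γ x A) : (objSig Γ)[x]? = some A.phi := by
  induction h with
  | here => simp [RigidLF.objSig, Exp.phi_shift]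
  | skipFam _ _ _ ih => exact ih
  | skipObj _ _ ih => simpa [RigidLF.objSig, Exp.phi_shift] using ih

theorem exists_objIn : ∀ {Γ : Ctx} {x : ℕ} {a : HTy}, (objSig Γ)[x]? = some a →
    ∃ A, ObjIn Γ x A ∧ A.phi = a
  | .fam u K :: Γ, x, a, h => by
    obtain ⟨A, hA, e⟩ := exists_objIn (Γ := Γ) h
    exact ⟨A, .skipFam _ _ hA, e⟩
  | .obj A :: Γ, 0, a, h => ⟨_, .here _ _, by simpa [objSig, Exp.phi_shift] using h⟩
  | .obj A :: Γ, x + 1, a, h => by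
    obtain ⟨A, hA, e⟩ := exists_objIn (Γ := Γ) (x := x) (by simpa [objSig] using h)
    exact ⟨_, .skipObj _ hA, by rw [Exp.phi_shift, e]⟩

theorem exists_famIn : ∀ {Γ : Ctx} {u : ℕ} {a : HTy}, (u, a) ∈ famSig Γ →
    ∃ K, FamIn Γ u K ∧ K.phi = a
  | .fam v L :: Γ, u, a, h => by
    rcases List.mem_cons.1 h with h | h
    · cases h; exact ⟨_, .here _ _ _, rfl⟩
    · obtain ⟨K, hK, e⟩ := exists_famIn (Γ := Γ) h
      exact ⟨K, .skipFam _ _ hK, e⟩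
  | .obj A :: Γ, u, a, h => by
    obtain ⟨K, hK, e⟩ := exists_famIn (Γ := Γ) h
    exact ⟨_, .skipObj _ hK, by rw [Exp.phi_shift, e]⟩

theorem Derives.ctx {Γ J} (h : Derives Γ J) : Derives Γ .ctx := by
  induction h with
  | nullCtx => exact .nullCtx
  | kindCtx h₁ h₂ h₃ => exact .kindCtx h₁ h₂ h₃
  | typeCtx h₁ h₂ => exact .typeCtx h₁ h₂
  | typeKind h => exact h
  | varFam h => exact h
  | varObj h => exact h
  | _ => assumption

/-- In a well-formed context each type variable has one kind. -/
theorem Derives.famIn_functional {Γ} (h : Derives Γ .ctx) {u K K'} (hK : FamIn Γ u K)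
    (hK' : FamIn Γ u K') : K = K' := by
  induction hK generalizing K' with
  | here =>
    cases h with | kindCtx _ _ hn =>
    cases hK' with
    | here => rfl
    | skipFam _ _ h' => exact (hn _ h').elim
  | skipFam _ _ h₁ ih =>
    cases h with | kindCtx _ h hn =>
    cases hK' with
    | here => exact (hn _ h₁).elim
    | skipFam _ _ h' => exact ih h h'
  | skipObj _ _ ih =>
    cases h with | typeCtx _ h =>
    cases hK' with | skipObj _ h' => rw [ih h h']

theorem Derives.sigFun {Γ} (h : Derives Γ .ctx) : SigFun (famSig Γ) := by
  intro u a b ha hb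
  obtain ⟨K, hK, rfl⟩ := exists_famIn ha
  obtain ⟨L, hL, rfl⟩ := exists_famIn hb
  rw [h.famIn_functional hK hL]

/-- `ρ` is a renaming from `Γ` to `Γ'` that respects the declarations. -/
structure Ren (Γ Γ' : Ctx) (ρ : ℕ → ℕ) : Prop where
  fam : ∀ {u K}, FamIn Γ u K → FamIn Γ' u (K.rename ρ)
  obj : ∀ {x A}, ObjIn Γ x A → ObjIn Γ' (ρ x) (A.rename ρ)

theorem Ren.up {Γ Γ' ρ} (h : Ren Γ Γ' ρ) (A : Fam) :
    Ren (.obj A :: Γ) (.obj (A.rename ρ) :: Γ') (upRen ρ) where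
  fam hK := by
    cases hK with | skipObj _ hK => rw [Exp.shift_rename]; exact .skipObj _ (h.fam hK)
  obj hA := by
    cases hA with
    | here => rw [Exp.shift_rename]; exact .here _ _
    | skipObj _ hA => rw [Exp.shift_rename]; exact .skipObj _ (h.obj hA)

theorem Ren.succ (Γ : Ctx) (A : Fam) : Ren Γ (.obj A :: Γ) Nat.succ :=
  ⟨fun h => .skipObj _ h, fun h => .skipObj _ h⟩

theorem Ren.skipFam (Γ : Ctx) (u : ℕ) (K : Kind) : Ren Γ (.fam u K :: Γ) fun x => x :=
  ⟨fun h => by rw [Exp.rename_id]; exact .skipFam _ _ h,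
    fun h => by rw [Exp.rename_id]; exact .skipFam _ _ h⟩

theorem Ren.comp {Γ Γ' Γ'' ρ ρ'} (h : Ren Γ Γ' ρ) (h' : Ren Γ' Γ'' ρ') :
    Ren Γ Γ'' fun x => ρ' (ρ x) :=
  ⟨fun hK => by rw [← Exp.rename_rename]; exact h'.fam (h.fam hK),
    fun hA => by rw [← Exp.rename_rename]; exact h'.obj (h.obj hA)⟩

theorem Ren.hRen {Γ Γ' ρ} (h : Ren Γ Γ' ρ) : HRen (objSig Γ) (objSig Γ') ρ := by
  intro x a hx
  obtain ⟨A, hA, rfl⟩ := exists_objIn hx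
  rw [(h.obj hA).objSig, Exp.phi_rename]

/-- Renaming of an assertion; it does not affect `Γ ctx`. -/
def Assertion.rename (ρ : ℕ → ℕ) : Assertion → Assertion
  | .ctx => .ctx
  | .kind K => .kind (K.rename ρ)
  | .fam A K => .fam (A.rename ρ) (K.rename ρ)
  | .obj M A => .obj (M.rename ρ) (A.rename ρ)

theorem Derives.rename {Γ J} (h : Derives Γ J) {Γ' ρ} (hρ : Ren Γ Γ' ρ) (hΓ' : Derives Γ' .ctx) :
    Derives Γ' (J.rename ρ) := by
  induction h generalizing Γ' ρ with
  | nullCtx => exact hΓ'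
  | kindCtx => exact hΓ'
  | typeCtx => exact hΓ'
  | typeKind => exact .typeKind hΓ'
  | piKind _ _ ih₁ ih₂ => exact .piKind (ih₁ hρ hΓ') (ih₂ (hρ.up _) (.typeCtx (ih₁ hρ hΓ') hΓ'))
  | varFam _ h₁ h₂ => exact .varFam hΓ' (hρ.fam h₁) (h₂.rename _)
  | varObj _ h₁ h₂ => exact .varObj hΓ' (hρ.obj h₁) (h₂.rename _)
  | piFam _ _ ih₁ ih₂ => exact .piFam (ih₁ hρ hΓ') (ih₂ (hρ.up _) (.typeCtx (ih₁ hρ hΓ') hΓ'))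
  | absFam _ _ h ih₁ ih₂ =>
    exact .absFam (ih₁ hρ hΓ') (ih₂ (hρ.up _) (.typeCtx (ih₁ hρ hΓ') hΓ')) (h.rename _)
  | absObj _ _ h ih₁ ih₂ =>
    exact .absObj (ih₁ hρ hΓ') (ih₂ (hρ.up _) (.typeCtx (ih₁ hρ hΓ') hΓ')) (h.rename _)
  | appFam _ _ h ih₁ ih₂ =>
    exact .appFam (ih₁ hρ hΓ') (ih₂ hρ hΓ') (by rw [← Exp.inst_rename]; exact h.rename _)
  | appObj _ _ h ih₁ ih₂ =>
    exact .appObj (ih₁ hρ hΓ') (ih₂ hρ hΓ') (by rw [← Exp.inst_rename]; exact h.rename _)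

/-- The types that a well-formed context assigns are well-formed. -/
theorem Derives.of_objIn {Γ x A} (hx : ObjIn Γ x A) (h : Derives Γ .ctx) :
    Derives Γ (.fam A .typ) := by
  induction hx with
  | here Γ A =>
    cases h with | typeCtx h₁ h₂ => exact h₁.rename (Ren.succ Γ A) (.typeCtx h₁ h₂)
  | @skipFam Γ x A v L _ ih =>
    have h' := h
    cases h with | kindCtx _ h₁ _ =>
    simpa only [Assertion.rename, Exp.rename_id] using (ih h₁).rename (Ren.skipFam Γ v L) h'
  | skipObj B _ ih =>
    have h' := h
    cases h with | typeCtx _ h₁ => exact (ih h₁).rename (Ren.succ _ B) h'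

theorem Derives.not_lamF {Γ A} (h : Derives Γ (.fam A .typ)) : ∀ B C, A ≠ .lamF B C := by
  rintro B C rfl
  cases h

/-- The classifier of a derivable assertion is normal. -/
def Assertion.ClassifierNormal : Assertion → Prop
  | .fam _ K => Normal K
  | .obj _ A => Normal A
  | _ => True

theorem Derives.classifierNormal {Γ J} (h : Derives Γ J) : J.ClassifierNormal := by
  induction h with
  | varFam _ _ h => exact h.2
  | varObj _ _ h => exact h.2
  | appFam _ _ h => exact h.2
  | appObj _ _ h => exact h.2
  | piFam => exact .typ
  | absFam _ _ h _ ih => exact h.2.mk_piK ih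
  | absObj _ _ h _ ih => exact h.2.mk_pi ih
  | _ => trivial

theorem Derives.normal_kind {Γ A K} (h : Derives Γ (.fam A K)) : Normal K := h.classifierNormal

theorem Derives.normal_type {Γ M A} (h : Derives Γ (.obj M A)) : Normal A := h.classifierNormal

/-! ### Simple typing of derivable assertions -/

/-- The expression contains no type-level abstraction. -/
def Flat : {c : Cat} → Exp c → Prop
  | _, .typ => True
  | _, .piK A K => Flat A ∧ Flat K
  | _, .tvar _ => True
  | _, .pi A B => Flat A ∧ Flat B
  | _, .lamF _ _ => False
  | _, .appF A M => Flat A ∧ Flat M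
  | _, .var _ => True
  | _, .lam A M => Flat A ∧ Flat M
  | _, .app M N => Flat M ∧ Flat N

/-- All types and kinds that the context assigns are free of type-level abstractions. -/
def FlatCtx : Ctx → Prop
  | [] => True
  | .fam _ K :: Γ => Flat K ∧ FlatCtx Γ
  | .obj A :: Γ => Flat A ∧ FlatCtx Γ

/-- All types and kinds that the context assigns are normal. -/
def NormalCtx : Ctx → Prop
  | [] => True
  | .fam _ K :: Γ => Normal K ∧ NormalCtx Γ
  | .obj A :: Γ => Normal A ∧ NormalCtx Γ

theorem ST.flat {c : Cat} {Θ} {P : Exp c} {a} (h : ST Θ P a) : Flat P := by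
  induction h with
  | typ => trivial
  | tvar => trivial
  | var => trivial
  | _ => constructor <;> assumption

/-- Normality of the subject entails flatness, except for type-level abstractions themselves. -/
def Assertion.FlatOfNormal : Assertion → Prop
  | .ctx => True
  | .kind K => Normal K → Flat K
  | .fam A _ => Normal A → (∀ B C, A ≠ .lamF B C) → Flat A
  | .obj M _ => Normal M → Flat M

/-- A type-level abstraction in a well-typed normal expression could only stand at the root: the
annotations of binders have kind `Type`, and in an application it would give a redex. -/
theorem Derives.flatOfNormal {Γ J} (h : Derives Γ J) : J.FlatOfNormal := by
  induction h with
  | nullCtx => trivial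
  | kindCtx => trivial
  | typeCtx => trivial
  | typeKind => exact fun _ => trivial
  | varFam => exact fun _ _ => trivial
  | varObj => exact fun _ => trivial
  | piKind h _ ih₁ ih₂ => exact fun hn => ⟨ih₁ hn.piK.1 h.not_lamF, ih₂ hn.piK.2⟩
  | piFam h h' ih₁ ih₂ => exact fun hn _ => ⟨ih₁ hn.pi.1 h.not_lamF, ih₂ hn.pi.2 h'.not_lamF⟩
  | absFam => exact fun _ h => (h _ _ rfl).elim
  | absObj h _ _ ih₁ ih₂ => exact fun hn => ⟨ih₁ hn.lam.1 h.not_lamF, ih₂ hn.lam.2⟩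
  | appFam _ _ _ ih₁ ih₂ => exact fun hn _ => ⟨ih₁ hn.appF.1 hn.appF.2.2, ih₂ hn.appF.2.1⟩
  | appObj _ _ _ ih₁ ih₂ => exact fun hn => ⟨ih₁ hn.app.1, ih₂ hn.app.2.1⟩

theorem Derives.flat_kind {Γ K} (h : Derives Γ (.kind K)) (hK : Normal K) : Flat K :=
  h.flatOfNormal hK

theorem Derives.flat_type {Γ A} (h : Derives Γ (.fam A .typ)) (hA : Normal A) : Flat A :=
  h.flatOfNormal hA h.not_lamF

theorem Derives.flat_obj {Γ M A} (h : Derives Γ (.obj M A)) (hM : Normal M) : Flat M :=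
  h.flatOfNormal hM

theorem NormalCtx.flatCtx : ∀ {Γ : Ctx}, NormalCtx Γ → Derives Γ .ctx → FlatCtx Γ
  | [], _, _ => trivial
  | .fam _ _ :: _, h, h' => by
    cases h' with | kindCtx h₁ h₂ _ => exact ⟨h₁.flat_kind h.1, h.2.flatCtx h₂⟩
  | .obj _ :: _, h, h' => by
    cases h' with | typeCtx h₁ h₂ => exact ⟨h₁.flat_type h.1, h.2.flatCtx h₂⟩

theorem NormalCtx.famIn {Γ u K} (h : NormalCtx Γ) (hu : FamIn Γ u K) : Normal K := by
  induction hu with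
  | here => exact h.1
  | skipFam _ _ _ ih => exact ih h.2
  | skipObj _ _ ih => exact (ih h.2).rename _

theorem NormalCtx.objIn {Γ x A} (h : NormalCtx Γ) (hx : ObjIn Γ x A) : Normal A := by
  induction hx with
  | here => exact h.1.rename _
  | skipFam _ _ _ ih => exact ih h.2
  | skipObj _ _ ih => exact (ih h.2).rename _

theorem NormalFormOf.phi_eq {A A' : Fam} (h : NormalFormOf A A') (hA : NoRedF A) :
    A'.phi = A.phi := (Steps.noRedF h.1 hA).2 nofun

/-- Simple typing of the expressions in an assertion with a flat subject. -/
def Assertion.Simple (Γ : Ctx) : Assertion → Prop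
  | .ctx => (∀ u K, FamIn Γ u K → ST (objSig Γ) K .o) ∧ ∀ x A, ObjIn Γ x A → ST (objSig Γ) A .o
  | .kind K => Flat K → ST (objSig Γ) K .o
  | .fam A K => Flat A → ST (objSig Γ) A .o ∧ ST (objSig Γ) K .o
  | .obj M A => Flat M → ST (objSig Γ) M A.phi ∧ ST (objSig Γ) A .o

/-- Derivable assertions are simply typed after erasure of dependencies. -/
theorem Derives.simple {Γ J} (h : Derives Γ J) (hΓ : FlatCtx Γ) : J.Simple Γ := by
  induction h with
  | nullCtx => exact ⟨nofun, nofun⟩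
  | kindCtx _ _ _ ih₁ ih₂ =>
    refine ⟨fun u K hu => ?_, fun x A hx => ?_⟩
    · cases hu with
      | here => exact ih₁ hΓ.2 hΓ.1
      | skipFam _ _ h => exact (ih₂ hΓ.2).1 _ _ h
    · cases hx with | skipFam _ _ h => exact (ih₂ hΓ.2).2 _ _ h
  | typeCtx _ _ ih₁ ih₂ =>
    refine ⟨fun u K hu => ?_, fun x A hx => ?_⟩
    · cases hu with | skipObj _ h => exact ((ih₂ hΓ.2).1 _ _ h).rename (HRen.succ _ _)
    · cases hx with
      | here => exact (ih₁ hΓ.2 hΓ.1).1.rename (HRen.succ _ _)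
      | skipObj _ h => exact ((ih₂ hΓ.2).2 _ _ h).rename (HRen.succ _ _)
  | typeKind => exact fun _ => .typ
  | piKind _ _ ih₁ ih₂ => exact fun h => .piK (ih₁ hΓ h.1).1 (ih₂ ⟨h.1, hΓ⟩ h.2)
  | varFam _ h hn ih => exact fun _ => ⟨.tvar _, ((ih hΓ).1 _ _ h).steps hn.1⟩
  | varObj _ h hn ih =>
    have h' := (ih hΓ).2 _ _ h
    exact fun _ => ⟨.var (by rw [hn.phi_eq h'.noRedF]; exact h.objSig), h'.steps hn.1⟩
  | piFam _ _ ih₁ ih₂ => exact fun h => ⟨.pi (ih₁ hΓ h.1).1 (ih₂ ⟨h.1, hΓ⟩ h.2).1, .typ⟩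
  | absFam => exact fun h => h.elim
  | absObj _ _ hn ih₁ ih₂ =>
    intro h
    have h₁ := (ih₁ hΓ h.1).1
    have h₂ := ih₂ ⟨h.1, hΓ⟩ h.2
    have e := hn.phi_eq h₁.noRedF
    exact ⟨by rw [Exp.phi, e]; exact .lam h₁ h₂.1, .pi (h₁.steps hn.1) (by rw [e]; exact h₂.2)⟩
  | appFam _ _ hn ih₁ ih₂ =>
    intro h
    have ⟨h₁, h₂⟩ := ih₁ hΓ h.1
    cases h₂ with | piK _ h₂ =>
    exact ⟨.appF h₁ (ih₂ hΓ h.2).1, (h₂.inst (ih₂ hΓ h.2).1).steps hn.1⟩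
  | @appObj _ M N A B B' _ _ hn ih₁ ih₂ =>
    intro h
    have ⟨h₁, h₂⟩ := ih₁ hΓ h.1
    cases h₂ with | pi _ h₂ =>
    have h₃ := h₂.inst (ih₂ hΓ h.2).1
    have e : B'.phi = B.phi := by rw [hn.phi_eq h₃.noRedF]; exact Exp.phi_subst_fam _ _
    exact ⟨by rw [e]; exact .app h₁ (ih₂ hΓ h.2).1, h₃.steps hn.1⟩

/-! ### Substitution and subject reduction in LF -/

/-- `s` is a substitution from `Γ` to `Γ'` that respects the declarations, up to normalization of
the classifiers.  Normal forms are not required to exist here: where they are needed, they are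
obtained from the simple typing `st`. -/
structure Sub (Γ Γ' : Ctx) (s : ℕ → Obj) : Prop where
  fam : ∀ {u K L}, FamIn Γ u K → NormalFormOf (K.subst s) L →
    ∃ K', FamIn Γ' u K' ∧ NormalFormOf K' L
  obj : ∀ {x A B}, ObjIn Γ x A → NormalFormOf (A.subst s) B → Derives Γ' (.obj (s x) B)
  st : ∀ x a, (objSig Γ)[x]? = some a → ST (objSig Γ') (s x) a

theorem Sub.up {Γ Γ' s} (h : Sub Γ Γ' s) {A : Fam} (hA : Derives (.obj (A.subst s) :: Γ') .ctx) :
    Sub (.obj A :: Γ) (.obj (A.subst s) :: Γ') (upSubst s) where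
  fam hu hL := by
    cases hu with | skipObj _ hu =>
    rw [Exp.shift_subst, Exp.shift] at hL
    obtain ⟨L', hL', rfl⟩ := hL.of_rename
    obtain ⟨K', hK', hn⟩ := h.fam hu hL'
    exact ⟨_, .skipObj _ hK', hn.rename _⟩
  obj hx hB := by
    cases hx with
    | here => rw [Exp.shift_subst] at hB; exact .varObj hA (.here _ _) hB
    | skipObj _ hx =>
      rw [Exp.shift_subst, Exp.shift] at hB
      obtain ⟨B', hB', rfl⟩ := hB.of_rename
      exact (h.obj hx hB').rename (Ren.succ _ _) hA
  st x a hx := by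
    have := ST.up h.st A.phi x a hx
    simpa only [objSig, Exp.phi_subst_fam] using this

/-- The assertion that results from substitution and normalization of the classifier. -/
def Assertion.SubstHolds (Γ' : Ctx) (s : ℕ → Obj) : Assertion → Prop
  | .fam A K => Flat A → ∀ L, NormalFormOf (K.subst s) L → Derives Γ' (.fam (A.subst s) L)
  | .obj M A => Flat M → ∀ B, NormalFormOf (A.subst s) B → Derives Γ' (.obj (M.subst s) B)
  | _ => True

theorem NormalFormOf.inst_subst {c : Cat} {P Q R P' : Exp c} {N : Obj} {s : ℕ → Obj}
    (h : NormalFormOf (P.inst N) Q) (hR : NormalFormOf (Q.subst s) R)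
    (hP' : NormalFormOf (P.subst (upSubst s)) P') : NormalFormOf (P'.inst (N.subst s)) R := by
  have h₁ : NormalFormOf ((P.inst N).subst s) R := hR.head (Steps.subst h.1 s)
  rw [Exp.inst_subst] at h₁
  exact h₁.of_steps (Steps.subst hP'.1 _)

/-- The substitution lemma.  In the application rules, the normal form of the instance of the
classifier of the function part exists by weak normalization of simply typed expressions. -/
theorem Derives.subst {Γ J} (h : Derives Γ J) (hΓ : FlatCtx Γ) {Γ' s} (hs : Sub Γ Γ' s)
    (hΓ' : Derives Γ' .ctx) : J.SubstHolds Γ' s := by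
  have nf_typ : ∀ {s L}, NormalFormOf (Exp.typ.subst s) L → L = .typ :=
    fun h => (h.eq_of_normal .typ).symm
  have typ_nf : ∀ s, NormalFormOf (Exp.typ.subst s) .typ := fun s => .of_normal .typ
  induction h generalizing Γ' s with
  | nullCtx => trivial
  | kindCtx => trivial
  | typeCtx => trivial
  | typeKind => trivial
  | piKind => trivial
  | varFam _ h hn =>
    intro _ L hL
    obtain ⟨K', h₁, h₂⟩ := hs.fam h (hL.head (Steps.subst hn.1 s))
    exact .varFam hΓ' h₁ h₂
  | varObj _ h hn => exact fun _ B hB => hs.obj h (hB.head (Steps.subst hn.1 s))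
  | piFam _ _ ih₁ ih₂ =>
    intro h L hL
    cases nf_typ hL
    have h₁ := ih₁ hΓ hs hΓ' h.1 _ (typ_nf _)
    have hctx := h₁.typeCtx hΓ'
    exact .piFam h₁ (ih₂ ⟨h.1, hΓ⟩ (hs.up hctx) hctx h.2 _ (typ_nf _))
  | absFam => exact fun h => h.elim
  | absObj _ _ hn ih₁ ih₂ =>
    intro h L hL
    obtain ⟨A₁, B₁, rfl, hA, hB⟩ := hL.pi_inv
    have h₁ := ih₁ hΓ hs hΓ' h.1 _ (typ_nf _)
    have hctx := h₁.typeCtx hΓ'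
    exact .absObj h₁ (ih₂ ⟨h.1, hΓ⟩ (hs.up hctx) hctx h.2 _ hB) (hA.head (Steps.subst hn.1 s))
  | appFam d _ hn ih₁ ih₂ =>
    intro h L hL
    obtain ⟨Q, hQ⟩ := (((d.simple hΓ) h.1).2.subst hs.st).wn
    obtain ⟨A₁, B₁, rfl, hA, hB⟩ := hQ.piK_inv
    exact .appFam (ih₁ hΓ hs hΓ' h.1 _ hQ) (ih₂ hΓ hs hΓ' h.2 _ hA) (hn.inst_subst hL hB)
  | appObj d _ hn ih₁ ih₂ =>
    intro h L hL
    obtain ⟨Q, hQ⟩ := (((d.simple hΓ) h.1).2.subst hs.st).wn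
    obtain ⟨A₁, B₁, rfl, hA, hB⟩ := hQ.pi_inv
    exact .appObj (ih₁ hΓ hs hΓ' h.1 _ hQ) (ih₂ hΓ hs hΓ' h.2 _ hA) (hn.inst_subst hL hB)

theorem Exp.shift_subst_inst {c : Cat} (P : Exp c) (N : Obj) :
    P.shift.subst (instObj fun _ : Fin 1 => N) = P := P.shift_inst N

/-- Instantiation of the most recent variable. -/
theorem Sub.inst {Γ A A' N} (hΓ : Derives Γ .ctx) (hN : Derives Γ (.obj N A'))
    (hst : ST (objSig Γ) N A.phi) (hA : NormalFormOf A A') :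
    Sub (.obj A :: Γ) Γ (instObj fun _ : Fin 1 => N) where
  fam hu hL := by
    cases hu with | skipObj _ hu => exact ⟨_, hu, by rwa [Exp.shift_subst_inst] at hL⟩
  obj hx hB := by
    cases hx with
    | here => rw [hA.unique (by rwa [Exp.shift_subst_inst] at hB)] at hN; exact hN
    | skipObj _ hx => exact .varObj hΓ hx (by rwa [Exp.shift_subst_inst] at hB)
  st x a hx := by
    cases x
    · cases hx; exact hst
    · simp only [instObj_succ]; exact .var hx

/-- Replacing the type of the most recent variable by a reduct. -/
theorem Sub.conv {Γ A A'} (hΓ : Derives (.obj A' :: Γ) .ctx) (h : Step A A') (hA : NoRedF A) :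
    Sub (.obj A :: Γ) (.obj A' :: Γ) .var where
  fam hu hL := by
    rw [Exp.subst_var] at hL
    cases hu with | skipObj _ hu => exact ⟨_, .skipObj _ hu, hL⟩
  obj hx hB := by
    rw [Exp.subst_var] at hB
    cases hx with
    | here => exact .varObj hΓ (.here _ _) (hB.of_steps (.single (h.rename _)))
    | skipObj _ hx => exact .varObj hΓ (.skipObj _ hx) hB
  st x a hx := by
    simp only [objSig, ← (h.noRedF hA).2 nofun] at hx
    exact .var hx

/-- Instantiating a family of types at an object of the right type. -/
theorem Derives.inst_typ {Γ A B N} (hΓ : FlatCtx Γ) (hA : Normal A) (hfA : Flat A) (hfB : Flat B)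
    (hfN : Flat N) (h : Derives (.obj A :: Γ) (.fam B .typ)) (hN : Derives Γ (.obj N A)) :
    Derives Γ (.fam (B.inst N) .typ) :=
  h.subst ⟨hfA, hΓ⟩ (.inst hN.ctx hN (hN.simple hΓ hfN).1 (.of_normal hA)) hN.ctx hfB _
    (.of_normal .typ)

/-- Every classifier of `P` in `Γ` is one of `Q`; no condition for kinds. -/
def Inherits : {c : Cat} → Ctx → Exp c → Exp c → Prop
  | .kind, _, _, _ => True
  | .fam, Γ, P, Q => ∀ K, Derives Γ (.fam P K) → Derives Γ (.fam Q K)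
  | .obj, Γ, P, Q => ∀ A, Derives Γ (.obj P A) → Derives Γ (.obj Q A)

/-- Subject reduction. -/
theorem Step.inherits {c : Cat} {P Q : Exp c} (h : Step P Q) :
    ∀ Γ, FlatCtx Γ → Flat P → Inherits Γ P Q := by
  have conv : ∀ {Γ A A'}, FlatCtx Γ → Flat A → Step A A' → Derives Γ (.fam A .typ) →
      Derives Γ (.fam A' .typ) → Derives (.obj A' :: Γ) .ctx ∧
        Sub (.obj A :: Γ) (.obj A' :: Γ) .var := fun hΓ hf hs hA hA' =>
    ⟨.typeCtx hA' hA.ctx, .conv (.typeCtx hA' hA.ctx) hs (hA.simple hΓ hf).1.noRedF⟩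
  induction h with
  | betaF => exact fun Γ _ h => h.1.elim
  | beta A M N =>
    intro Γ hΓ hf B d
    cases d with | appObj d₁ d₂ hn =>
    cases d₁ with | absObj d₃ d₄ hA =>
    have h₃ := (d₃.simple hΓ hf.1.1).1
    have h₂ := (d₂.simple hΓ hf.2).1
    rw [hA.phi_eq h₃.noRedF] at h₂
    exact d₄.subst ⟨hf.1.1, hΓ⟩ (.inst d₃.ctx d₂ h₂ hA) d₃.ctx hf.1.2 _ hn
  | piK₁ => exact fun _ _ _ => trivial
  | piK₂ => exact fun _ _ _ => trivial
  | lamF₁ => exact fun _ _ h => h.elim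
  | lamF₂ => exact fun _ _ h => h.elim
  | pi₁ B hs ih =>
    intro Γ hΓ hf K d
    cases d with | piFam d₁ d₂ =>
    have d₁' := ih Γ hΓ hf.1 _ d₁
    have ⟨hc, hsub⟩ := conv hΓ hf.1 hs d₁ d₁'
    have := d₂.subst ⟨hf.1, hΓ⟩ hsub hc hf.2 _ (.of_normal .typ)
    rw [Exp.subst_var] at this
    exact .piFam d₁' this
  | pi₂ A hs ih =>
    intro Γ hΓ hf K d
    cases d with | piFam d₁ d₂ => exact .piFam d₁ (ih (.obj A :: Γ) ⟨hf.1, hΓ⟩ hf.2 _ d₂)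
  | lam₁ M hs ih =>
    intro Γ hΓ hf B d
    cases d with | absObj d₁ d₂ hn =>
    have d₁' := ih Γ hΓ hf.1 _ d₁
    have ⟨hc, hsub⟩ := conv hΓ hf.1 hs d₁ d₁'
    have := d₂.subst ⟨hf.1, hΓ⟩ hsub hc hf.2 _ (by
      rw [Exp.subst_var]
      exact .of_normal d₂.normal_type)
    rw [Exp.subst_var] at this
    exact .absObj d₁' this (hn.of_steps (.single hs))
  | lam₂ A hs ih =>
    intro Γ hΓ hf K d
    cases d with | absObj d₁ d₂ hn => exact .absObj d₁ (ih (.obj A :: Γ) ⟨hf.1, hΓ⟩ hf.2 _ d₂) hn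
  | appF₁ M hs ih =>
    intro Γ hΓ hf K d
    cases d with | appFam d₁ d₂ hn => exact .appFam (ih _ hΓ hf.1 _ d₁) d₂ hn
  | appF₂ A hs ih =>
    intro Γ hΓ hf K d
    cases d with | appFam d₁ d₂ hn =>
    exact .appFam d₁ (ih _ hΓ hf.2 _ d₂) (hn.of_steps (hs.inst_right _))
  | app₁ M hs ih =>
    intro Γ hΓ hf K d
    cases d with | appObj d₁ d₂ hn => exact .appObj (ih _ hΓ hf.1 _ d₁) d₂ hn
  | app₂ A hs ih =>
    intro Γ hΓ hf K d
    cases d with | appObj d₁ d₂ hn =>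
    exact .appObj d₁ (ih _ hΓ hf.2 _ d₂) (hn.of_steps (hs.inst_right _))

theorem Derives.steps_typ {Γ A A'} (h : Derives Γ (.fam A .typ)) (hΓ : FlatCtx Γ) (hA : Flat A)
    (hs : Steps A A') : Derives Γ (.fam A' .typ) := by
  induction hs with
  | refl => exact h
  | tail hs hs' ih =>
    exact hs'.inherits Γ hΓ (((h.simple hΓ hA).1.steps hs).flat) _ ih

theorem Derives.pi_inv {Γ A B} (h : Derives Γ (.fam (.pi A B) .typ)) :
    Derives Γ (.fam A .typ) ∧ Derives (.obj A :: Γ) (.fam B .typ) := by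
  cases h with | piFam h₁ h₂ => exact ⟨h₁, h₂⟩

/-- The type of a normal object in a normal context is well-formed. -/
theorem Derives.wf_type {Γ M A} (h : Derives Γ (.obj M A)) (hM : Normal M) (hΓ : NormalCtx Γ) :
    Derives Γ (.fam A .typ) := by
  generalize hJ : Assertion.obj M A = J at h
  induction h generalizing M A with
  | varObj h hx hn =>
    cases hJ
    rw [← hn.eq_of_normal (hΓ.objIn hx)]
    exact .of_objIn hx h
  | absObj d₁ d₂ hn _ ih =>
    cases hJ
    rw [← hn.eq_of_normal hM.lam.1]
    exact .piFam d₁ (ih hM.lam.2 ⟨hM.lam.1, hΓ⟩ rfl)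
  | appObj d₁ d₂ hn ih _ =>
    cases hJ
    have hf := hΓ.flatCtx d₁.ctx
    have ⟨h₁, h₂⟩ := (ih hM.app.1 hΓ rfl).pi_inv
    have ⟨n₁, n₂⟩ := d₁.normal_type.pi
    have fA := h₁.flat_type n₁
    have fB := h₂.flat_type n₂
    have fN := d₂.flat_obj hM.app.2.1
    have d := h₂.inst_typ hf n₁ fA fB fN d₂
    have sA := (d₁.simple hf (d₁.flat_obj hM.app.1)).2
    cases sA with | pi _ sB =>
    exact d.steps_typ hf ((sB.inst (d₂.simple hf fN).1).flat) hn.1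
  | _ => cases hJ

/-! ### Long expressions and canonical expressions -/

/-- Induction on objects alone, without motives for the types that annotate abstractions. -/
theorem Obj.induction {motive : Obj → Prop} (var : ∀ x, motive (.var x))
    (lam : ∀ A M, motive M → motive (.lam A M))
    (app : ∀ M N, motive M → motive N → motive (.app M N)) : ∀ M, motive M
  | .var x => var x
  | .lam A M => lam A M (Obj.induction var lam app M)
  | .app M N => app M N (Obj.induction var lam app M) (Obj.induction var lam app N)

/-- Induction on types alone, without motives for the objects that they contain. -/
theorem Fam.induction {motive : Fam → Prop} (tvar : ∀ u, motive (.tvar u))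
    (pi : ∀ A B, motive A → motive B → motive (.pi A B))
    (lamF : ∀ A B, motive A → motive B → motive (.lamF A B))
    (appF : ∀ A M, motive A → motive (.appF A M)) : ∀ A, motive A
  | .tvar u => tvar u
  | .pi A B => pi A B (Fam.induction tvar pi lamF appF A) (Fam.induction tvar pi lamF appF B)
  | .lamF A B => lamF A B (Fam.induction tvar pi lamF appF A) (Fam.induction tvar pi lamF appF B)
  | .appF A M => appF A M (Fam.induction tvar pi lamF appF A)

/-- `Long Θ P k`: when `P` stands at a position where it is applied to `k` arguments, every object
variable in `P` has at least as many arguments as its simple type in `Θ` takes.  In contrast to full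
application, this refers to no derivation, and it is stable under substitution and, in the absence
of type-level redexes, under reduction. -/
def Long : {c : Cat} → List HTy → Exp c → ℕ → Prop
  | _, _, .typ, _ => True
  | _, Θ, .piK A K, _ => Long Θ A 0 ∧ Long (A.phi :: Θ) K 0
  | _, _, .tvar _, _ => True
  | _, Θ, .pi A B, _ => Long Θ A 0 ∧ Long (A.phi :: Θ) B 0
  | _, Θ, .lamF A B, _ => Long Θ A 0 ∧ Long (A.phi :: Θ) B 0
  | _, Θ, .appF A M, k => Long Θ A (k + 1) ∧ Long Θ M 0
  | _, Θ, .var x, k => ∃ a, Θ[x]? = some a ∧ a.arity ≤ k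
  | _, Θ, .lam A M, _ => Long Θ A 0 ∧ Long (A.phi :: Θ) M 0
  | _, Θ, .app M N, k => Long Θ M (k + 1) ∧ Long Θ N 0

namespace Long

theorem mono {c : Cat} {Θ} {P : Exp c} {k l} (h : Long Θ P k) (hkl : k ≤ l) : Long Θ P l := by
  induction P generalizing k l with
  | var => obtain ⟨a, h₁, h₂⟩ := h; exact ⟨a, h₁, h₂.trans hkl⟩
  | app _ _ ih _ => exact ⟨ih h.1 (by omega), h.2⟩
  | appF _ _ ih _ => exact ⟨ih h.1 (by omega), h.2⟩
  | _ => exact h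

theorem rename {c : Cat} {Θ Θ'} {P : Exp c} {k ρ} (h : Long Θ P k) (hρ : HRen Θ Θ' ρ) :
    Long Θ' (P.rename ρ) k := by
  induction P generalizing Θ Θ' ρ k with
  | typ => trivial
  | tvar => trivial
  | var => obtain ⟨a, h₁, h₂⟩ := h; exact ⟨a, hρ _ _ h₁, h₂⟩
  | app _ _ ih₁ ih₂ => exact ⟨ih₁ h.1 hρ, ih₂ h.2 hρ⟩
  | appF _ _ ih₁ ih₂ => exact ⟨ih₁ h.1 hρ, ih₂ h.2 hρ⟩
  | _ => rename_i ih₁ ih₂; exact ⟨ih₁ h.1 hρ, by rw [Exp.phi_rename]; exact ih₂ h.2 (hρ.up _)⟩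

theorem of_rename {c : Cat} {Θ Θ'} {P : Exp c} {k} {ρ : ℕ → ℕ} (h : Long Θ' (P.rename ρ) k)
    (hρ : ∀ x a, Θ'[ρ x]? = some a → Θ[x]? = some a) : Long Θ P k := by
  have up : ∀ {Θ Θ' : List HTy} {ρ : ℕ → ℕ} (b : HTy),
      (∀ x a, Θ'[ρ x]? = some a → Θ[x]? = some a) →
      ∀ x a, (b :: Θ')[upRen ρ x]? = some a → (b :: Θ)[x]? = some a := by
    intro Θ Θ' ρ b hρ x a hx
    cases x
    · exact hx
    · exact hρ _ _ hx
  induction P generalizing Θ Θ' ρ k with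
  | typ => trivial
  | tvar => trivial
  | var => obtain ⟨a, h₁, h₂⟩ := h; exact ⟨a, hρ _ _ h₁, h₂⟩
  | app _ _ ih₁ ih₂ => exact ⟨ih₁ h.1 hρ, ih₂ h.2 hρ⟩
  | appF _ _ ih₁ ih₂ => exact ⟨ih₁ h.1 hρ, ih₂ h.2 hρ⟩
  | _ =>
    rename_i ih₁ ih₂
    have h₂ := h.2
    rw [Exp.phi_rename] at h₂
    exact ⟨ih₁ h.1 hρ, ih₂ h₂ (up _ hρ)⟩

theorem subst {c : Cat} {Θ Θ'} {P : Exp c} {k s} (h : Long Θ P k)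
    (hs : ∀ x a, Θ[x]? = some a → Long Θ' (s x) a.arity) : Long Θ' (P.subst s) k := by
  have up : ∀ {Θ Θ' : List HTy} {s : ℕ → Obj} (b : HTy),
      (∀ x a, Θ[x]? = some a → Long Θ' (s x) a.arity) →
      ∀ x a, (b :: Θ)[x]? = some a → Long (b :: Θ') (upSubst s x) a.arity := by
    intro Θ Θ' s b hs x a hx
    cases x
    · exact ⟨a, hx, le_rfl⟩
    · exact (hs _ _ hx).rename (HRen.succ _ _)
  induction P generalizing Θ Θ' s k with
  | typ => trivial
  | tvar => trivial
  | var => obtain ⟨a, h₁, h₂⟩ := h; exact (hs _ _ h₁).mono h₂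
  | app _ _ ih₁ ih₂ => exact ⟨ih₁ h.1 hs, ih₂ h.2 hs⟩
  | appF _ _ ih₁ ih₂ => exact ⟨ih₁ h.1 hs, ih₂ h.2 hs⟩
  | _ =>
    rename_i ih₁ ih₂
    exact ⟨ih₁ h.1 hs, by rw [Exp.phi_subst_fam]; exact ih₂ h.2 (up _ hs)⟩

theorem inst {c : Cat} {Θ} {P : Exp c} {k b N} (h : Long (b :: Θ) P k) (hN : Long Θ N 0) :
    Long Θ (P.inst N) k := by
  refine h.subst fun x a hx => ?_
  cases x
  · exact hN.mono (Nat.zero_le _)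
  · simp only [instObj_succ]; exact ⟨a, hx, le_rfl⟩

theorem step {c : Cat} {Θ} {P Q : Exp c} {k} (h : Long Θ P k) (hs : Step P Q) (hP : NoRedF P) :
    Long Θ Q k := by
  induction hs generalizing Θ k with
  | betaF => exact (hP.1 _ _ rfl).elim
  | beta => exact (h.1.2.inst h.2).mono (Nat.zero_le _)
  | appF₁ _ _ ih => exact ⟨ih h.1 hP.2.1, h.2⟩
  | appF₂ _ _ ih => exact ⟨h.1, ih h.2 hP.2.2⟩
  | app₁ _ _ ih => exact ⟨ih h.1 hP.1, h.2⟩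
  | app₂ _ _ ih => exact ⟨h.1, ih h.2 hP.2⟩
  | piK₁ _ hs ih | pi₁ _ hs ih | lamF₁ _ hs ih | lam₁ _ hs ih =>
    exact ⟨ih h.1 hP.1, by rw [(hs.noRedF hP.1).2 nofun]; exact h.2⟩
  | piK₂ _ _ ih | pi₂ _ _ ih | lamF₂ _ _ ih | lam₂ _ _ ih => exact ⟨h.1, ih h.2 hP.2⟩

theorem steps {c : Cat} {Θ} {P Q : Exp c} {k} (h : Long Θ P k) (hs : Steps P Q) (hP : NoRedF P) :
    Long Θ Q k := by
  induction hs with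
  | refl => exact h
  | tail hs hs' ih => exact ih.step hs' (Steps.noRedF hs hP).1

theorem inst_normalForm {c : Cat} {Θ} {P Q : Exp c} {k b N} (h : Long (b :: Θ) P k) (nP : Normal P)
    (nN : Normal N) (lN : Long Θ N 0) (hQ : NormalFormOf (P.inst N) Q) : Long Θ Q k :=
  (h.inst lN).steps hQ.1 (nP.noRedF.inst nN.noRedF)

/-- A long normal object encodes to a long normal form. -/
theorem ev {S Θ} {M : Obj} : ∀ {k a}, Long Θ M k → Normal M → HasTy S Θ (enc M) a →
    ((∀ A L, M ≠ .lam A L) → a.arity ≤ k ∧ Ev S true Θ (enc M) (enc M) a) ∧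
    (k = 0 → Ev S false Θ (enc M) (enc M) a) := by
  have base : ∀ {Θ : List HTy} {M : Obj} {k a}, a.arity ≤ k ∧ Ev S true Θ (enc M) (enc M) a →
      k = 0 → Ev S false Θ (enc M) (enc M) a :=
    fun h hk => .base (by omega) .refl h.2
  induction M using Obj.induction generalizing Θ with
  | var x =>
    intro k a h _ ht
    obtain ⟨b, h₁, h₂⟩ := h
    cases ht with | var ht =>
    rw [h₁] at ht
    cases ht
    have := And.intro h₂ (Ev.var (S := S) h₁)
    exact ⟨fun _ => this, base (M := .var x) this⟩
  | lam A M ih =>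
    intro k a h hn ht
    refine ⟨fun h => (h _ _ rfl).elim, fun _ => ?_⟩
    cases ht with | lam ht =>
    refine .arr (.expand (.beta _ _ _) ?_)
    rw [Tm.rename_up_succ_inst]
    exact (ih h.2 hn.lam.2 ht).2 rfl
  | app M N ih₁ ih₂ =>
    intro k a h hn ht
    cases ht with | app ht₁ ht₂ =>
    have ⟨h₁, h₂⟩ := (ih₁ h.1 hn.app.1 ht₁).1 hn.app.2.2
    have h₃ := (ih₂ h.2 hn.app.2.1 ht₂).2 rfl
    have : _ ≤ k ∧ _ := And.intro (Nat.le_of_succ_le_succ h₁) (Ev.app h₂ h₃)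
    exact ⟨fun _ => this, base (M := .app M N) this⟩

theorem ev_enc {S Θ} {M : Obj} {a} (h : Long Θ M 0) (hM : Normal M) (ht : HasTy S Θ (enc M) a) :
    Ev S false Θ (enc M) (enc M) a := (h.ev hM ht).2 rfl

end Long

theorem FullyApplied.long {c : Cat} {Γ} {P : Exp c} {k} (h : FullyApplied Γ P k) (hP : NoRedF P)
    (hΓ : ∀ x A, ObjIn Γ x A → NoRedF A) : Long (objSig Γ) P k := by
  have up : ∀ {Γ : Ctx} {A : Fam}, (∀ x A, ObjIn Γ x A → NoRedF A) → NoRedF A →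
      ∀ x B, ObjIn (.obj A :: Γ) x B → NoRedF B := by
    intro Γ A hΓ hA x B hx
    cases hx with
    | here => exact hA.rename _
    | skipObj _ hx => exact (hΓ _ _ hx).rename _
  induction P generalizing Γ k with
  | typ => trivial
  | tvar => trivial
  | var x =>
    obtain ⟨A, A', hA, hn, rfl⟩ := h
    refine ⟨_, hA.objSig, ?_⟩
    rw [← hn.phi_eq (hΓ _ _ hA), Exp.phi_arity]
  | app _ _ ih₁ ih₂ => exact ⟨ih₁ h.1 hP.1 hΓ, ih₂ h.2 hP.2 hΓ⟩
  | appF _ _ ih₁ ih₂ => exact ⟨ih₁ h.1 hP.2.1 hΓ, ih₂ h.2 hP.2.2 hΓ⟩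
  | _ => rename_i ih₁ ih₂; exact ⟨ih₁ h.1 hP.1 hΓ, ih₂ (Γ := .obj _ :: Γ) h.2 hP.2 (up hΓ hP.1)⟩

theorem CanonicalCtx.normalCtx : ∀ {Γ : Ctx}, CanonicalCtx Γ → NormalCtx Γ
  | [], _ => trivial
  | .fam _ _ :: _, h => ⟨h.1.1, h.2.normalCtx⟩
  | .obj _ :: _, h => ⟨h.1.1, h.2.normalCtx⟩

theorem Canonical.long {c : Cat} {Γ} {P : Exp c} (h : Canonical Γ P) (hΓ : NormalCtx Γ) :
    Long (objSig Γ) P 0 :=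
  h.2.long h.1.noRedF fun _ _ hx => (hΓ.objIn hx).noRedF

theorem CanonicalCtx.long_objIn {Γ x A} (h : CanonicalCtx Γ) (hx : ObjIn Γ x A) :
    Long (objSig Γ) A 0 := by
  induction hx with
  | here => exact (h.1.long h.2.normalCtx).rename (HRen.succ _ _)
  | skipFam _ _ _ ih => exact ih h.2
  | skipObj _ _ ih => exact (ih h.2).rename (HRen.succ _ _)

/-- Full application of the subject of an assertion, which stands at a position where it has as many
arguments as its classifier takes. -/
def Assertion.Full (Γ : Ctx) : Assertion → Prop
  | .fam A K => Normal A → ∀ k, Long (objSig Γ) A k → (∀ B C, A ≠ .lamF B C) →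
      FullyApplied Γ A K.piCount
  | .obj M A => Normal M → ∀ k, Long (objSig Γ) M k → k ≤ A.piCount → FullyApplied Γ M k
  | _ => True

theorem Exp.piCount_inst {c : Cat} {P Q : Exp c} {N : Obj} (h : NormalFormOf (P.inst N) Q)
    (hc : c ≠ .obj) (hP : Normal P) (hN : Normal N) : Q.piCount = P.piCount := by
  rw [← Exp.phi_arity, (Steps.noRedF h.1 (hP.noRedF.inst hN.noRedF)).2 hc, Exp.inst,
    Exp.phi_subst _ hc, Exp.phi_arity]

/-- Typing bounds the number of arguments from above, so that long expressions which are well typed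
are fully applied. -/
theorem Derives.full {Γ J} (h : Derives Γ J) (hΓ : NormalCtx Γ) : J.Full Γ := by
  induction h with
  | varFam _ h hn => exact fun _ _ _ _ => ⟨_, _, h, hn, rfl⟩
  | @varObj _ x _ _ _ h hn =>
    intro _ k hk hle
    refine ⟨_, _, h, hn, le_antisymm ?_ hle⟩
    obtain ⟨a, h₁, h₂⟩ := hk
    rw [h.objSig] at h₁
    cases h₁
    rwa [← hn.phi_eq (hΓ.objIn h).noRedF, Exp.phi_arity] at h₂
  | piFam d₁ d₂ ih₁ ih₂ =>
    exact fun hn _ hl _ => ⟨ih₁ hΓ hn.pi.1 _ hl.1 d₁.not_lamF,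
      ih₂ ⟨hn.pi.1, hΓ⟩ hn.pi.2 _ hl.2 d₂.not_lamF⟩
  | absFam => exact fun _ _ _ h => (h _ _ rfl).elim
  | absObj d₁ d₂ _ ih₁ ih₂ =>
    exact fun hn k hl _ => ⟨ih₁ hΓ hn.lam.1 _ hl.1 d₁.not_lamF,
      ih₂ ⟨hn.lam.1, hΓ⟩ hn.lam.2 0 hl.2 (Nat.zero_le _)⟩
  | appFam d₁ d₂ hK ih₁ ih₂ =>
    intro hn k hl _
    refine ⟨?_, ih₂ hΓ hn.appF.2.1 0 hl.2 (Nat.zero_le _)⟩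
    rw [Exp.piCount_inst hK nofun d₁.normal_kind.piK.2 hn.appF.2.1]
    exact ih₁ hΓ hn.appF.1 _ hl.1 hn.appF.2.2
  | appObj d₁ d₂ hB ih₁ ih₂ =>
    intro hn k hl hk
    refine ⟨ih₁ hΓ hn.app.1 _ hl.1 ?_, ih₂ hΓ hn.app.2.1 0 hl.2 (Nat.zero_le _)⟩
    rw [Exp.piCount_inst hB nofun d₁.normal_type.pi.2 hn.app.2.1] at hk
    exact Nat.succ_le_succ hk
  | _ => trivial

theorem Derives.canonical {Γ M A} (h : Derives Γ (.obj M A)) (hΓ : NormalCtx Γ) (hM : Normal M)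
    (hl : Long (objSig Γ) M 0) : Canonical Γ M :=
  ⟨hM, h.full hΓ hM 0 hl (Nat.zero_le _)⟩

/-! ### The relation `∼` -/

namespace Sim

theorem phi_eq {S} {c : Cat} {Θ σ} {P Q : Exp c} (h : Sim S Θ σ P Q) (hc : c ≠ .obj) :
    P.phi = Q.phi := by
  induction h with
  | obj => exact (hc rfl).elim
  | piK _ _ ih₁ ih₂ => simp [Exp.phi, ih₁ nofun, ih₂ nofun]
  | pi _ _ ih₁ ih₂ => simp [Exp.phi, ih₁ nofun, ih₂ nofun]
  | _ => rfl

theorem obj_inv {S Θ σ} {M N : Obj} (h : Sim S Θ σ M N) :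
    ∃ a, TmEq S Θ (enc M) ((enc N).subst σ) a := by
  cases h with | obj h => exact ⟨_, h⟩

theorem rename_left {S S'} {c : Cat} {Θ Θ' σ ρ} {P Q : Exp c} (h : Sim S Θ σ P Q) (hS : S ⊆ S')
    (hρ : HRen Θ Θ' ρ) : Sim S' Θ' (fun x => (σ x).rename ρ) (P.rename ρ) Q := by
  induction h generalizing Θ' ρ with
  | obj h =>
    have := h.rename hS hρ
    rw [← enc_rename, Tm.rename_subst] at this
    exact .obj this
  | typ => exact .typ
  | tvar u => exact .tvar u
  | appF _ _ ih₁ ih₂ => exact .appF (ih₁ hρ) (ih₂ hρ)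
  | piK _ _ ih₁ ih₂ =>
    exact .piK (ih₁ hρ) (by rw [Exp.phi_rename, ← upTm_rename]; exact ih₂ (hρ.up _))
  | pi _ _ ih₁ ih₂ =>
    exact .pi (ih₁ hρ) (by rw [Exp.phi_rename, ← upTm_rename]; exact ih₂ (hρ.up _))
  | lamF _ _ ih₁ ih₂ =>
    exact .lamF (ih₁ hρ) (by rw [Exp.phi_rename, ← upTm_rename]; exact ih₂ (hρ.up _))

/-- Replacing variables on the left by objects and on the right by terms equal to their
encodings. -/
theorem subst_left {S} {c : Cat} {Θ Θ' σ s τ} {P Q : Exp c} (h : Sim S Θ σ P Q)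
    (hs : ∀ x a, Θ[x]? = some a → TmEq S Θ' (enc (s x)) (τ x) a) :
    Sim S Θ' (fun x => (σ x).subst τ) (P.subst s) Q := by
  have up : ∀ {Θ Θ' : List HTy} {s : ℕ → Obj} {τ : ℕ → Tm} (b : HTy),
      (∀ x a, Θ[x]? = some a → TmEq S Θ' (enc (s x)) (τ x) a) →
      ∀ x a, (b :: Θ)[x]? = some a → TmEq S (b :: Θ') (enc (upSubst s x)) (upTm τ x) a := by
    intro Θ Θ' s τ b hs x a hx
    rw [show enc (upSubst s x) = _ from congrFun (upTm_enc s) x]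
    exact TmEq.upTm hs b x a hx
  induction h generalizing Θ' s τ with
  | obj h =>
    have := h.subst_eq hs
    rw [← enc_subst, Tm.subst_subst] at this
    exact .obj this
  | typ => exact .typ
  | tvar u => exact .tvar u
  | appF _ _ ih₁ ih₂ => exact .appF (ih₁ hs) (ih₂ hs)
  | piK _ _ ih₁ ih₂ =>
    exact .piK (ih₁ hs) (by rw [Exp.phi_subst_fam, ← upTm_subst]; exact ih₂ (up _ hs))
  | pi _ _ ih₁ ih₂ =>
    exact .pi (ih₁ hs) (by rw [Exp.phi_subst_fam, ← upTm_subst]; exact ih₂ (up _ hs))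
  | lamF _ _ ih₁ ih₂ =>
    exact .lamF (ih₁ hs) (by rw [Exp.phi_subst_fam, ← upTm_subst]; exact ih₂ (up _ hs))

theorem subst_right {S} {c : Cat} {Θ σ s} {P Q : Exp c}
    (h : Sim S Θ (fun x => (enc (s x)).subst σ) P Q) : Sim S Θ σ P (Q.subst s) := by
  generalize hτ : (fun x => (enc (s x)).subst σ) = τ at h
  have up : ∀ (s : ℕ → Obj) (σ : ℕ → Tm),
      (fun x => (enc (upSubst s x)).subst (upTm σ)) = upTm fun x => (enc (s x)).subst σ := by
    intro s σ
    rw [← upTm_subst, ← upTm_enc]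
  induction h generalizing s σ with
  | obj h => subst hτ; rw [← Tm.subst_subst, ← enc_subst] at h; exact .obj h
  | typ => exact .typ
  | tvar u => exact .tvar u
  | appF _ _ ih₁ ih₂ => exact .appF (ih₁ hτ) (ih₂ hτ)
  | piK _ _ ih₁ ih₂ => exact .piK (ih₁ hτ) (ih₂ (by rw [up, hτ]))
  | pi _ _ ih₁ ih₂ => exact .pi (ih₁ hτ) (ih₂ (by rw [up, hτ]))
  | lamF _ _ ih₁ ih₂ => exact .lamF (ih₁ hτ) (ih₂ (by rw [up, hτ]))

theorem rename_right {S} {c : Cat} {Θ σ} {ρ : ℕ → ℕ} {P Q : Exp c}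
    (h : Sim S Θ (fun x => σ (ρ x)) P Q) : Sim S Θ σ P (Q.rename ρ) := by
  rw [Exp.rename_eq_subst]
  exact subst_right h

theorem shift {S} {c : Cat} {Θ σ} {P Q : Exp c} (h : Sim S Θ σ P Q) (a : HTy) :
    Sim S (a :: Θ) (upTm σ) P.shift Q.shift :=
  rename_right (h.rename_left (List.Subset.refl _) (HRen.succ Θ a))

end Sim

/-- Reduction steps become equalities of encodings.  A step in an annotation leaves the encoding
unchanged, since it preserves `φ`. -/
theorem Step.tmEq {S} {c : Cat} {Θ σ} {P Q : Exp c} {a} (hs : Step P Q) (hc : c = .obj)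
    (hP : NoRedF P) (h : HasTy S Θ ((enc P).subst σ) a) :
    TmEq S Θ ((enc P).subst σ) ((enc Q).subst σ) a := by
  induction hs generalizing Θ σ a with
  | beta A M N =>
    cases h with | app h₁ h₂ =>
    cases h₁ with | lam h₁ =>
    have := TmEq.beta h₁ h₂
    rw [← Tm.inst_subst] at this
    rwa [enc_inst]
  | app₁ _ _ ih => cases h with | app h₁ h₂ => exact .app (ih rfl hP.1 h₁) (.refl h₂)
  | app₂ _ _ ih => cases h with | app h₁ h₂ => exact .app (.refl h₁) (ih rfl hP.2 h₂)
  | lam₁ M hs _ =>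
    have e : Exp.phi _ = Exp.phi _ := (hs.noRedF hP.1).2 nofun
    simp only [enc, e] at h ⊢
    exact .refl h
  | lam₂ A _ ih => cases h with | lam h => exact .lam (ih rfl hP.2 h)
  | _ => cases hc

namespace Sim

theorem step_left {S} {c : Cat} {Θ σ} {P P' Q : Exp c} (h : Sim S Θ σ P Q) (hs : Step P P')
    (hP : NoRedF P) : Sim S Θ σ P' Q := by
  induction h with
  | obj h =>
    have := h.hasTy.1
    rw [← Tm.subst_var (enc _)] at this
    have := hs.tmEq rfl hP this
    rw [Tm.subst_var, Tm.subst_var] at this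
    exact .obj (this.symm.trans h)
  | typ => cases hs
  | tvar => cases hs
  | appF h₁ h₂ ih₁ ih₂ =>
    cases hs with
    | betaF => exact (hP.1 _ _ rfl).elim
    | appF₁ _ hs => exact .appF (ih₁ hs hP.2.1) h₂
    | appF₂ _ hs => exact .appF h₁ (ih₂ hs hP.2.2)
  | piK h₁ h₂ ih₁ ih₂ =>
    cases hs with
    | piK₁ _ hs => exact .piK (ih₁ hs hP.1) (by rwa [(hs.noRedF hP.1).2 nofun])
    | piK₂ _ hs => exact .piK h₁ (ih₂ hs hP.2)
  | pi h₁ h₂ ih₁ ih₂ =>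
    cases hs with
    | pi₁ _ hs => exact .pi (ih₁ hs hP.1) (by rwa [(hs.noRedF hP.1).2 nofun])
    | pi₂ _ hs => exact .pi h₁ (ih₂ hs hP.2)
  | lamF h₁ h₂ ih₁ ih₂ =>
    cases hs with
    | lamF₁ _ hs => exact .lamF (ih₁ hs hP.1) (by rwa [(hs.noRedF hP.1).2 nofun])
    | lamF₂ _ hs => exact .lamF h₁ (ih₂ hs hP.2)

theorem step_right {S} {c : Cat} {Θ σ} {P Q Q' : Exp c} (h : Sim S Θ σ P Q) (hs : Step Q Q')
    (hQ : NoRedF Q) : Sim S Θ σ P Q' := by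
  induction h with
  | obj h => exact .obj (h.trans (hs.tmEq rfl hQ h.hasTy.2))
  | typ => cases hs
  | tvar => cases hs
  | appF h₁ h₂ ih₁ ih₂ =>
    cases hs with
    | betaF => exact (hQ.1 _ _ rfl).elim
    | appF₁ _ hs => exact .appF (ih₁ hs hQ.2.1) h₂
    | appF₂ _ hs => exact .appF h₁ (ih₂ hs hQ.2.2)
  | piK h₁ h₂ ih₁ ih₂ =>
    cases hs with
    | piK₁ _ hs => exact .piK (ih₁ hs hQ.1) h₂
    | piK₂ _ hs => exact .piK h₁ (ih₂ hs hQ.2)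
  | pi h₁ h₂ ih₁ ih₂ =>
    cases hs with
    | pi₁ _ hs => exact .pi (ih₁ hs hQ.1) h₂
    | pi₂ _ hs => exact .pi h₁ (ih₂ hs hQ.2)
  | lamF h₁ h₂ ih₁ ih₂ =>
    cases hs with
    | lamF₁ _ hs => exact .lamF (ih₁ hs hQ.1) h₂
    | lamF₂ _ hs => exact .lamF h₁ (ih₂ hs hQ.2)

theorem steps {S} {c : Cat} {Θ σ} {P P' Q Q' : Exp c} (h : Sim S Θ σ P Q) (hP : Steps P P')
    (hQ : Steps Q Q') (nP : NoRedF P) (nQ : NoRedF Q) : Sim S Θ σ P' Q' := by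
  induction hP with
  | refl =>
    induction hQ with
    | refl => exact h
    | tail hs hs' ih => exact ih.step_right hs' (Steps.noRedF hs nQ).1
  | tail hs hs' ih => exact ih.step_left hs' (Steps.noRedF hs nP).1

/-- Normal forms of corresponding instances of related expressions are related. -/
theorem inst {S} {c : Cat} {Θ σ} {P Q P' Q' : Exp c} {a} {M N : Obj}
    (h : Sim S (a :: Θ) (upTm σ) P Q) (hMN : TmEq S Θ (enc M) ((enc N).subst σ) a)
    (hP : NormalFormOf (P.inst M) P') (hQ : NormalFormOf (Q.inst N) Q') (nP : NoRedF P)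
    (nQ : NoRedF Q) (nM : NoRedF M) (nN : NoRedF N) : Sim S Θ σ P' Q' := by
  refine steps ?_ hP.1 hQ.1 (nP.inst nM) (nQ.inst nN)
  have hl := h.subst_left (s := instObj fun _ : Fin 1 => M) (Θ' := Θ)
    (τ := instTm fun _ : Fin 1 => (enc N).subst σ) fun x b hx => by
      cases x
      · cases hx; exact hMN
      · simp only [instObj_succ, instTm_succ]; exact .refl (.var hx)
  refine subst_right (s := instObj fun _ : Fin 1 => N) ?_
  convert hl using 1
  swap
  · rfl
  funext x; cases x
  · simp [upTm, Tm.subst]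
  · simp only [instObj_succ, upTm]; exact (Tm.shift_inst _ _).symm

theorem refl_of_st {S} {c : Cat} {Θ} {P : Exp c} {a} (h : ST Θ P a) : Sim S Θ Tm.var P P := by
  have ob : ∀ {Θ} {M : Obj} {a}, ST Θ M a → Sim S Θ Tm.var M M := fun h =>
    .obj (a := _) (by rw [Tm.subst_var]; exact .refl (h.hasTy S))
  induction h with
  | typ => exact .typ
  | tvar u => exact .tvar u
  | piK _ _ ih₁ ih₂ => exact .piK ih₁ (by rwa [upTm_var])
  | pi _ _ ih₁ ih₂ => exact .pi ih₁ (by rwa [upTm_var])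
  | appF _ _ ih₁ ih₂ => exact .appF ih₁ ih₂
  | var h => exact ob (.var h)
  | lam h₁ h₂ => exact ob (.lam h₁ h₂)
  | app h₁ h₂ => exact ob (.app h₁ h₂)

end Sim

/-! ### Injectivity of the encoding and strengthening -/

/-- Canonical objects with the same encoding and the same type are equal; for objects that are not
abstractions the types need not be assumed equal. -/
theorem Derives.eq_of_enc {M : Obj} : ∀ {Γ : Ctx} {N : Obj} {A A' : Fam}, Normal M → Normal N →
    Derives Γ (.obj M A) → Derives Γ (.obj N A') → enc M = enc N →
    ((∀ B L, M ≠ .lam B L) ∨ A = A') → M = N ∧ A = A' := by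
  induction M using Obj.induction with
  | var x =>
    intro Γ N A A' _ _ h h' e _
    cases N <;> simp only [enc, Tm.var.injEq, reduceCtorEq] at e
    subst e
    cases h with | varObj _ h hn =>
    cases h' with | varObj _ h' hn' =>
    cases h.functional h'
    exact ⟨rfl, hn.unique hn'⟩
  | lam A₁ M ih =>
    intro Γ N A A' nM nN h h' e hA
    have hA := hA.resolve_left fun h => h _ _ rfl
    cases N <;> simp only [enc, Tm.lam.injEq, reduceCtorEq] at e
    cases h with | absObj _ h hn =>
    cases h' with | absObj _ h' hn' =>
    cases hn.eq_of_normal nM.lam.1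
    cases hn'.eq_of_normal nN.lam.1
    cases hA
    exact ⟨by rw [(ih nM.lam.2 nN.lam.2 h h' e.2 (.inr rfl)).1], rfl⟩
  | app M₁ M₂ ih₁ ih₂ =>
    intro Γ N A A' nM nN h h' e _
    cases N <;> simp only [enc, Tm.app.injEq, reduceCtorEq] at e
    cases h with | appObj h₁ h₂ hn =>
    cases h' with | appObj h₁' h₂' hn' =>
    obtain ⟨e₁, e₂⟩ := ih₁ nM.app.1 nN.app.1 h₁ h₁' e.1 (.inl nM.app.2.2)
    cases e₁
    cases e₂
    obtain ⟨e₁, -⟩ := ih₂ nM.app.2.1 nN.app.2.1 h₂ h₂' e.2 (.inr rfl)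
    cases e₁
    exact ⟨rfl, hn.unique hn'⟩

/-- Canonical types that are related by `∼` to the same type are equal. -/
theorem Derives.eq_of_sim {A : Fam} : ∀ {Γ : Ctx} {A' X : Fam} {K K' : Kind} {σ : ℕ → Tm} {k l},
    NormalCtx Γ → Normal A → Normal A' → Long (objSig Γ) A k → Long (objSig Γ) A' l →
    (∀ B C, A ≠ .lamF B C) → (∀ B C, A' ≠ .lamF B C) →
    Derives Γ (.fam A K) → Derives Γ (.fam A' K') → Sim (famSig Γ) (objSig Γ) σ A X →
    Sim (famSig Γ) (objSig Γ) σ A' X → A = A' ∧ K = K' := by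
  induction A using Fam.induction with
  | tvar u =>
    intro Γ A' X K K' σ k l _ _ _ _ _ _ _ h h' hs hs'
    cases hs
    cases hs'
    cases h with | varFam hΓ h hn =>
    cases h' with | varFam _ h' hn' =>
    cases hΓ.famIn_functional h h'
    exact ⟨rfl, hn.unique hn'⟩
  | pi A B ih₁ ih₂ =>
    intro Γ A' X K K' σ k l hΓ nA nA' lA lA' _ _ h h' hs hs'
    cases hs with | pi s₁ s₂ =>
    cases hs' with | pi s₁' s₂' =>
    cases h with | piFam h₁ h₂ =>
    cases h' with | piFam h₁' h₂' =>
    cases (ih₁ hΓ nA.pi.1 nA'.pi.1 lA.1 lA'.1 h₁.not_lamF h₁'.not_lamF h₁ h₁' s₁ s₁').1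
    rw [(ih₂ (Γ := .obj A :: Γ) ⟨nA.pi.1, hΓ⟩ nA.pi.2 nA'.pi.2 lA.2 lA'.2 h₂.not_lamF
      h₂'.not_lamF h₂ h₂' s₂ s₂').1]
    exact ⟨rfl, rfl⟩
  | lamF A B ih₁ ih₂ => intro _ _ _ _ _ _ _ _ _ _ _ _ _ h; exact (h _ _ rfl).elim
  | appF A M ih =>
    intro Γ A' X K K' σ k l hΓ nA nA' lA lA' _ _ h h' hs hs'
    cases hs with | appF s₁ s₂ =>
    cases hs' with | appF s₁' s₂' =>
    cases h with | appFam h₁ h₂ hn =>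
    cases h' with | appFam h₁' h₂' hn' =>
    obtain ⟨e₁, e₂⟩ := ih hΓ nA.appF.1 nA'.appF.1 lA.1 lA'.1 nA.appF.2.2 nA'.appF.2.2 h₁ h₁' s₁ s₁'
    cases e₁
    cases e₂
    obtain ⟨a, t⟩ := s₂.obj_inv
    obtain ⟨a', t'⟩ := s₂'.obj_inv
    have hS := h₁.ctx.sigFun
    have hf := hΓ.flatCtx h₁.ctx
    have T := ((h₂.simple hf (h₂.flat_obj nA.appF.2.1)).1).hasTy (famSig Γ)
    have T' := ((h₂'.simple hf (h₂'.flat_obj nA'.appF.2.1)).1).hasTy (famSig Γ)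
    cases t.hasTy.1.unique hS T
    cases t'.hasTy.1.unique hS T'
    have e := (t.trans t'.symm).ev_eq hS (lA.2.ev_enc nA.appF.2.1 T) (lA'.2.ev_enc nA'.appF.2.1 T')
    cases (h₂.eq_of_enc nA.appF.2.1 nA'.appF.2.1 h₂' e (.inr rfl)).1
    exact ⟨rfl, hn.unique hn'⟩

/-- `ρ` is an injective renaming from `Γ` to `Γ'` that respects the declarations and that maps no
index undeclared in `Γ` to one declared in `Γ'`. -/
structure Emb (Γ Γ' : Ctx) (ρ : ℕ → ℕ) : Prop extends Ren Γ Γ' ρ where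
  refl : ∀ {x A}, ObjIn Γ' (ρ x) A → ∃ B, ObjIn Γ x B
  inj : Function.Injective ρ

theorem Emb.up {Γ Γ' ρ} (h : Emb Γ Γ' ρ) (A : Fam) :
    Emb (.obj A :: Γ) (.obj (A.rename ρ) :: Γ') (upRen ρ) where
  toRen := h.toRen.up A
  refl {x B} hx := by
    cases x with
    | zero => exact ⟨_, .here _ _⟩
    | succ x =>
      cases hx with | skipObj _ hx =>
      obtain ⟨B, hB⟩ := h.refl hx
      exact ⟨_, .skipObj _ hB⟩
  inj := upRen_injective h.inj

theorem Emb.succ {Γ Γ' ρ} (h : Emb Γ Γ' ρ) (A : Fam) :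
    Emb Γ (.obj A :: Γ') fun x => ρ x + 1 where
  toRen := h.toRen.comp (Ren.succ _ _)
  refl hx := by cases hx with | skipObj _ hx => exact h.refl hx
  inj := fun _ _ e => h.inj (Nat.succ.inj e)

/-- Mapping a new variable to a variable outside the range. -/
theorem Emb.cons {Γ Γ' ρ} (h : Emb Γ Γ' ρ) {y : ℕ} {A : Fam} (hy : ObjIn Γ' y (A.rename ρ))
    (hy' : ∀ x, ρ x ≠ y) : Emb (.obj A :: Γ) Γ' (cons y ρ) where
  fam hK := by
    cases hK with | skipObj _ hK =>
    rw [Exp.shift, Exp.rename_rename]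
    exact h.fam hK
  obj hA := by
    cases hA with
    | here => rw [Exp.shift, Exp.rename_rename]; exact hy
    | skipObj _ hA => rw [Exp.shift, Exp.rename_rename]; exact h.obj hA
  refl {x B} hx := by
    cases x with
    | zero => exact ⟨_, .here _ _⟩
    | succ x =>
      obtain ⟨B, hB⟩ := h.refl (x := x) hx
      exact ⟨_, .skipObj _ hB⟩
  inj := by
    intro x x' e
    cases x <;> cases x'
    · rfl
    · exact (hy' _ e.symm).elim
    · exact (hy' _ e).elim
    · exact congrArg _ (h.inj e)

/-- Strengthening: a canonical object over `Γ'` whose encoding lives in `Γ` comes from an object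
over `Γ`, provided that its type does in case it is an abstraction.  The types that annotate
abstractions, which the encoding forgets, are recovered from the type. -/
theorem Derives.strengthen {M' : Obj} : ∀ {Γ Γ' : Ctx} {ρ : ℕ → ℕ} {s : Tm} {A' : Fam},
    Emb Γ Γ' ρ → NormalCtx Γ → Derives Γ .ctx → Normal M' → Derives Γ' (.obj M' A') →
    enc M' = s.rename ρ →
    ((∀ B L, M' ≠ .lam B L) ∨ ∃ A, Derives Γ (.fam A .typ) ∧ Normal A ∧ A' = A.rename ρ) →
    ∃ M A, M' = M.rename ρ ∧ A' = A.rename ρ ∧ Derives Γ (.obj M A) := by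
  induction M' using Obj.induction with
  | var y =>
    intro Γ Γ' ρ s A' hρ hΓ hc _ h e _
    cases s <;> simp only [enc, Tm.rename, Tm.var.injEq, reduceCtorEq] at e
    subst e
    cases h with | varObj _ h hn =>
    obtain ⟨B, hB⟩ := hρ.refl h
    cases h.functional (hρ.obj hB)
    obtain ⟨B', hB', rfl⟩ := hn.of_rename
    exact ⟨_, _, rfl, rfl, .varObj hc hB hB'⟩
  | lam A₁ M ih =>
    intro Γ Γ' ρ s A' hρ hΓ hc nM h e hA
    obtain ⟨A, dA, nA, rfl⟩ := hA.resolve_left fun h => h _ _ rfl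
    cases s <;> simp only [enc, Tm.rename, Tm.lam.injEq, reduceCtorEq] at e
    generalize hT : A.rename ρ = T at h
    cases h with | absObj _ h hn =>
    cases hn.eq_of_normal nM.lam.1
    cases A <;> simp only [Exp.rename, Exp.pi.injEq, reduceCtorEq] at hT
    obtain ⟨rfl, rfl⟩ := hT
    obtain ⟨dA₁, dA₂⟩ := dA.pi_inv
    obtain ⟨M, B, rfl, eB, d⟩ := ih (hρ.up _) ⟨nA.pi.1, hΓ⟩ (dA₁.typeCtx hc) nM.lam.2 h e.2
      (.inr ⟨_, dA₂, nA.pi.2, rfl⟩)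
    cases Exp.rename_injective _ _ (upRen_injective hρ.inj) eB
    exact ⟨.lam _ M, _, rfl, rfl, .absObj dA₁ d (.of_normal nA.pi.1)⟩
  | app M₁ M₂ ih₁ ih₂ =>
    intro Γ Γ' ρ s A' hρ hΓ hc nM h e _
    cases s <;> simp only [enc, Tm.rename, Tm.app.injEq, reduceCtorEq] at e
    cases h with | appObj h₁ h₂ hn =>
    obtain ⟨M, A, rfl, eA, d⟩ := ih₁ hρ hΓ hc nM.app.1 h₁ e.1 (.inl nM.app.2.2)
    cases A <;> simp only [Exp.rename, Exp.pi.injEq, reduceCtorEq] at eA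
    obtain ⟨rfl, rfl⟩ := eA
    obtain ⟨dA, _⟩ := (d.wf_type nM.app.1.of_rename hΓ).pi_inv
    obtain ⟨N, A, rfl, eA, d'⟩ := ih₂ hρ hΓ hc nM.app.2.1 h₂ e.2
      (.inr ⟨_, dA, d.normal_type.pi.1, rfl⟩)
    cases Exp.rename_injective _ _ hρ.inj eA
    rw [← Exp.inst_rename] at hn
    obtain ⟨B, hB, rfl⟩ := hn.of_rename
    exact ⟨.app M N, B, rfl, rfl, .appObj d d' hB⟩

/-! ### Recovering an instance from a rigid occurrence -/

theorem Emb.of_objSig {Γ Γ' ρ} (h : Emb Γ Γ' ρ) (x : ℕ) (a : HTy)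
    (hx : (objSig Γ')[ρ x]? = some a) : (objSig Γ)[x]? = some a := by
  obtain ⟨A, hA, rfl⟩ := exists_objIn hx
  obtain ⟨B, hB⟩ := h.refl hA
  rw [hA.functional (h.obj hB), Exp.phi_rename]
  exact hB.objSig

theorem apps_concat (H : Obj) (Ms : List Obj) (M : Obj) :
    apps H (Ms ++ [M]) = .app (apps H Ms) M := by
  simp [apps]

theorem appsF_concat (A : Fam) (Ms : List Obj) (M : Obj) :
    appsF A (Ms ++ [M]) = .appF (appsF A Ms) M := by
  simp [appsF]

theorem apps_var_ne_lam (y : ℕ) (Ms : List Obj) : ∀ A L, apps (.var y) Ms ≠ .lam A L := by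
  induction Ms using List.reverseRecOn with
  | nil => exact nofun
  | append_singleton Ms M _ => rw [apps_concat]; exact nofun

/-- `Spine Γ X Ns A`: over `Γ`, applying an object of type `X` to the objects `Ns` gives an object
of type `A`. -/
inductive Spine (Γ : Ctx) : Fam → List Obj → Fam → Prop where
  | nil (X) : Spine Γ X [] X
  | cons {X₁ X₂ X N Ns A} : Derives Γ (.obj N X₁) → NormalFormOf (X₂.inst N) X → Spine Γ X Ns A →
      Spine Γ (.pi X₁ X₂) (N :: Ns) A

theorem Derives.spine {Γ} : ∀ {Ns : List Obj} {H A}, Derives Γ (.obj (apps H Ns) A) →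
    ∃ X, Derives Γ (.obj H X) ∧ Spine Γ X Ns A
  | [], _, _, h => ⟨_, h, .nil _⟩
  | N :: Ns, H, _, h => by
    obtain ⟨X, h, hs⟩ := Derives.spine (Ns := Ns) (H := .app H N) h
    cases h with | appObj h₁ h₂ hn => exact ⟨_, h₁, .cons h₂ hn hs⟩

/-- `Ξ` and `Ξ'` are normal, with `Ξ'` long, and `σ` maps each variable of `Ξ` outside `G` to a
variable of `Ξ'` of a corresponding type. -/
structure CtxRel (Ξ Ξ' : Ctx) (σ : ℕ → Tm) (G : Set ℕ) : Prop where
  wf : Derives Ξ .ctx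
  wf' : Derives Ξ' .ctx
  normal : NormalCtx Ξ
  normal' : NormalCtx Ξ'
  long' : ∀ {x A}, ObjIn Ξ' x A → Long (objSig Ξ') A 0
  rel : ∀ {y P}, y ∉ G → ObjIn Ξ y P →
    ∃ y' P', σ y = .var y' ∧ ObjIn Ξ' y' P' ∧ Sim (famSig Ξ') (objSig Ξ') σ P' P

/-- `M : A` over `Ξ` and `M' : A'` over `Ξ'` are canonical and related by `∼`. -/
structure Corr (Ξ Ξ' : Ctx) (σ : ℕ → Tm) (M M' : Obj) (A A' : Fam) : Prop where
  normal : Normal M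
  normal' : Normal M'
  long : Long (objSig Ξ) M 0
  long' : Long (objSig Ξ') M' 0
  long_type' : Long (objSig Ξ') A' 0
  derives : Derives Ξ (.obj M A)
  derives' : Derives Ξ' (.obj M' A')
  sim_type : Sim (famSig Ξ') (objSig Ξ') σ A' A
  eq : ∃ a, TmEq (famSig Ξ') (objSig Ξ') (enc M') ((enc M).subst σ) a

/-- Some canonical object of type `D` over `Γ` encodes to a term equal to `τ`. -/
def Recovered (Γ : Ctx) (τ : Tm) (D : Fam) : Prop :=
  ∃ s, Normal s ∧ Long (objSig Γ) s 0 ∧ Derives Γ (.obj s D) ∧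
    TmEq (famSig Γ) (objSig Γ) τ (enc s) D.phi

theorem Derives.hasTy_enc {Γ M A} (h : Derives Γ (.obj M A)) (hM : Normal M) (hΓ : NormalCtx Γ)
    (S : List (ℕ × HTy)) : HasTy S (objSig Γ) (enc M) A.phi :=
  (h.simple (hΓ.flatCtx h.ctx) (h.flat_obj hM)).1.hasTy S

/-- The type `D` of `τ` over `Γ` is well-formed, normal and long. -/
structure TermOf (Γ : Ctx) (τ : Tm) (D : Fam) : Prop where
  ctx : NormalCtx Γ
  typ : Derives Γ (.fam D .typ)
  normal : Normal D
  long : Long (objSig Γ) D 0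
  hasTy : HasTy (famSig Γ) (objSig Γ) τ D.phi

/-- If `τ`, embedded into `Ξ'` by `ρ`, equals the encoding of a canonical object whose type comes
from the type `D` of `τ`, then this object comes from one over `Γ`. -/
theorem TermOf.recovered_of_enc {Γ Ξ' τ D ρ M' A' a} (h : TermOf Γ τ D) (hρ : Emb Γ Ξ' ρ)
    (hS : famSig Γ ⊆ famSig Ξ') (hM : Normal M')
    (lM : Long (objSig Ξ') M' 0) (dM : Derives Ξ' (.obj M' A')) (hA : A' = D.rename ρ)
    (he : TmEq (famSig Ξ') (objSig Ξ') (enc M') (τ.rename ρ) a) : Recovered Γ τ D := by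
  obtain ⟨n, hn, -⟩ := (TmEq.refl h.hasTy).exists_ev h.typ.ctx.sigFun
  have hn' := hn.rename hS hρ.hRen
  have hS' := dM.ctx.sigFun
  have e := he.hasTy.2.unique hS' (h.hasTy.rename hS hρ.hRen)
  subst e
  have e := he.ev_eq hS' (lM.ev_enc hM he.hasTy.1) hn'
  obtain ⟨M, A, rfl, eA, d⟩ :=
    Derives.strengthen hρ h.ctx h.typ.ctx hM dM e (.inr ⟨D, h.typ, h.normal, hA⟩)
  cases Exp.rename_injective _ _ hρ.inj (hA.symm.trans eA)
  rw [enc_rename] at e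
  cases Tm.rename_injective _ _ hρ.inj e
  exact ⟨M, hM.of_rename, lM.of_rename hρ.of_objSig, d,
    (hn.sound h.typ.ctx.sigFun _ h.hasTy fun _ => rfl).2⟩

/-- The case of distinct bound variables as arguments.  Each argument `y` is abstracted in turn: its
type over `Ξ'` agrees with the domain of the type of `τ`, so that `Γ` can be extended by a variable
that is mapped to `y`. -/
theorem TermOf.recovered {Ξ Ξ' σ G} (hΞ : CtxRel Ξ Ξ' σ G) {M' A'} (hM : Normal M')
    (lM : Long (objSig Ξ') M' 0) (lA : Long (objSig Ξ') A' 0) (dM : Derives Ξ' (.obj M' A')) {A a}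
    (hA : Sim (famSig Ξ') (objSig Ξ') σ A' A) :
    ∀ {ys : List ℕ} {Γ : Ctx} {τ : Tm} {D : Fam} {ρ H X}, TermOf Γ τ D → Emb Γ Ξ' ρ →
    famSig Γ ⊆ famSig Ξ' → (enc H).subst σ = τ.rename ρ → Normal X →
    Sim (famSig Ξ') (objSig Ξ') σ (D.rename ρ) X → Spine Ξ X (ys.map .var) A → ys.Nodup →
    (∀ y ∈ ys, y ∉ G ∧ σ y = .var y ∧ ∀ z, ρ z ≠ y) →
    TmEq (famSig Ξ') (objSig Ξ') (enc M') ((enc (apps H (ys.map .var))).subst σ) a →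
    Recovered Γ τ D
  | [], Γ, τ, D, ρ, H, X, h, hρ, hS, hH, nX, hX, hs, _, _, he => by
    cases hs
    have dA := dM.wf_type hM hΞ.normal'
    have dD : Derives Ξ' (.fam (D.rename ρ) .typ) := h.typ.rename hρ.toRen hΞ.wf'
    have e := (dA.eq_of_sim hΞ.normal' dM.normal_type (h.normal.rename ρ) lA
      (h.long.rename hρ.hRen) dA.not_lamF dD.not_lamF dD hA hX).1
    refine h.recovered_of_enc hρ hS hM lM dM e (a := a) ?_
    rw [← hH]
    exact he
  | y :: ys, Γ, τ, D, ρ, H, X, h, hρ, hS, hH, nX, hX, hs, hnd, hys, he => by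
    rw [List.map_cons] at hs
    cases hs with | @cons X₁ X₂ X' _ _ _ dy hn hs =>
    obtain ⟨hyG, hσy, hyρ⟩ := hys y (List.mem_cons_self ..)
    generalize hT : D.rename ρ = T at hX
    cases hX with | pi hX₁ hX₂ =>
    cases D <;> simp only [Exp.rename, Exp.pi.injEq, reduceCtorEq] at hT
    obtain ⟨rfl, rfl⟩ := hT
    rename_i D₁ D₂
    obtain ⟨dD₁, dD₂⟩ := h.typ.pi_inv
    have ⟨nD₁, nD₂⟩ := h.normal.pi
    -- the types of `y` over `Ξ` and over `Ξ'`
    cases dy with | varObj _ hy hyn =>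
    cases hyn.eq_of_normal (hΞ.normal.objIn hy)
    obtain ⟨y', P', hy', hP', hsim⟩ := hΞ.rel hyG hy
    cases hσy.symm.trans hy'
    have dP := Derives.of_objIn hP' hΞ.wf'
    have dD₁' : Derives Ξ' (.fam (D₁.rename ρ) .typ) := dD₁.rename hρ.toRen hΞ.wf'
    cases (dP.eq_of_sim hΞ.normal' (hΞ.normal'.objIn hP') (nD₁.rename ρ) (hΞ.long' hP')
      (h.long.1.rename hρ.hRen) dP.not_lamF dD₁'.not_lamF dD₁' hsim hX₁).1
    have hρ' := hρ.cons hP' hyρ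
    have h' : TermOf (.obj D₁ :: Γ) (.app τ.shift (.var 0)) D₂ :=
      ⟨⟨nD₁, h.ctx⟩, dD₂, nD₂, h.long.2, .app (h.hasTy.shift _) (.var rfl)⟩
    have hX' : Sim (famSig Ξ') (objSig Ξ') σ (D₂.rename (cons y ρ)) X' := by
      refine hX₂.inst (M := .var y) (N := .var y) ?_ ?_ hn (nD₂.rename _).noRedF nX.pi.2.noRedF
        trivial trivial
      · simp only [enc, Tm.subst, hσy]
        exact .refl (.var hP'.objSig)
      · rw [Exp.rename_up_inst_var]
        exact .of_normal (nD₂.rename _)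
    obtain ⟨s, ns, ls, ds, es⟩ := recovered hΞ hM lM lA dM hA (ys := ys) h' hρ' hS
      (H := .app H (.var y)) (by
        simp only [enc, Tm.subst, hσy, hH, Tm.rename, Tm.shift, Tm.rename_rename]
        rfl) hn.2 hX' hs (List.nodup_cons.1 hnd).2 (by
        intro z hz
        obtain ⟨h₁, h₂, h₃⟩ := hys z (List.mem_cons_of_mem _ hz)
        refine ⟨h₁, h₂, fun x e => ?_⟩
        cases x
        · cases (show y = z from e)
          exact (List.nodup_cons.1 hnd).1 hz
        · exact h₃ _ e) he
    exact ⟨.lam D₁ s, nD₁.mk_lam ns, ⟨h.long.1, ls⟩, .absObj dD₁ ds (.of_normal nD₁),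
      .lam_of_app h.hasTy es⟩

theorem Ev.of_neutral {S Θ s n a} (h : Ev S false Θ s n a) (hs : s.Neutral) (ha : a.arity = 0) :
    Ev S true Θ s n a := by
  cases h with
  | base _ h hp => rwa [hs.eq_of_whr h]
  | arr => simp [HTy.arity] at ha

theorem neutral_apps {σ : ℕ → Tm} {y y' : ℕ} (hy : σ y = .var y') (Ms : List Obj) :
    ((enc (apps (.var y) Ms)).subst σ).Neutral := by
  induction Ms using List.reverseRecOn with
  | nil => simp only [apps, List.foldl, enc, Tm.subst, hy]; trivial
  | append_singleton Ms M ih => rw [apps_concat]; exact ih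

/-- If the `σ`-instance of `y M₁ ⋯ Mₘ`, where `y ∉ G`, evaluates to the encoding of `H'`, then `H'`
has the head `σ y` and the arguments correspond.  The types correspond by induction on the number of
arguments: they come from the related types of `y` and `σ y` by instantiation with related
objects. -/
theorem CtxRel.corr_args {Ξ Ξ' σ G} (hΞ : CtxRel Ξ Ξ' σ G) {y : ℕ} (hy : y ∉ G) {Ms : List Obj} :
    ∀ {k l H' A A' a}, Normal (apps (.var y) Ms) → Normal H' →
    Long (objSig Ξ) (apps (.var y) Ms) k → Long (objSig Ξ') H' l →
    Derives Ξ (.obj (apps (.var y) Ms) A) → Derives Ξ' (.obj H' A') →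
    HasTy (famSig Ξ') (objSig Ξ') ((enc (apps (.var y) Ms)).subst σ) a →
    Ev (famSig Ξ') true (objSig Ξ') ((enc (apps (.var y) Ms)).subst σ) (enc H') a →
    Sim (famSig Ξ') (objSig Ξ') σ A' A ∧ Long (objSig Ξ') A' 0 ∧
      ∀ M ∈ Ms, ∃ M' T T', Corr Ξ Ξ' σ M M' T T' := by
  induction Ms using List.reverseRecOn with
  | nil =>
    intro k l H' A A' a _ _ _ _ d d' _ he
    cases d with | varObj _ hy' hn =>
    cases hn.eq_of_normal (hΞ.normal.objIn hy')
    obtain ⟨y', P', hσ, hP, hs⟩ := hΞ.rel hy hy'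
    simp only [apps, List.foldl, enc, Tm.subst, hσ] at he
    generalize hn : enc H' = n at he
    cases he
    cases H' <;> simp only [enc, Tm.var.injEq, reduceCtorEq] at hn
    subst hn
    cases d' with | varObj _ hP' hn =>
    cases hP.functional hP'
    cases hn.eq_of_normal (hΞ.normal'.objIn hP)
    exact ⟨hs, hΞ.long' hP, nofun⟩
  | append_singleton Ms M ih =>
    intro k l H' A A' a nM nH lM lH d d' ht he
    rw [apps_concat] at nM lM d ht he
    simp only [enc, Tm.subst] at ht he
    cases d with | appObj d₁ d₂ hn =>
    generalize hm : enc H' = m at he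
    cases he with | app he₁ he₂ =>
    cases ht with | app ht₁ ht₂ =>
    have hS := hΞ.wf'.sigFun
    have e := (he₁.sound hS _ ht₁ nofun).1
    cases e
    cases H' <;> simp only [enc, Tm.app.injEq, reduceCtorEq] at hm
    obtain ⟨rfl, rfl⟩ := hm
    rename_i H' M'
    cases d' with | appObj d₁' d₂' hn' =>
    obtain ⟨hs, hl, hMs⟩ := ih nM.app.1 nH.app.1 lM.1 lH.1 d₁ d₁' ht₁ he₁
    cases hs with | pi hs₁ hs₂ =>
    have eM := (he₂.sound hS _ ht₂ fun _ => rfl).2.symm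
    have e := eM.hasTy.1.unique hS (d₂'.hasTy_enc nH.app.2.1 hΞ.normal' _)
    subst e
    have n₁ := d₁.normal_type.pi.2
    have n₁' := d₁'.normal_type.pi.2
    refine ⟨hs₂.inst eM hn' hn n₁'.noRedF n₁.noRedF nH.app.2.1.noRedF nM.app.2.1.noRedF,
      hl.2.inst_normalForm n₁' nH.app.2.1 lH.2 hn', fun L hL => ?_⟩
    rcases List.mem_append.1 hL with hL | hL
    · exact hMs L hL
    · cases List.mem_singleton.1 hL
      exact ⟨M', _, _, nM.app.2.1, nH.app.2.1, lM.2, lH.2, hl.1, d₂, d₂', hs₁, _, eM⟩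

theorem CtxRel.up {Ξ Ξ' σ G} (h : CtxRel Ξ Ξ' σ G) {A A' : Fam} (nA : Normal A) (nA' : Normal A')
    (lA' : Long (objSig Ξ') A' 0) (dA : Derives Ξ (.fam A .typ)) (dA' : Derives Ξ' (.fam A' .typ))
    (hs : Sim (famSig Ξ') (objSig Ξ') σ A' A) :
    CtxRel (.obj A :: Ξ) (.obj A' :: Ξ') (upTm σ) (Nat.succ '' G) where
  wf := dA.typeCtx h.wf
  wf' := dA'.typeCtx h.wf'
  normal := ⟨nA, h.normal⟩
  normal' := ⟨nA', h.normal'⟩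
  long' hx := by
    cases hx with
    | here => exact lA'.rename (HRen.succ _ _)
    | skipObj _ hx => exact (h.long' hx).rename (HRen.succ _ _)
  rel {y P} hy hP := by
    cases hP with
    | here => exact ⟨0, _, rfl, .here _ _, hs.shift _⟩
    | @skipObj _ y P _ hP =>
      obtain ⟨y', P', h₁, h₂, h₃⟩ := h.rel (fun hG => hy ⟨y, hG, rfl⟩) hP
      refine ⟨y' + 1, _, ?_, .skipObj _ h₂, h₃.shift _⟩
      show (σ y).shift = _
      rw [h₁]
      rfl

/-- The data about a rigid variable `x` of type `C` over `Γ`: `ξ` embeds `Γ` into `Ξ'`, and `σ` maps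
`x` to the embedded term `τ` and the variables in `δ` to themselves. -/
structure RigidRel (Γ : Ctx) (τ : Tm) (C : Fam) (Ξ Ξ' : Ctx) (σ : ℕ → Tm) (ξ : ℕ → ℕ) (G δ : Set ℕ)
    (x : ℕ) : Prop where
  rel : CtxRel Ξ Ξ' σ G
  emb : Emb Γ Ξ' ξ
  sig : famSig Γ ⊆ famSig Ξ'
  term : σ x = τ.rename ξ
  type : ∃ B, ObjIn Ξ x B ∧ Sim (famSig Ξ') (objSig Ξ') σ (C.rename ξ) B
  bound : ∀ y ∈ δ, y ∉ G ∧ σ y = .var y ∧ ∀ z, ξ z ≠ y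

/-- Crossing a binder. -/
theorem RigidRel.up {Γ τ C Ξ Ξ' σ ξ G δ x} (r : RigidRel Γ τ C Ξ Ξ' σ ξ G δ x) {A A' : Fam}
    (nA : Normal A) (nA' : Normal A') (lA' : Long (objSig Ξ') A' 0)
    (dA : Derives Ξ (.fam A .typ)) (dA' : Derives Ξ' (.fam A' .typ))
    (hs : Sim (famSig Ξ') (objSig Ξ') σ A' A) :
    RigidRel Γ τ C (.obj A :: Ξ) (.obj A' :: Ξ') (upTm σ) (fun z => ξ z + 1)
      (Nat.succ '' G) (insert 0 (Nat.succ '' δ)) (x + 1) := by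
  refine ⟨r.rel.up nA nA' lA' dA dA' hs, r.emb.succ _, r.sig, ?_, ?_, ?_⟩
  · show (σ x).shift = _
    rw [r.term, Tm.shift, Tm.rename_rename]
  · obtain ⟨B, hB, hs'⟩ := r.type
    have := hs'.shift A'.phi
    rw [Exp.shift, Exp.rename_rename] at this
    exact ⟨_, .skipObj _ hB, this⟩
  · rintro y (rfl | ⟨y, hy, rfl⟩)
    · exact ⟨by simp, rfl, fun z => Nat.succ_ne_zero _⟩
    · obtain ⟨h₁, h₂, h₃⟩ := r.bound y hy
      refine ⟨fun ⟨z, hz, e⟩ => h₁ (Nat.succ.inj e ▸ hz), ?_, fun z e => h₃ z (Nat.succ.inj e)⟩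
      show (σ y).shift = _
      rw [h₂]
      rfl

/-- A rigid occurrence of `x` determines the instance of `x` as an encoding of an LF object. -/
theorem RigidObj.recovered {Γ τ C} (hτ : TermOf Γ τ C) {G δ x M} (h : RigidObj G δ x M) :
    ∀ {Ξ Ξ' σ ξ M' A A'}, RigidRel Γ τ C Ξ Ξ' σ ξ G δ x → Corr Ξ Ξ' σ M M' A A' →
    Recovered Γ τ C := by
  induction h with
  | @init G δ x ys hys hnd =>
    intro Ξ Ξ' σ ξ M' A A' r c
    obtain ⟨B, hB, hs⟩ := r.type
    obtain ⟨X, dX, hsp⟩ := c.derives.spine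
    cases dX with | varObj _ hX hn =>
    cases hX.functional hB
    cases hn.eq_of_normal (r.rel.normal.objIn hB)
    obtain ⟨a, he⟩ := c.eq
    exact hτ.recovered r.rel c.normal' c.long' c.long_type' c.derives' c.sim_type r.emb r.sig
      (H := .var x) (show (enc (.var x)).subst σ = _ from r.term)
      (r.rel.normal.objIn hB) hs hsp hnd (fun y hy => r.bound y (hys y hy)) he
  | @app G δ x y Ms M hy hM _ ih =>
    intro Ξ Ξ' σ ξ M' A A' r c
    obtain ⟨a, he⟩ := c.eq
    have hS := r.rel.wf'.sigFun
    -- `apps (var y) Ms` is long and no abstraction, so its type is not a `Π`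
    have hA₀ := ((c.long.ev c.normal (c.derives.hasTy_enc c.normal r.rel.normal [])).1
      (apps_var_ne_lam y Ms)).1
    have ht' := c.derives'.hasTy_enc c.normal' r.rel.normal' (famSig Ξ')
    rw [← c.sim_type.phi_eq nofun] at hA₀
    have hM' : ∀ A L, M' ≠ .lam A L := by
      rintro B L rfl
      have d := c.derives'
      cases d
      exact absurd hA₀ (by simp [Exp.phi, HTy.arity])
    have e := he.hasTy.1.unique hS ht'
    subst e
    have hE := (c.long'.ev c.normal' ht').1 hM' |>.2
    obtain ⟨n, h₁, h₂⟩ := he.exists_ev hS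
    have e := ((c.long'.ev_enc c.normal' ht').det hS _ _ h₁ fun _ => rfl).1
    subst e
    obtain ⟨X, dX, -⟩ := c.derives.spine
    cases dX with | varObj _ hX _ =>
    obtain ⟨y', P', hσ, -, -⟩ := r.rel.rel hy hX
    obtain ⟨L', T, T', c'⟩ := (r.rel.corr_args hy c.normal c.normal' c.long c.long' c.derives
      c.derives' he.hasTy.2 (h₂.of_neutral (neutral_apps hσ Ms) (Nat.le_zero.1 hA₀))).2.2 M hM
    exact ih r c'
  | @abs G δ x A₁ M _ ih =>
    intro Ξ Ξ' σ ξ M' A A' r c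
    have d := c.derives
    have hs := c.sim_type
    have d' := c.derives'
    have nM' := c.normal'
    have lM' := c.long'
    have lA' := c.long_type'
    obtain ⟨a, he⟩ := c.eq
    cases d with | absObj d₁ d₂ hn =>
    cases hn.eq_of_normal c.normal.lam.1
    cases hs with | @pi _ _ _ A₁' _ B' hs₁ hs₂ =>
    -- a long object of a `Π`-type is an abstraction
    have hM' : ∃ A L, M' = .lam A L := by
      by_contra hcon
      push Not at hcon
      have := ((lM'.ev nM' (d'.hasTy_enc nM' r.rel.normal' [])).1 hcon).1
      simp [Exp.phi, HTy.arity] at this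
    obtain ⟨A₂, L, rfl⟩ := hM'
    cases d' with | absObj d₁' d₂' hn' =>
    cases hn'.eq_of_normal nM'.lam.1
    have e := hs₁.phi_eq nofun
    simp only [enc, Tm.subst, ← e] at he
    have ⟨b, hb⟩ : ∃ b, a = .arr A₁'.phi b := by
      have := he.hasTy.1
      cases this
      exact ⟨_, rfl⟩
    subst hb
    have r' := r.up c.normal.lam.1 nM'.lam.1 lM'.1 d₁ d₁' hs₁
    exact ih r' ⟨c.normal.lam.2, nM'.lam.2, c.long.2, lM'.2, lA'.2, d₂, d₂', hs₂, b, he.lam_inv⟩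

/-- Types with the same head: the arguments correspond. -/
theorem CtxRel.corr_argsF {Ξ Ξ' σ G} (hΞ : CtxRel Ξ Ξ' σ G) {u : ℕ}
    (hu : ∀ K K', FamIn Ξ u K → FamIn Ξ' u K' → Sim (famSig Ξ') (objSig Ξ') σ K' K)
    (hl : ∀ K, FamIn Ξ' u K → Long (objSig Ξ') K 0) {Ms : List Obj} :
    ∀ {k l A' K K'}, Normal (appsF (.tvar u) Ms) → Normal A' →
    Long (objSig Ξ) (appsF (.tvar u) Ms) k → Long (objSig Ξ') A' l →
    Derives Ξ (.fam (appsF (.tvar u) Ms) K) → Derives Ξ' (.fam A' K') →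
    Sim (famSig Ξ') (objSig Ξ') σ A' (appsF (.tvar u) Ms) →
    Sim (famSig Ξ') (objSig Ξ') σ K' K ∧ Long (objSig Ξ') K' 0 ∧
      ∀ M ∈ Ms, ∃ M' T T', Corr Ξ Ξ' σ M M' T T' := by
  induction Ms using List.reverseRecOn with
  | nil =>
    intro k l A' K K' _ _ _ _ d d' he
    cases he
    cases d with | varFam _ h hn =>
    cases d' with | varFam _ h' hn' =>
    cases hn.eq_of_normal (hΞ.normal.famIn h)
    cases hn'.eq_of_normal (hΞ.normal'.famIn h')
    exact ⟨hu _ _ h h', hl _ h', nofun⟩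
  | append_singleton Ms M ih =>
    intro k l A' K K' nA nA' lA lA' d d' he
    rw [appsF_concat] at nA lA d he
    cases he with | appF he₁ he₂ =>
    cases d with | appFam d₁ d₂ hn =>
    cases d' with | appFam d₁' d₂' hn' =>
    obtain ⟨hs, hl, hMs⟩ := ih nA.appF.1 nA'.appF.1 lA.1 lA'.1 d₁ d₁' he₁
    cases hs with | piK hs₁ hs₂ =>
    obtain ⟨a, eM⟩ := he₂.obj_inv
    have e := eM.hasTy.1.unique hΞ.wf'.sigFun (d₂'.hasTy_enc nA'.appF.2.1 hΞ.normal' _)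
    subst e
    have n₁ := d₁.normal_kind.piK.2
    have n₁' := d₁'.normal_kind.piK.2
    refine ⟨hs₂.inst eM hn' hn n₁'.noRedF n₁.noRedF nA'.appF.2.1.noRedF nA.appF.2.1.noRedF,
      hl.2.inst_normalForm n₁' nA'.appF.2.1 lA'.2 hn', fun L hL => ?_⟩
    rcases List.mem_append.1 hL with hL | hL
    · exact hMs L hL
    · cases List.mem_singleton.1 hL
      exact ⟨_, _, _, nA.appF.2.1, nA'.appF.2.1, lA.2, lA'.2, hl.1, d₂, d₂', hs₁, _, eM⟩

/-! ### Telescopes -/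

theorem Sim.mono {S S'} {c : Cat} {Θ σ} {P Q : Exp c} (h : Sim S Θ σ P Q) (hS : S ⊆ S') :
    Sim S' Θ σ P Q := by
  have := h.rename_left hS (ρ := fun x => x) (Θ' := Θ) fun _ _ h => h
  simpa only [Tm.rename_id, Exp.rename_id] using this

theorem Emb.skipFam {Γ Γ' ρ} (h : Emb Γ Γ' ρ) (u : ℕ) (K : Kind) : Emb Γ (.fam u K :: Γ') ρ where
  toRen := h.toRen.comp (Ren.skipFam _ _ _)
  refl hx := by cases hx with | skipFam _ _ hx => exact h.refl hx
  inj := h.inj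

theorem Emb.append (Γ : Ctx) : ∀ Φ : Ctx, Emb Γ (Φ ++ Γ) fun x => x + objCount Φ
  | [] => ⟨⟨fun h => by simpa [objCount, objSig, Exp.rename_id] using h,
      fun h => by simpa [objCount, objSig, Exp.rename_id] using h⟩, fun h => ⟨_, h⟩, fun _ _ h => h⟩
  | .fam u K :: Φ => (Emb.append Γ Φ).skipFam u K
  | .obj A :: Φ => (Emb.append Γ Φ).succ A

theorem CanonicalCtx.suffix {Γ : Ctx} : ∀ {Φ : Ctx}, CanonicalCtx (Φ ++ Γ) → CanonicalCtx Γ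
  | [], h => h
  | .fam _ _ :: _, h => h.2.suffix
  | .obj _ :: _, h => h.2.suffix

theorem CanonicalCtx.long_famIn {Γ u K} (h : CanonicalCtx Γ) (hu : FamIn Γ u K) :
    Long (objSig Γ) K 0 := by
  induction hu with
  | here => exact h.1.long h.2.normalCtx
  | skipFam _ _ _ ih => exact ih h.2
  | skipObj _ _ ih => exact (ih h.2).rename (HRen.succ _ _)

theorem Derives.ctx_suffix {Γ : Ctx} : ∀ {Φ : Ctx}, Derives (Φ ++ Γ) .ctx → Derives Γ .ctx
  | [], h => h
  | .fam _ _ :: Φ, h => by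
    cases h with | kindCtx _ h _ => exact Derives.ctx_suffix (Φ := Φ) h
  | .obj _ :: Φ, h => by
    cases h with | typeCtx _ h => exact Derives.ctx_suffix (Φ := Φ) h

theorem teleCtx_succ {n : ℕ} (B : Fin (n + 1) → Fam) :
    teleCtx B = .obj (B (Fin.last n)) :: teleCtx fun j => B j.castSucc := by
  rw [teleCtx, List.ofFn_succ_last, List.reverse_append]
  rfl

theorem objCount_teleCtx {n : ℕ} (B : Fin n → Fam) : objCount (teleCtx B) = n := by
  induction n with
  | zero => rfl
  | succ n ih => rw [teleCtx_succ]; exact congrArg (· + 1) (ih _)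

theorem objSig_teleCtx {n : ℕ} (B : Fin n → Fam) (Γ : Ctx) (x : ℕ) :
    (objSig (teleCtx B ++ Γ))[x]? =
      if h : x < n then some (B (Fin.rev ⟨x, h⟩)).phi else (objSig Γ)[x - n]? := by
  induction n generalizing x with
  | zero => rfl
  | succ n ih =>
    rw [teleCtx_succ]
    cases x with
    | zero => rfl
    | succ x =>
      have := ih (fun j => B j.castSucc) x
      simp only [List.cons_append, objSig, List.getElem?_cons_succ, this]
      by_cases h : x < n
      · rw [dif_pos h, dif_pos (by omega)]
        congr 3
        ext
        simp [Fin.val_rev]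
      · rw [dif_neg h, dif_neg (by omega)]
        congr 1
        omega

/-- The entry `xᵢ : Bᵢ` of a telescope and the part that precedes it. -/
theorem teleCtx_split {n : ℕ} (B : Fin n → Fam) (i : Fin n) :
    ∃ Φ, teleCtx B = Φ ++ .obj (B i) :: teleCtx (fun j : Fin i => B (j.castLE i.isLt.le)) ∧
      objCount Φ = Fin.rev i := by
  induction n with
  | zero => exact i.elim0
  | succ n ih =>
    rw [teleCtx_succ]
    induction i using Fin.lastCases with
    | last => exact ⟨[], rfl, by simp [objCount, objSig]⟩
    | cast i =>
      obtain ⟨Φ, h, e⟩ := ih (fun j => B j.castSucc) i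
      refine ⟨.obj (B (Fin.last n)) :: Φ, ?_, ?_⟩
      · rw [h]
        rfl
      · show objCount Φ + 1 = _
        rw [e]
        simp [Fin.val_rev]
        omega

theorem pis_succ {n : ℕ} (B : Fin (n + 1) → Fam) (A : Fam) :
    pis B A = pis (fun j => B j.castSucc) (.pi (B (Fin.last n)) A) := by
  rw [pis, List.ofFn_succ_last, List.foldr_append]
  rfl

theorem Derives.of_pis {n : ℕ} {B : Fin n → Fam} {Γ A} (h : Derives Γ (.fam (pis B A) .typ)) :
    Derives (teleCtx B ++ Γ) (.fam A .typ) := by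
  induction n generalizing A with
  | zero => exact h
  | succ n ih =>
    rw [pis_succ] at h
    rw [teleCtx_succ]
    exact (ih h).pi_inv.2

theorem Canonical.of_pis {n : ℕ} {B : Fin n → Fam} {Γ A} (h : Canonical Γ (pis B A)) :
    Canonical (teleCtx B ++ Γ) A := by
  induction n generalizing A with
  | zero => exact h
  | succ n ih =>
    rw [pis_succ] at h
    rw [teleCtx_succ]
    exact ⟨(ih h).1.pi.2, (ih h).2.2⟩

/-! ### The rigid variables of a telescope -/

theorem instTm_add {n : ℕ} (t : Fin n → Tm) (x : ℕ) : instTm t (x + n) = .var x := by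
  simp [instTm]

theorem instTm_castLE {n : ℕ} (t : Fin n → Tm) (i : Fin n) (x : ℕ) :
    instTm (fun j : Fin i => t (j.castLE i.isLt.le)) x = instTm t (x + ((Fin.rev i : ℕ) + 1)) := by
  have hi := i.isLt
  have hr : (Fin.rev i : ℕ) = n - (i + 1) := Fin.val_rev i
  unfold instTm
  by_cases h : x < i
  · rw [dif_pos h, dif_pos (by omega)]
    refine congrArg t (Fin.ext ?_)
    simp only [Fin.val_castLE, Fin.val_rev]
    omega
  · rw [dif_neg h, dif_neg (by omega)]
    congr 1
    omega

/-- A simply typed expression over `Γ` is related to its weakening by `x₁, …, xₙ`, for which the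
substitution has no effect. -/
theorem Sim.weaken_teleCtx {S} {c : Cat} {n : ℕ} {Γ : Ctx} (t : Fin n → Tm) {P : Exp c} {a}
    (h : ST (objSig Γ) P a) :
    Sim S (objSig Γ) (instTm t) P (P.rename fun x => x + n) := by
  refine .rename_right ?_
  simp only [instTm_add]
  exact .refl_of_st h

/-- The telescope `x₁ : B₁, …, xₙ : Bₙ` is canonical and well-formed over `Γ`, the terms `tⱼ` are
typed accordingly, `tⱼ` encodes `t'ⱼ` for `j < i`, and `C` is the type of an instance of `xᵢ`. -/
structure TeleHyp {n : ℕ} (Γ : Ctx) (B : Fin n → Fam) (t : Fin n → Tm) (i : Fin n)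
    (t' : Fin (i : ℕ) → Obj) (C : Fam) : Prop where
  can : CanonicalCtx (teleCtx B ++ Γ)
  hasTy : ∀ j, HasTy (famSig Γ) (objSig Γ) (t j) (B j).phi
  can' : ∀ j, Canonical Γ (t' j)
  eq : ∀ j : Fin (i : ℕ), TmEq (famSig Γ) (objSig Γ) (t (j.castLE i.isLt.le)) (enc (t' j))
    (B (j.castLE i.isLt.le)).phi
  nf : NormalFormOf ((B i).subst (instObj t')) C
  typ : Derives Γ (.fam C .typ)
  wf : Derives (teleCtx B ++ Γ) .ctx

namespace TeleHyp

variable {n : ℕ} {Γ : Ctx} {B : Fin n → Fam} {t : Fin n → Tm} {i : Fin n} {t' : Fin (i : ℕ) → Obj}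
  {C : Fam}

/-- `Bᵢ` is a canonical type over `Γ, x₁ : B₁, …, xᵢ₋₁ : Bᵢ₋₁`. -/
theorem prefix_ctx (h : TeleHyp Γ B t i t' C) :
    Derives (teleCtx (fun j : Fin i => B (j.castLE i.isLt.le)) ++ Γ) (.fam (B i) .typ) ∧
    Canonical (teleCtx (fun j : Fin i => B (j.castLE i.isLt.le)) ++ Γ) (B i) ∧
    CanonicalCtx (teleCtx (fun j : Fin i => B (j.castLE i.isLt.le)) ++ Γ) := by
  obtain ⟨Φ, e, -⟩ := teleCtx_split B i
  have hc := h.can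
  have hw := h.wf
  rw [e, List.append_assoc] at hc hw
  have hc := hc.suffix
  have hw := hw.ctx_suffix
  cases hw with | typeCtx hw _ => exact ⟨hw, hc.1, hc.2⟩

theorem noRedF_inst (h : TeleHyp Γ B t i t' C) : NoRedF ((B i).subst (instObj t')) := by
  refine h.prefix_ctx.2.1.1.noRedF.subst fun x => ?_
  unfold instObj
  split
  · exact (h.can' _).1.noRedF
  · trivial

theorem phi_eq (h : TeleHyp Γ B t i t' C) : C.phi = (B i).phi := by
  rw [h.nf.phi_eq h.noRedF_inst, Exp.phi_subst_fam]

theorem canonicalCtx (h : TeleHyp Γ B t i t' C) : CanonicalCtx Γ := h.can.suffix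

/-- `C` is long although the `t'ⱼ` need not be well typed, since `Long` is stable under substitution
and reduction. -/
theorem termOf (h : TeleHyp Γ B t i t' C) : TermOf Γ (t i) C where
  ctx := h.canonicalCtx.normalCtx
  typ := h.typ
  normal := h.nf.2
  long := by
    refine Long.steps (Long.subst (h.prefix_ctx.2.1.long h.prefix_ctx.2.2.normalCtx) ?_) h.nf.1
      h.noRedF_inst
    intro x a hx
    rw [objSig_teleCtx] at hx
    unfold instObj
    split
    · exact ((h.can' _).long h.canonicalCtx.normalCtx).mono (Nat.zero_le _)
    · rename_i hx'
      rw [dif_neg hx'] at hx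
      exact ⟨a, hx, le_rfl⟩
  hasTy := by rw [h.phi_eq]; exact h.hasTy i

/-- `C ∼ Bᵢ`, since `tⱼ` is the encoding of `t'ⱼ` for `j < i`. -/
theorem sim (h : TeleHyp Γ B t i t' C) :
    Sim (famSig Γ) (objSig Γ) (instTm t) C
      ((B i).rename fun x => x + ((Fin.rev i : ℕ) + 1)) := by
  obtain ⟨d, hc, hcc⟩ := h.prefix_ctx
  have hst := (d.simple (hcc.normalCtx.flatCtx d.ctx) (d.flat_type hc.1)).1
  have hs := (Sim.refl_of_st (S := famSig Γ) hst).subst_left (Θ' := objSig Γ) (s := instObj t')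
    (τ := instTm fun j : Fin i => t (j.castLE i.isLt.le)) (by
      intro x a hx
      rw [objSig_teleCtx] at hx
      unfold instObj instTm
      split
      · rename_i hx'
        rw [dif_pos hx'] at hx
        cases hx
        exact (h.eq _).symm
      · rename_i hx'
        rw [dif_neg hx'] at hx
        exact .refl (.var hx))
  refine .rename_right ?_
  have hs := hs.steps h.nf.1 .refl h.noRedF_inst hc.1.noRedF
  simpa only [Tm.subst, instTm_castLE] using hs

theorem emb (B : Fin n → Fam) : Emb Γ (teleCtx B ++ Γ) fun x => x + n := by
  have := Emb.append Γ (teleCtx B)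
  rwa [objCount_teleCtx] at this

/-- The data about the rigid variable `xᵢ` at the root, before any binder is crossed. -/
theorem rigidRel_nil (h : TeleHyp Γ B t i t' C) :
    RigidRel Γ (t i) C (teleCtx B ++ Γ) Γ (instTm t) (fun x => x) {k | k < n} ∅ (Fin.rev i) where
  rel :=
    { wf := h.wf
      wf' := h.typ.ctx
      normal := h.can.normalCtx
      normal' := h.canonicalCtx.normalCtx
      long' := fun hx => h.canonicalCtx.long_objIn hx
      rel := by
        intro y P hy hP
        obtain ⟨x, rfl⟩ : ∃ x, y = x + n := ⟨y - n, by simp at hy; omega⟩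
        obtain ⟨Q, hQ⟩ := (emb B).refl hP
        cases hP.functional ((emb B).obj hQ)
        have hf := h.canonicalCtx.normalCtx.flatCtx h.typ.ctx
        exact ⟨x, Q, instTm_add t x, hQ, .weaken_teleCtx t ((h.typ.ctx.simple hf).2 _ _ hQ)⟩ }
  emb := Emb.append Γ []
  sig := List.Subset.refl _
  term := by
    rw [Tm.rename_id, instTm, dif_pos (Fin.rev i).isLt, Fin.eta, Fin.rev_rev]
  type := by
    obtain ⟨Φ, e, hΦ⟩ := teleCtx_split B i
    refine ⟨_, ?_, by rw [Exp.rename_id]; exact h.sim⟩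
    have := (Emb.append
      (.obj (B i) :: (teleCtx (fun j : Fin i => B (j.castLE i.isLt.le)) ++ Γ)) Φ).obj (.here _ _)
    rw [hΦ, Exp.shift, Exp.rename_rename, Nat.zero_add] at this
    rw [e, List.append_assoc]
    have hr : (fun x => x + ((Fin.rev i : ℕ) + 1)) = fun x => Nat.succ x + (Fin.rev i : ℕ) :=
      funext fun x => by simp only [Nat.succ_eq_add_one]; omega
    rw [hr]
    exact this
  bound := nofun

theorem recovered_type (h : TeleHyp Γ B t i t' C) (hr : Recovered Γ (t i) C) :
    ∃ s : Obj, Canonical Γ s ∧ TmEq (famSig Γ) (objSig Γ) (t i) (enc s) (B i).phi ∧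
      Derives Γ (.obj s C) := by
  obtain ⟨s, ns, ls, ds, es⟩ := hr
  exact ⟨s, ds.canonical h.canonicalCtx.normalCtx ns ls, h.phi_eq ▸ es, ds⟩

end TeleHyp

theorem CtxRel.skipFam {Ξ Ξ' σ G} (h : CtxRel Ξ Ξ' σ G) {u K K'} (nK : Normal K) (nK' : Normal K')
    (d : Derives (.fam u K :: Ξ) .ctx) (d' : Derives (.fam u K' :: Ξ') .ctx) :
    CtxRel (.fam u K :: Ξ) (.fam u K' :: Ξ') σ G where
  wf := d
  wf' := d'
  normal := ⟨nK, h.normal⟩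
  normal' := ⟨nK', h.normal'⟩
  long' hx := by cases hx with | skipFam _ _ hx => exact h.long' hx
  rel hy hP := by
    cases hP with | skipFam _ _ hP =>
    obtain ⟨y', P', h₁, h₂, h₃⟩ := h.rel hy hP
    exact ⟨y', P', h₁, .skipFam _ _ h₂, h₃.mono (List.subset_cons_self _ _)⟩

theorem RigidRel.skipFam {Γ τ C Ξ Ξ' σ ξ G δ x} (r : RigidRel Γ τ C Ξ Ξ' σ ξ G δ x) {u K K'}
    (nK : Normal K) (nK' : Normal K') (d : Derives (.fam u K :: Ξ) .ctx)
    (d' : Derives (.fam u K' :: Ξ') .ctx) :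
    RigidRel Γ τ C (.fam u K :: Ξ) (.fam u K' :: Ξ') σ ξ G δ x where
  rel := r.rel.skipFam nK nK' d d'
  emb := r.emb.skipFam _ _
  sig := fun _ h => List.mem_cons_of_mem _ (r.sig h)
  term := r.term
  type := by
    obtain ⟨B, hB, hs⟩ := r.type
    exact ⟨B, .skipFam _ _ hB, hs.mono (List.subset_cons_self _ _)⟩
  bound := r.bound

/-- The data about the rigid variable `xᵢ` below related contexts `Δ` and `Δ'`. -/
theorem TeleHyp.rigidRel {n : ℕ} {Γ : Ctx} {B : Fin n → Fam} {t : Fin n → Tm} {i : Fin n}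
    {t' : Fin (i : ℕ) → Obj} {C : Fam} (h : TeleHyp Γ B t i t' C) {Δ' Δ : Ctx}
    (hs : CtxSim Γ t Δ' Δ) (hc : CanonicalCtx (Δ ++ (teleCtx B ++ Γ)))
    (hc' : CanonicalCtx (Δ' ++ Γ))
    (hd : Derives (Δ ++ (teleCtx B ++ Γ)) .ctx) (hd' : Derives (Δ' ++ Γ) .ctx) :
    RigidRel Γ (t i) C (Δ ++ (teleCtx B ++ Γ)) (Δ' ++ Γ) (upTm^[objCount Δ'] (instTm t))
      (fun x => x + objCount Δ') {k | objCount Δ ≤ k ∧ k < objCount Δ + n} {k | k < objCount Δ}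
      (objCount Δ + (Fin.rev i : ℕ)) := by
  induction hs with
  | nil =>
    simpa [objCount, objSig] using h.rigidRel_nil
  | fam u _ _ ih =>
    have hd₁ := hd
    have hd₁' := hd'
    cases hd with | kindCtx _ hd _ =>
    cases hd' with | kindCtx _ hd' _ =>
    exact (ih hc.2 hc'.2 hd hd').skipFam hc.1.1 hc'.1.1 hd₁ hd₁'
  | @obj Δ' Δ A' A _ hA ih =>
    cases hd with | typeCtx hA₁ hd =>
    cases hd' with | typeCtx hA₂ hd' =>
    have := (ih hc.2 hc'.2 hd hd').up hc.1.1 hc'.1.1 (hc'.1.long hc'.2.normalCtx) hA₁ hA₂ hA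
    have e : ∀ (B : Fam) (Φ : Ctx), objCount (.obj B :: Φ) = objCount Φ + 1 := fun _ _ => rfl
    rw [← Function.iterate_succ_apply' upTm] at this
    have hG : {k | objCount Δ + 1 ≤ k ∧ k < objCount Δ + 1 + n} =
        Nat.succ '' {k | objCount Δ ≤ k ∧ k < objCount Δ + n} := by
      ext k
      constructor
      · rintro ⟨h₁, h₂⟩
        exact ⟨k - 1, ⟨by omega, by omega⟩, by omega⟩
      · rintro ⟨l, ⟨h₁, h₂⟩, rfl⟩
        exact ⟨by omega, by omega⟩
    have hδ : {k | k < objCount Δ + 1} = insert 0 (Nat.succ '' {k | k < objCount Δ}) := by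
      ext k
      constructor
      · intro (h : k < objCount Δ + 1)
        cases k with
        | zero => exact .inl rfl
        | succ k => exact .inr ⟨k, Nat.lt_of_succ_lt_succ h, rfl⟩
      · rintro (rfl | ⟨l, h, rfl⟩)
        · exact Nat.succ_pos _
        · exact Nat.succ_lt_succ h
    rw [e, e, hG, hδ, Nat.add_right_comm]
    exact this

end RigidLF

open RigidLF in
theorem mainTheorem2 {n : ℕ} (Γ : Ctx) (B : Fin n → Fam) (t : Fin n → Tm) (i : Fin n)
    (t' : Fin (i : ℕ) → Obj) (C : Fam)
    -- `Γ` and the types `B₁, …, Bₙ` (each over `Γ` and the preceding variables) are canonical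
    (hcan : CanonicalCtx (teleCtx B ++ Γ))
    -- `t₁, …, tₙ` are terms over the signature of `Γ` of the types of the variables they replace
    (ht : ∀ j, HasTy (famSig Γ) (objSig Γ) (t j) (B j).phi)
    -- `tⱼ` encodes the canonical object `t'ⱼ` for `j < i`
    (ht'can : ∀ j, Canonical Γ (t' j))
    (ht' : ∀ j : Fin (i : ℕ), TmEq (famSig Γ) (objSig Γ) (t (j.castLE i.isLt.le)) (enc (t' j))
      (B (j.castLE i.isLt.le)).phi)
    -- `C` is the normal form of `Bᵢ[t'₁/x₁, …, t'ᵢ₋₁/xᵢ₋₁]`, and it is a well-formed type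
    (hC : NormalFormOf ((B i).subst (instObj t')) C)
    (hCtyp : Derives Γ (.fam C .typ)) :
    -- part (1)
    (∀ (Δ Δ' : Ctx) (M M' : Obj) (A A' : Fam),
      CanonicalCtx (Δ ++ teleCtx B ++ Γ) →
      Canonical (Δ ++ teleCtx B ++ Γ) M →
      Canonical (Δ ++ teleCtx B ++ Γ) A →
      CanonicalCtx (Δ' ++ Γ) →
      Canonical (Δ' ++ Γ) M' →
      Canonical (Δ' ++ Γ) A' →
      RigidObj {k | objCount Δ ≤ k ∧ k < objCount Δ + n} {k | k < objCount Δ}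
        (objCount Δ + (Fin.rev i : ℕ)) M →
      Derives (Δ ++ teleCtx B ++ Γ) (.obj M A) →
      Derives (Δ' ++ Γ) (.obj M' A') →
      ExpSim Γ t Δ' A' A → ExpSim Γ t Δ' M' M → CtxSim Γ t Δ' Δ →
      ∃ s : Obj, Canonical Γ s ∧ TmEq (famSig Γ) (objSig Γ) (t i) (enc s) (B i).phi ∧
        Derives Γ (.obj s C)) ∧
    -- part (2)
    (∀ A A' : Fam, IsAtomic A →
      Canonical Γ (pis B A) →
      Canonical Γ A' →
      Derives Γ (.fam (pis B A) .typ) →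
      RigidFam {k | k < n} (Fin.rev i : ℕ) A →
      ExpSim Γ t [] A' A →
      Derives Γ (.fam A' .typ) →
      ∃ s : Obj, Canonical Γ s ∧ TmEq (famSig Γ) (objSig Γ) (t i) (enc s) (B i).phi ∧
        Derives Γ (.obj s C)) := by
  constructor
  · intro Δ Δ' M M' A A' hΞ hM _ hΞ' hM' hA' hr d d' sA sM sΔ
    rw [List.append_assoc] at hΞ hM d
    have h : TeleHyp Γ B t i t' C := ⟨hcan, ht, ht'can, ht', hC, hCtyp, d.ctx.ctx_suffix⟩
    exact h.recovered_type (hr.recovered h.termOf (h.rigidRel sΔ hΞ hΞ' d.ctx d'.ctx)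
      ⟨hM.1, hM'.1, hM.long hΞ.normalCtx, hM'.long hΞ'.normalCtx, hA'.long hΞ'.normalCtx, d, d', sA,
        sM.obj_inv⟩)
  · intro A A' hat hp hA' d hr sA d'
    have d₁ := d.of_pis
    have h : TeleHyp Γ B t i t' C := ⟨hcan, ht, ht'can, ht', hC, hCtyp, d₁.ctx⟩
    have hA := hp.of_pis
    have r := h.rigidRel_nil
    cases hr with
    | pi => cases hat
    | @app _ _ u Ms M hM hr =>
      have hf := h.canonicalCtx.normalCtx.flatCtx hCtyp.ctx
      -- the kinds of `u` on the two sides differ by weakening only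
      obtain ⟨L, T, T', c⟩ := (r.rel.corr_argsF
        (fun K K' hK hK' => by
          cases d₁.ctx.famIn_functional hK ((TeleHyp.emb B).fam hK')
          exact .weaken_teleCtx t ((hCtyp.ctx.simple hf).1 _ _ hK'))
        (fun K hK => h.canonicalCtx.long_famIn hK) hA.1 hA'.1 (hA.long hcan.normalCtx)
        (hA'.long h.canonicalCtx.normalCtx) d₁ d' sA).2.2 M hM
      exact h.recovered_type (hr.recovered h.termOf r c)
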